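/- Let $N\ge 1$, let $J\in C_c^\infty(\mathbb R^N)$ be nonnegative and radially symmetric with $\int J=1$, put $Lv(x)=\int_{\mathbb R^N}J(x-y)\,(v(y)-v(x))\,dy$ and $\mathfrak a=\frac1{2N}\int_{\mathbb R^N}J(z)|z|^2\,dz$. Let $u_0\in L^\infty(\mathbb R^N)$, $u_0\ge 0$, be such that $|x|^\alpha u_0(x)\to A$ as $|x|\to\infty$ for some $0<\alpha\le N$ and $A>0$. Let $u$ be the bounded solution of $u_t=Lu$ in $\mathbb R^N\times(0,\infty)$ with $u(\cdot,0)=u_0$, and let $u_\Delta$ be the bounded solution of the heat equation $v_t=\mathfrak a\Delta v$ in $\mathbb R^N\times(0,\infty)$ with the same initial datum $u_0$. Then for every $0<\mu<\frac{\alpha}{2N}$ there is a constant $C_\mu$ such that $$t^{\alpha/2}\,\|u(\cdot,t)-u_\Delta(\cdot,t)\|_{L^\infty(\mathbb R^N)}\le C_\mu\,t^{-\mu}\qquad\text{for all }t>0 .$$ Moreover: (i) If $\alpha<N$, there is a constant $C$ with $u(x,t)\le C\,t^{-\alpha/2}$ for all $t>0$ and a.e. $x$, and for every $K>0$ $$t^{\alpha/2}\,\|u(\cdot,t)-U_{\alpha,A}(\cdot,t)\|_{L^\infty(|x|\le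 K\sqrt t)}\to 0\qquad\text{as }t\to\infty,$$ where $U_{\alpha,A}$ is the solution (nonnegative, and bounded on $\mathbb R^N\times[\tau,\infty)$ for each $\tau>0$) of $U_t=\mathfrak a\Delta U$ in $\mathbb R^N\times(0,\infty)$ with $U(x,0)=A|x|^{-\alpha}$. (ii) If $\alpha=N$, there is a constant $C$ with $u(x,t)\le C\,t^{-N/2}\log t$ for all $t\ge 2$ and a.e. $x$, and for every $K>0$ $$t^{N/2}\,\Big\|\frac{u(\cdot,t)}{\log t}-C_{A,N}\,U_{\mathfrak a}(\cdot,t)\Big\|_{L^\infty(|x|\le K\sqrt t)}\to 0\qquad\text{as }t\to\infty,$$ where $U_{\mathfrak a}(x,t)=(4\pi\mathfrak a t)^{-N/2}e^{-|x|^2/(4\mathfrak a t)}$ is the fundamental solution of the heat equation with diffusivity $\mathfrak a$, and $C_{A,N}$ is a constant that depends only on $A$ and $N$. Here initial data of the heat equation are attained in the sense that $\int v(x,t)\varphi(x)\,dx\to\int v(x,0)\varphi(x)\,dx$ as $t\to0^+$ for every $\varphi\in C_c(\mathbb R^N)$. -/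

import Mathlib

open MeasureTheory Filter Topology
open scoped ENNReal ContDiff

noncomputable section

/-- The spatial domain `ℝ^N` with its Euclidean norm. -/
abbrev RSpace (N : ℕ) : Type := EuclideanSpace ℝ (Fin N)

/-- The dispersal kernel: `J ∈ C_c^∞(ℝ^N)`, radially symmetric, nonnegative, with unit integral. -/
structure IsDispersalKernel {N : ℕ} (J : RSpace N → ℝ) : Prop where
  smooth : ContDiff ℝ ∞ J
  compactSupport : HasCompactSupport J
  radial : ∀ x y : RSpace N, ‖x‖ = ‖y‖ → J x = J y
  nonneg : ∀ x, 0 ≤ J x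
  integral_eq_one : ∫ x, J x = 1

/-- The diffusivity `𝔞 = (1 / (2N)) ∫ J(z) |z|² dz` attached to the kernel `J`; it is the number
with `Ĵ(ξ) = 1 - 𝔞 |ξ|² + o(|ξ|²)` for `Ĵ(ξ) = ∫ J(z) exp(-i ξ · z) dz`. -/
def diffusivity {N : ℕ} (J : RSpace N → ℝ) : ℝ :=
  (1 / (2 * (N : ℝ))) * ∫ z, J z * ‖z‖ ^ 2

/-- The nonlocal operator `(L v)(x) = ∫ J(x - y) (v(y) - v(x)) dy`. -/
def nonlocalOp {N : ℕ} (J v : RSpace N → ℝ) (x : RSpace N) : ℝ :=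
  ∫ y, J (x - y) * (v y - v x)

/-- `u` (written `u t x`, `t ≥ 0`) is a bounded solution of `u_t = L u` in `ℝ^N × (0, ∞)` with
initial datum `u(·, 0) = u₀ ∈ L^∞(ℝ^N)`. As `u₀` is only defined up to null sets, the equation is
required at every `t > 0` for almost every `x`, with one exceptional null set for all times. -/
structure IsNonlocalSolution {N : ℕ} (J u₀ : RSpace N → ℝ) (u : ℝ → RSpace N → ℝ) : Prop where
  aestronglyMeasurable : ∀ t, 0 ≤ t → AEStronglyMeasurable (u t) volume
  bounded : ∃ M : ℝ, ∀ t, 0 ≤ t → ∀ᵐ x, |u t x| ≤ M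
  initial : ∀ᵐ x, u 0 x = u₀ x
  continuous_at_zero : ∀ᵐ x, ContinuousWithinAt (fun s => u s x) (Set.Ici 0) 0
  equation : ∀ᵐ x, ∀ t, 0 < t → HasDerivAt (fun s => u s x) (nonlocalOp J (u t) x) t

/-- `v` (written `v t x`, `t > 0`) is a classical solution of `v_t = a Δ v` in `ℝ^N × (0, ∞)` with
initial datum `f`, attained in the sense of vague convergence: `∫ v(x,t) φ(x) dx → ∫ f(x) φ(x) dx`
as `t → 0⁺` for every continuous compactly supported `φ`. -/
structure IsHeatSolution {N : ℕ} (a : ℝ) (f : RSpace N → ℝ) (v : ℝ → RSpace N → ℝ) : Prop where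
  continuousOn : ContinuousOn (fun p : ℝ × RSpace N => v p.1 p.2) (Set.Ioi 0 ×ˢ Set.univ)
  contDiff : ∀ t, 0 < t → ContDiff ℝ 2 (v t)
  equation : ∀ t, 0 < t → ∀ x,
    HasDerivAt (fun s => v s x) (a * Laplacian.laplacian (v t) x) t
  initial : ∀ φ : RSpace N → ℝ, Continuous φ → HasCompactSupport φ →
    Tendsto (fun t => ∫ x, v t x * φ x) (𝓝[>] 0) (𝓝 (∫ x, f x * φ x))

/-- `v` is a bounded solution of the heat equation `v_t = a Δ v` with initial datum `f`
(the class in which the solution with a bounded datum is unique). -/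
structure IsBoundedHeatSolution {N : ℕ} (a : ℝ) (f : RSpace N → ℝ) (v : ℝ → RSpace N → ℝ) :
    Prop extends IsHeatSolution a f v where
  bounded : ∃ M : ℝ, ∀ t, 0 < t → ∀ x, |v t x| ≤ M

/-- `U` is the solution `U_{α,A}` of `U_t = a Δ U` with the unbounded initial datum `A / |x|^α`:
nonnegative, and bounded on `ℝ^N × [τ, ∞)` for every `τ > 0` (the solution is unique in this
class when `0 < α < N`). -/
structure IsPowerHeatSolution {N : ℕ} (a α A : ℝ) (U : ℝ → RSpace N → ℝ) :
    Prop extends IsHeatSolution a (fun x => A / ‖x‖ ^ α) U where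
  nonneg : ∀ t, 0 < t → ∀ x, 0 ≤ U t x
  bounded_of_pos : ∀ τ, 0 < τ → ∃ M : ℝ, ∀ t, τ ≤ t → ∀ x, U t x ≤ M

/-- The fundamental solution `U_a(x,t) = (4 π a t)^{-N/2} exp(-|x|² / (4 a t))` of the heat
equation with diffusivity `a`. -/
def heatKernel {N : ℕ} (a t : ℝ) (x : RSpace N) : ℝ :=
  (4 * Real.pi * a * t) ^ (-(N : ℝ) / 2) * Real.exp (-‖x‖ ^ 2 / (4 * a * t))

/-- The norm of `L^∞(|x| ≤ K √t)`. -/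
def parabolicSupNorm {N : ℕ} (K t : ℝ) (g : RSpace N → ℝ) : ℝ≥0∞ :=
  eLpNorm g ∞ (volume.restrict {x : RSpace N | ‖x‖ ≤ K * √t})

end

/-! ### The Laplacian along coordinate lines and the maximum principle -/

/-! The symbol of `L` is `Ĵ - 1`. In the normalisation of `cosTransform`, `Ĵ(ξ) = 1 - 4π²𝔞|ξ|² +
O(|ξ|⁴)`, so at low frequencies `L` acts like `𝔞Δ`, while `Ĵ ≤ 1 - δ` away from the origin makes the
high frequencies decay exponentially. There is no smoothing: `u(t) = e^{-t} u₀ + W_t * u₀` with `W_t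
= e^{-t} ∑_{k≥1} (t^k/k!) J^{*k}`, and only `W_t` is a function. Its symbol differs from that of the
heat kernel `G_t` by `O(t^{-(N+1)/2})` in `L¹`, and Fourier inversion turns this into a sup bound
for `W_t - G_t`. The series is never summed in physical space: finite truncations are used, their
order chosen after `t` (`partialKernel_sub_heatKernel_le`), and the remainder is controlled by
iterating Duhamel's formula (`nonlocal_solution_expansion`).

A kernel with sup bound `B` and bounded mass, integrated against a datum of size `|y|^{-β}` with `β
< N`, gives at most a constant times `B^{β/N}` (`integral_mul_le_of_le_rpow`). With `B ~
t^{-(N+1)/2}` this is `t^{-β(N+1)/(2N)}`, and choosing `β < α` suitably gives every rate `α/2 + μ`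
with `μ < α/(2N)`, also when `α = N`.

The rest concerns the heat equation. In both solution classes the solution is `G_t` convolved with
the datum: a maximum principle with a quadratic barrier gives the semigroup identity from a time `s
> 0`, and `s → 0` is taken with Gaussian control of the tails (`heat_representation`). If `α < N`,
the difference `u₀ - A|x|^{-α}` is small relative to `|x|^{-α}` at infinity, so its heat flow is
`o(t^{-α/2})` (`heatFlow_decay_of_small_at_infinity`). If `α = N`, the heat flow is `G_t` times the
mass of `u₀` in `|y| ≤ √t`, up to `O(t^{-N/2})`; that mass grows like `Aσ log √t`, with `σ` the area
of the unit sphere, whence the constant `Aσ/2` (`heatFlow_critical_asymptotics`). Both limits hold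
uniformly on all of space. -/

lemma deriv_comp_line {E : Type*} [NormedAddCommGroup E] [NormedSpace ℝ E] {f : E → ℝ}
    (hf : Differentiable ℝ f) (x e : E) (s : ℝ) :
    HasDerivAt (fun s : ℝ => f (x + s • e)) (fderiv ℝ f (x + s • e) e) s := by
  have h1 : HasDerivAt (fun s : ℝ => x + s • e) e s := by
    simpa using ((hasDerivAt_id s).smul_const e).const_add x
  exact (hf _).hasFDerivAt.comp_hasDerivAt s h1

lemma hasDerivAt_fderiv_line {E : Type*} [NormedAddCommGroup E] [NormedSpace ℝ E] {f : E → ℝ}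
    (hf : ContDiff ℝ 2 f) (x e : E) (s : ℝ) :
    HasDerivAt (fun s : ℝ => fderiv ℝ f (x + s • e) e)
      (iteratedFDeriv ℝ 2 f (x + s • e) ![e, e]) s := by
  have h1 : HasDerivAt (fun s : ℝ => x + s • e) e s := by
    simpa using ((hasDerivAt_id s).smul_const e).const_add x
  have h2 : Differentiable ℝ (fderiv ℝ f) :=
    (hf.fderiv_right (m := 1) (by norm_num)).differentiable (by norm_num)
  have h3 : HasDerivAt (fun s : ℝ => fderiv ℝ f (x + s • e))
      (fderiv ℝ (fderiv ℝ f) (x + s • e) e) s :=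
    (h2 (x + s • e)).hasFDerivAt.comp_hasDerivAt s h1
  have h4 := h3.clm_apply (hasDerivAt_const s e)
  rw [iteratedFDeriv_two_apply]
  simpa using h4

lemma iteratedFDeriv_two_line {E : Type*} [NormedAddCommGroup E] [NormedSpace ℝ E] {f : E → ℝ}
    (hf : ContDiff ℝ 2 f) (x e : E) :
    deriv (deriv (fun s : ℝ => f (x + s • e))) 0 = iteratedFDeriv ℝ 2 f x ![e, e] := by
  have h : deriv (fun s : ℝ => f (x + s • e)) = fun s => fderiv ℝ f (x + s • e) e :=
    funext fun s => (deriv_comp_line (hf.differentiable (by norm_num)) x e s).deriv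
  rw [h, (hasDerivAt_fderiv_line hf x e 0).deriv]
  simp

lemma laplacian_eq_sum_line {N : ℕ} {f : RSpace N → ℝ} (hf : ContDiff ℝ 2 f) (x : RSpace N) :
    Laplacian.laplacian f x =
      ∑ i, deriv (deriv (fun s : ℝ => f (x + s • EuclideanSpace.basisFun (Fin N) ℝ i))) 0 := by
  rw [InnerProductSpace.laplacian_eq_iteratedFDeriv_orthonormalBasis f
    (EuclideanSpace.basisFun (Fin N) ℝ)]
  exact Finset.sum_congr rfl fun i _ => (iteratedFDeriv_two_line hf x _).symm

/-- If the second derivative were positive, the critical point would also be a local minimum; the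
function would then be locally constant, with vanishing second derivative. -/
lemma deriv_deriv_nonpos_of_isLocalMax {g : ℝ → ℝ} {s : ℝ} (h : IsLocalMax g s)
    (hc : ContinuousAt g s) : deriv (deriv g) s ≤ 0 := by
  by_contra! hpos
  have hmin := isLocalMin_of_deriv_deriv_pos hpos h.deriv_eq_zero hc
  have hconst : g =ᶠ[𝓝 s] fun _ => g s := by
    filter_upwards [h, hmin] with y h1 h2 using le_antisymm h1 h2
  have := hconst.deriv.deriv_eq
  simp at this
  linarith

lemma laplacian_nonpos_of_isLocalMax {N : ℕ} {f : RSpace N → ℝ} (hf : ContDiff ℝ 2 f)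
    {x : RSpace N} (h : IsLocalMax f x) : Laplacian.laplacian f x ≤ 0 := by
  rw [laplacian_eq_sum_line hf]
  refine Finset.sum_nonpos fun i _ => deriv_deriv_nonpos_of_isLocalMax ?_ ?_
  · have hc : ContinuousAt (fun s : ℝ => x + s • EuclideanSpace.basisFun (Fin N) ℝ i) 0 := by
      fun_prop
    have h' : IsLocalMax f (x + (0 : ℝ) • EuclideanSpace.basisFun (Fin N) ℝ i) := by simpa using h
    exact IsLocalMax.comp_continuous (g := fun s : ℝ => x + s • EuclideanSpace.basisFun (Fin N) ℝ i) h' hc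
  · exact (hf.continuous.comp (by fun_prop)).continuousAt

lemma laplacian_norm_sq {N : ℕ} (x : RSpace N) :
    Laplacian.laplacian (fun x : RSpace N => ‖x‖ ^ 2) x = 2 * N := by
  rw [laplacian_eq_sum_line (contDiff_norm_sq ℝ)]
  have : ∀ i, deriv (deriv (fun s : ℝ =>
      ‖x + s • EuclideanSpace.basisFun (Fin N) ℝ i‖ ^ 2)) 0 = 2 := by
    intro i
    have h0 : (fun s : ℝ => ‖x + s • EuclideanSpace.basisFun (Fin N) ℝ i‖ ^ 2)
        = fun s => ‖x‖ ^ 2 + 2 * s * x i + s ^ 2 := by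
      funext s
      rw [norm_add_sq_real, inner_smul_right, norm_smul]
      simp [EuclideanSpace.inner_single_right]
      ring
    have h1 : ∀ s : ℝ, HasDerivAt (fun s : ℝ => ‖x‖ ^ 2 + 2 * s * x i + s ^ 2)
        (2 * x i + 2 * s) s := by
      intro s
      exact (((((hasDerivAt_id s).const_mul 2).mul_const (x i)).const_add (‖x‖ ^ 2)).fun_add
        (hasDerivAt_pow 2 s)).congr_deriv (by simp)
    rw [h0, show deriv (fun s : ℝ => ‖x‖ ^ 2 + 2 * s * x i + s ^ 2) = fun s => 2 * x i + 2 * s from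
      funext fun s => (h1 s).deriv]
    have h2 := ((hasDerivAt_id (0 : ℝ)).const_mul 2).const_add (2 * x i)
    exact h2.deriv.trans (by simp)
  rw [Finset.sum_congr rfl fun i _ => this i]
  simp [mul_comm]

lemma deriv_nonneg_of_max_left {g : ℝ → ℝ} {g' t : ℝ} (h : HasDerivAt g g' t) (ht : 0 < t)
    (hmax : ∀ s, 0 ≤ s → s ≤ t → g s ≤ g t) : 0 ≤ g' := by
  have h1 := (hasDerivAt_iff_tendsto_slope.1 h).mono_left
    (nhdsWithin_mono t (fun s (hs : s < t) => hs.ne) : 𝓝[<] t ≤ 𝓝[≠] t)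
  refine ge_of_tendsto h1 ?_
  filter_upwards [Ioo_mem_nhdsLT ht] with s hs
  rw [slope_def_field]
  exact div_nonneg_of_nonpos (sub_nonpos.2 (hmax s hs.1.le hs.2.le)) (by linarith [hs.2])

/-- The barrier `ε'(|x|² + ct)` with `ε' > ε` dominates `w` initially and, since `w ≤ M`, also far
out in space. A positive maximum of `w` minus the barrier would then be attained inside a ball at a
positive time, where the equation forbids it. Letting `ε' → ε` concludes. -/
theorem heat_max_principle {N : ℕ} {a T M ε : ℝ} (ha : 0 ≤ a) (hε : 0 ≤ ε)
    {w : ℝ → RSpace N → ℝ}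
    (hcont : ContinuousOn (fun p : ℝ × RSpace N => w p.1 p.2) (Set.Icc 0 T ×ˢ Set.univ))
    (hC2 : ∀ t, 0 < t → t ≤ T → ContDiff ℝ 2 (w t))
    (heq : ∀ t, 0 < t → t ≤ T → ∀ x,
      HasDerivAt (fun s => w s x) (a * Laplacian.laplacian (w t) x) t)
    (hM : ∀ t, 0 ≤ t → t ≤ T → ∀ x, w t x ≤ M)
    (h0 : ∀ x, w 0 x ≤ ε * ‖x‖ ^ 2) {t : ℝ} (ht : 0 ≤ t) (htT : t ≤ T) (x : RSpace N) :
    w t x ≤ ε * (‖x‖ ^ 2 + 2 * N * a * t) := by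
  have key : ∀ ε', ε < ε' → w t x ≤ ε' * (‖x‖ ^ 2 + (2 * N * a + (ε' - ε)) * t) := by
    intro ε' hε'
    have hpos : 0 < ε' := hε.trans_lt hε'
    -- The part `2Na` balances `aΔ|x|²`; the excess `ε' - ε` makes the barrier a strict
    -- supersolution.
    set c := 2 * N * a + (ε' - ε) with hc
    have hNa : 0 ≤ 2 * (N : ℝ) * a := by positivity
    have hcpos : 0 < c := by linarith
    by_contra! hlt
    set g : ℝ × RSpace N → ℝ := fun p => w p.1 p.2 - ε' * (‖p.2‖ ^ 2 + c * p.1) with hg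
    -- On the sphere of radius `R` the barrier already exceeds the bound `M`. Taking `R ≥ 1` and `R
    -- ≥ M/ε'` gives `ε'R² ≥ ε'R ≥ M`.
    obtain ⟨R, hR, hxR⟩ : ∃ R : ℝ, M ≤ ε' * R ^ 2 ∧ ‖x‖ ≤ R := by
      refine ⟨max ‖x‖ (max 1 (M / ε')), ?_, le_max_left _ _⟩
      set R := max ‖x‖ (max 1 (M / ε'))
      have h1 : 1 ≤ R := (le_max_left _ _).trans (le_max_right _ _)
      have h2 : M / ε' ≤ R := (le_max_right _ _).trans (le_max_right _ _)
      rw [div_le_iff₀ hpos] at h2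
      nlinarith [mul_le_mul_of_nonneg_left h1 (zero_le_one.trans h1)]
    have hK : IsCompact (Set.Icc 0 T ×ˢ Metric.closedBall (0 : RSpace N) R) :=
      isCompact_Icc.prod (isCompact_closedBall _ _)
    have hgc : ContinuousOn g (Set.Icc 0 T ×ˢ Metric.closedBall (0 : RSpace N) R) :=
      (hcont.mono (Set.prod_mono_right (Set.subset_univ _))).sub
        (Continuous.continuousOn (by fun_prop))
    obtain ⟨⟨t₀, x₀⟩, ⟨⟨ht0, ht0T⟩, hx0⟩, hmax⟩ := hK.exists_isMaxOn
      ⟨(t, x), ⟨⟨ht, htT⟩, by simpa using hxR⟩⟩ hgc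
    have hgt : 0 < g (t₀, x₀) :=
      lt_of_lt_of_le (sub_pos.2 hlt) (hmax (a := (t, x)) ⟨⟨ht, htT⟩, by simpa using hxR⟩)
    simp only at ht0 ht0T
    have hx0' : ‖x₀‖ ≤ R := by simpa using hx0
    have ht0p : 0 < t₀ := by
      rcases ht0.lt_or_eq with h | h
      · exact h
      · exfalso
        have := h0 x₀
        simp only [hg, ← h] at hgt
        nlinarith [sq_nonneg ‖x₀‖]
    have hx0l : ‖x₀‖ < R := by
      rcases hx0'.lt_or_eq with h | h
      · exact h
      · exfalso
        have := hM t₀ ht0 ht0T x₀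
        simp only [hg, h] at hgt
        have : 0 < ε' * (c * t₀) := by positivity
        nlinarith
    have hq : ContDiff ℝ 2 (fun y : RSpace N => ‖y‖ ^ 2) := contDiff_norm_sq ℝ
    have hq' : ContDiff ℝ 2 ((-ε') • fun y : RSpace N => ‖y‖ ^ 2) := contDiff_const.smul hq
    have hloc : IsLocalMax (w t₀ + (-ε') • fun y : RSpace N => ‖y‖ ^ 2) x₀ := by
      have : Metric.ball (0 : RSpace N) R ∈ 𝓝 x₀ := Metric.isOpen_ball.mem_nhds (by simpa using hx0l)
      filter_upwards [this] with y hy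
      have := hmax (a := (t₀, y)) ⟨⟨ht0, ht0T⟩, Metric.ball_subset_closedBall hy⟩
      simp only [hg, Set.mem_ofPred_eq] at this
      simp only [Pi.add_apply, Pi.smul_apply, smul_eq_mul]
      linarith
    have hlap : Laplacian.laplacian (w t₀ + (-ε') • fun y : RSpace N => ‖y‖ ^ 2) x₀ ≤ 0 := laplacian_nonpos_of_isLocalMax ((hC2 t₀ ht0p ht0T).add hq') hloc
    rw [(hC2 t₀ ht0p ht0T).contDiffAt.laplacian_add hq'.contDiffAt,
      InnerProductSpace.laplacian_smul _ hq.contDiffAt, laplacian_norm_sq] at hlap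
    have hder : HasDerivAt (fun s => g (s, x₀)) (a * Laplacian.laplacian (w t₀) x₀ - ε' * c) t₀ := by
      have h1 := (((hasDerivAt_id t₀).const_mul c).const_add (‖x₀‖ ^ 2)).const_mul ε'
      exact ((heq t₀ ht0p ht0T x₀).fun_sub h1).congr_deriv (by simp)
    -- Only earlier times are compared, since the maximum may sit at the final time `T`.
    have hnn := deriv_nonneg_of_max_left hder ht0p fun s hs hst =>
      hmax (a := (s, x₀)) ⟨⟨hs, hst.trans ht0T⟩, hx0⟩
    simp only [smul_eq_mul] at hlap
    have h3 : a * Laplacian.laplacian (w t₀) x₀ ≤ a * (ε' * (2 * N)) :=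
      mul_le_mul_of_nonneg_left (by linarith) ha
    have h4 : 0 < ε' * (ε' - ε) := mul_pos hpos (by linarith)
    rw [hc] at hnn
    nlinarith
  have hlim : Tendsto (fun ε' : ℝ => ε' * (‖x‖ ^ 2 + (2 * N * a + (ε' - ε)) * t)) (𝓝[>] ε)
      (𝓝 (ε * (‖x‖ ^ 2 + (2 * N * a + (ε - ε)) * t))) :=
    (Continuous.tendsto (by fun_prop) ε).mono_left nhdsWithin_le_nhds
  rw [sub_self, add_zero] at hlim
  exact ge_of_tendsto hlim (eventually_mem_nhdsWithin.mono fun ε' h => key ε' h)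

/-! ### The heat kernel -/

section HeatKernel

variable {N : ℕ} {a t : ℝ}

lemma heatKernel_pos (ha : 0 < a) (ht : 0 < t) (x : RSpace N) : 0 < heatKernel a t x := by
  unfold heatKernel
  have := Real.pi_pos
  positivity

lemma continuous_heatKernel : Continuous (heatKernel a t : RSpace N → ℝ) := by
  unfold heatKernel
  fun_prop

lemma heatKernel_eq_mul_exp (x : RSpace N) : heatKernel a t x =
    (4 * Real.pi * a * t) ^ (-(N : ℝ) / 2) * Real.exp (-(1 / (4 * a * t)) * ‖x‖ ^ 2) := by
  unfold heatKernel
  congr 2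
  ring

lemma integral_heatKernel (ha : 0 < a) (ht : 0 < t) : ∫ x : RSpace N, heatKernel a t x = 1 := by
  simp_rw [heatKernel_eq_mul_exp]
  rw [integral_const_mul, GaussianFourier.integral_rexp_neg_mul_sq_norm (by positivity),
    show Real.pi / (1 / (4 * a * t)) = 4 * Real.pi * a * t by field_simp,
    finrank_euclideanSpace_fin, ← Real.rpow_add (by have := Real.pi_pos; positivity)]
  simp [neg_div]

lemma integrable_heatKernel (ha : 0 < a) (ht : 0 < t) :
    Integrable (heatKernel a t : RSpace N → ℝ) := by
  by_contra h
  have := integral_heatKernel (N := N) ha ht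
  rw [integral_undef h] at this
  exact zero_ne_one this

lemma heatKernel_le (ha : 0 < a) (ht : 0 < t) (x : RSpace N) :
    heatKernel a t x ≤ (4 * Real.pi * a * t) ^ (-(N : ℝ) / 2) := by
  unfold heatKernel
  have := Real.pi_pos
  refine mul_le_of_le_one_right (by positivity) (Real.exp_le_one_iff.2 ?_)
  rw [neg_div]
  exact neg_nonpos.2 (by positivity)

lemma heatKernel_scaling (ha : 0 < a) (ht : 0 < t) (x : RSpace N) :
    heatKernel a t x = t ^ (-(N : ℝ) / 2) * heatKernel a 1 ((√t)⁻¹ • x) := by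
  have := Real.pi_pos
  unfold heatKernel
  rw [Real.mul_rpow (by positivity) ht.le, norm_smul, mul_pow, norm_inv, inv_pow, Real.norm_eq_abs,
    sq_abs, Real.sq_sqrt ht.le, ← mul_assoc, mul_comm (t ^ _), mul_one]
  congr 2
  field_simp

lemma continuousOn_heatKernel_time (ha : 0 < a) :
    ContinuousOn (fun p : ℝ × RSpace N => heatKernel a p.1 p.2) (Set.Ioi 0 ×ˢ Set.univ) := by
  have := Real.pi_pos
  unfold heatKernel
  refine ContinuousOn.mul (ContinuousOn.rpow_const (by fun_prop) ?_) (ContinuousOn.rexp ?_)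
  · rintro p ⟨hp, -⟩
    have : 0 < p.1 := hp
    left; positivity
  · refine ContinuousOn.div (by fun_prop) (by fun_prop) ?_
    rintro p ⟨hp, -⟩
    have : 0 < p.1 := hp
    positivity

lemma hasDerivAt_heatKernel_time (ha : 0 < a) (ht : 0 < t) (x : RSpace N) :
    HasDerivAt (fun s => heatKernel a s x)
      ((‖x‖ ^ 2 / (4 * a * t ^ 2) - N / (2 * t)) * heatKernel a t x) t := by
  have hpi := Real.pi_pos
  unfold heatKernel
  have h1 : HasDerivAt (fun s : ℝ => 4 * Real.pi * a * s) (4 * Real.pi * a) t := by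
    simpa using (hasDerivAt_id t).const_mul (4 * Real.pi * a)
  have h2 := h1.rpow_const (p := -(N : ℝ) / 2) (Or.inl (by positivity))
  have h3 : HasDerivAt (fun s : ℝ => 4 * a * s) (4 * a) t := by
    simpa using (hasDerivAt_id t).const_mul (4 * a)
  have h4 := ((hasDerivAt_const t (-‖x‖ ^ 2)).fun_div h3 (by positivity)).exp
  refine (h2.fun_mul h4).congr_deriv ?_
  rw [Real.rpow_sub_one (by positivity)]
  field_simp
  ring

lemma hasDerivAt_heatKernel_line (z e : RSpace N) (s : ℝ) :
    HasDerivAt (fun s : ℝ => heatKernel a t (z + s • e))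
      (-(inner ℝ (z + s • e) e / (2 * a * t)) * heatKernel a t (z + s • e)) s := by
  have h1 : HasDerivAt (fun s : ℝ => z + s • e) e s := by
    simpa using ((hasDerivAt_id s).smul_const e).const_add z
  have h2 := ((h1.norm_sq.fun_neg.div_const (4 * a * t)).exp).const_mul
    ((4 * Real.pi * a * t) ^ (-(N : ℝ) / 2))
  unfold heatKernel
  refine h2.congr_deriv ?_
  by_cases h : a * t = 0
  · have h' : 2 * a * t = 0 := by rw [mul_assoc, h, mul_zero]
    have h'' : 4 * a * t = 0 := by rw [mul_assoc, h, mul_zero]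
    simp [h', h'']
  · have ha : a ≠ 0 := left_ne_zero_of_mul h
    have ht : t ≠ 0 := right_ne_zero_of_mul h
    field_simp
    ring

lemma hasDerivAt_heatKernel_line_two (z e : RSpace N) (he : ‖e‖ = 1) (s : ℝ) :
    HasDerivAt (fun s : ℝ => -(inner ℝ (z + s • e) e / (2 * a * t)) * heatKernel a t (z + s • e))
      (((inner ℝ (z + s • e) e / (2 * a * t)) ^ 2 - 1 / (2 * a * t)) *
        heatKernel a t (z + s • e)) s := by
  have h1 : HasDerivAt (fun s : ℝ => inner ℝ (z + s • e) e) 1 s := by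
    have h0 : (fun s : ℝ => inner ℝ (z + s • e) e) = fun s => inner ℝ z e + s := by
      funext s
      rw [inner_add_left, real_inner_smul_left, real_inner_self_eq_norm_sq, he]
      simp
    rw [h0]
    exact (hasDerivAt_id s).const_add _
  refine ((h1.div_const (2 * a * t)).fun_neg.fun_mul
    (hasDerivAt_heatKernel_line z e s)).congr_deriv ?_
  ring

end HeatKernel

/-! ### The heat flow of a compactly supported function -/

/-- The convolution `G_t * f` with the heat kernel. -/
noncomputable def heatFlow {N : ℕ} (a : ℝ) (f : RSpace N → ℝ) (t : ℝ) (x : RSpace N) : ℝ :=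
  ∫ y, heatKernel a t (x - y) * f y

/-- Domination is automatic: a continuous `F'` is bounded on the compact product of a time interval
and the support of `f`. -/
lemma hasDerivAt_integral_of_hasCompactSupport {E : Type*} [NormedAddCommGroup E]
    [MeasurableSpace E] [BorelSpace E] [SecondCountableTopology E]
    {m : Measure E} [IsFiniteMeasureOnCompacts m]
    {F F' : ℝ → E → ℝ} {f : E → ℝ} (hf : Continuous f) (hs : HasCompactSupport f)
    {s₀ : ℝ} {U : Set ℝ} (hU : U ∈ 𝓝 s₀)
    (hF : ContinuousOn (fun p : ℝ × E => F p.1 p.2) (U ×ˢ Set.univ))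
    (hF' : ContinuousOn (fun p : ℝ × E => F' p.1 p.2) (U ×ˢ Set.univ))
    (hd : ∀ s ∈ U, ∀ y, HasDerivAt (fun s => F s y) (F' s y) s) :
    HasDerivAt (fun s => ∫ y, F s y * f y ∂m) (∫ y, F' s₀ y * f y ∂m) s₀ := by
  obtain ⟨ε, hε, hεU⟩ := Metric.nhds_basis_closedBall.mem_iff.1 hU
  have hK : IsCompact (Metric.closedBall s₀ ε ×ˢ tsupport f) := (isCompact_closedBall _ _).prod hs
  obtain ⟨C, hC⟩ := hK.exists_bound_of_continuousOn
    (hF'.mono (Set.prod_mono hεU (Set.subset_univ _)))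
  have hslice : ∀ {F : ℝ → E → ℝ}, ContinuousOn (fun p : ℝ × E => F p.1 p.2) (U ×ˢ Set.univ) →
      ∀ s ∈ U, Continuous (F s) := by
    intro F hF s hs
    have : ContinuousOn (fun y : E => F s y) Set.univ :=
      hF.comp (f := fun y : E => (s, y)) (by fun_prop) (fun y _ => ⟨hs, Set.mem_univ _⟩)
    exact continuousOn_univ.1 this
  have hcomp : ∀ {g : E → ℝ}, Continuous g → Integrable (fun y => g y * f y) m := fun hg =>
    (hg.mul hf).integrable_of_hasCompactSupport hs.mul_left
  refine (hasDerivAt_integral_of_dominated_loc_of_deriv_le (bound := fun y => C * ‖f y‖)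
    (F := fun s y => F s y * f y) (F' := fun s y => F' s y * f y)
    (Metric.closedBall_mem_nhds s₀ hε) ?_ ?_ ?_ ?_ ?_ ?_).2
  · filter_upwards [hU] with s hs using ((hslice hF s hs).mul hf).aestronglyMeasurable
  · exact hcomp (hslice hF s₀ (mem_of_mem_nhds hU))
  · exact ((hslice hF' s₀ (mem_of_mem_nhds hU)).mul hf).aestronglyMeasurable
  · refine Eventually.of_forall fun y s hs' => ?_
    rw [norm_mul]
    by_cases hy : y ∈ tsupport f
    · exact mul_le_mul_of_nonneg_right (hC (s, y) ⟨hs', hy⟩) (norm_nonneg _)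
    · simp [image_eq_zero_of_notMem_tsupport hy]
  · exact (hf.norm.integrable_of_hasCompactSupport hs.norm).const_mul C
  · exact Eventually.of_forall fun y s hs' => (hd s (hεU hs') y).mul_const _

section HeatFlow

variable {N : ℕ} {a t : ℝ} {f : RSpace N → ℝ}

/-- The right-hand side still makes sense at `t = 0`, where it equals `f x`. It serves as the
continuous extension of the flow up to the initial time, which the maximum principle requires. -/
lemma heatFlow_eq_integral_scaled (ha : 0 < a) (ht : 0 < t) (x : RSpace N) :
    heatFlow a f t x = ∫ z, heatKernel a 1 z * f (x - √t • z) := by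
  have hst := Real.sqrt_pos.2 ht
  have h1 := Measure.integral_comp_smul (volume : Measure (RSpace N))
    (fun y => heatKernel a t y * f (x - y)) (√t)
  have h2 : heatFlow a f t x = ∫ y, heatKernel a t y * f (x - y) := by
    unfold heatFlow
    rw [← integral_sub_left_eq_self _ volume x]
    simp
  rw [h2]
  have h3 : ∀ z : RSpace N, heatKernel a t (√t • z) = t ^ (-(N : ℝ) / 2) * heatKernel a 1 z := by
    intro z
    rw [heatKernel_scaling ha ht, inv_smul_smul₀ hst.ne']
  simp_rw [h3, mul_assoc] at h1
  rw [integral_const_mul, finrank_euclideanSpace_fin, smul_eq_mul] at h1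
  have h4 : |(√t ^ N)⁻¹| = t ^ (-(N : ℝ) / 2) := by
    rw [abs_of_pos (by positivity), Real.sqrt_eq_rpow, ← Real.rpow_natCast, ← Real.rpow_mul ht.le,
      ← Real.rpow_neg ht.le]
    congr 1
    ring
  rw [h4] at h1
  exact (mul_left_cancel₀ (Real.rpow_pos_of_pos ht _).ne' h1).symm

lemma continuous_integral_scaled (ha : 0 < a) (hf : Continuous f) (hs : HasCompactSupport f) :
    Continuous (fun p : ℝ × RSpace N => ∫ z, heatKernel a 1 z * f (p.2 - √p.1 • z)) := by
  obtain ⟨C, hC⟩ := hs.exists_bound_of_continuous hf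
  refine continuous_of_dominated (bound := fun z => heatKernel a 1 z * C) (fun p => ?_)
    (fun p => Eventually.of_forall fun z => ?_)
    ((integrable_heatKernel ha one_pos).mul_const C) (Eventually.of_forall fun z => ?_)
  · exact (continuous_heatKernel.mul (by fun_prop)).aestronglyMeasurable
  · rw [norm_mul, Real.norm_of_nonneg (heatKernel_pos ha one_pos z).le]
    exact mul_le_mul_of_nonneg_left (hC _) (heatKernel_pos ha one_pos z).le
  · fun_prop

lemma abs_integral_scaled_le (ha : 0 < a) {C : ℝ} (hC : ∀ x, |f x| ≤ C) (t : ℝ) (x : RSpace N) :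
    |∫ z, heatKernel a 1 z * f (x - √t • z)| ≤ C := by
  have h := norm_integral_le_of_norm_le (f := fun z => heatKernel a 1 z * f (x - √t • z))
    ((integrable_heatKernel (N := N) ha one_pos).mul_const C)
    (Eventually.of_forall fun z => by
      rw [norm_mul, Real.norm_of_nonneg (heatKernel_pos ha one_pos z).le]
      exact mul_le_mul_of_nonneg_left (hC _) (heatKernel_pos ha one_pos z).le)
  rwa [integral_mul_const, integral_heatKernel ha one_pos, one_mul] at h

/-- Regularity is taken from the compactly supported factor `f`; the explicit derivatives below
instead fall on the kernel. -/
lemma contDiff_heatFlow (hf : ContDiff ℝ 2 f) (hs : HasCompactSupport f) :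
    ContDiff ℝ 2 (heatFlow a f t) := by
  have h' : heatFlow a f t =
      convolution (heatKernel a t) f (ContinuousLinearMap.mul ℝ ℝ) volume := by
    funext x
    unfold heatFlow convolution
    rw [← integral_sub_left_eq_self _ volume x]
    simp
  rw [h']
  exact hs.contDiff_convolution_right (ContinuousLinearMap.mul ℝ ℝ)
    (continuous_heatKernel (N := N) (a := a) (t := t)).locallyIntegrable (μ := volume) (n := 2) hf

lemma hasDerivAt_heatFlow_time (ha : 0 < a) (ht : 0 < t) (hf : Continuous f)
    (hs : HasCompactSupport f) (x : RSpace N) :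
    HasDerivAt (fun s => heatFlow a f s x)
      (∫ y, ((‖x - y‖ ^ 2 / (4 * a * t ^ 2) - N / (2 * t)) * heatKernel a t (x - y)) * f y) t := by
  have hc : ContinuousOn (fun p : ℝ × RSpace N => heatKernel a p.1 (x - p.2))
      (Set.Ioi 0 ×ˢ Set.univ) :=
    (continuousOn_heatKernel_time ha).comp
      (f := fun p : ℝ × RSpace N => (p.1, x - p.2)) (by fun_prop) (fun p hp => ⟨hp.1, trivial⟩)
  refine hasDerivAt_integral_of_hasCompactSupport
    (F' := fun s y => (‖x - y‖ ^ 2 / (4 * a * s ^ 2) - N / (2 * s)) * heatKernel a s (x - y))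
    hf hs (Ioi_mem_nhds ht) hc ?_ (fun s hs y => hasDerivAt_heatKernel_time ha hs _)
  refine ContinuousOn.mul (ContinuousOn.sub (ContinuousOn.div (by fun_prop) (by fun_prop) ?_)
    (ContinuousOn.div (by fun_prop) (by fun_prop) ?_)) hc
  all_goals
    rintro p ⟨hp, -⟩
    have : 0 < p.1 := hp
    positivity

lemma deriv_deriv_heatFlow_line (hf : Continuous f) (hs : HasCompactSupport f)
    (x e : RSpace N) (he : ‖e‖ = 1) :
    deriv (deriv (fun s : ℝ => heatFlow a f t (x + s • e))) 0 =
      ∫ y, (((inner ℝ (x - y) e / (2 * a * t)) ^ 2 - 1 / (2 * a * t)) *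
        heatKernel a t (x - y)) * f y := by
  have hcomm : ∀ (s : ℝ) (y : RSpace N), x + s • e - y = (x - y) + s • e := fun s y => by abel
  have hK : Continuous (heatKernel a t : RSpace N → ℝ) := continuous_heatKernel
  have h1 : ∀ s₀ : ℝ, HasDerivAt (fun s : ℝ => heatFlow a f t (x + s • e))
      (∫ y, (-(inner ℝ (x - y + s₀ • e) e / (2 * a * t)) * heatKernel a t (x - y + s₀ • e)) * f y)
      s₀ := by
    intro s₀
    unfold heatFlow
    simp_rw [hcomm]
    exact hasDerivAt_integral_of_hasCompactSupport
      (F := fun s y => heatKernel a t (x - y + s • e))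
      (F' := fun s y => -(inner ℝ (x - y + s • e) e / (2 * a * t)) * heatKernel a t (x - y + s • e))
      hf hs univ_mem (Continuous.continuousOn (by fun_prop)) (Continuous.continuousOn (by fun_prop))
      (fun s _ y => hasDerivAt_heatKernel_line _ _ _)
  have h2 := hasDerivAt_integral_of_hasCompactSupport (m := volume) (s₀ := 0)
      (F := fun s y => -(inner ℝ (x - y + s • e) e / (2 * a * t)) * heatKernel a t (x - y + s • e))
      (F' := fun s y => ((inner ℝ (x - y + s • e) e / (2 * a * t)) ^ 2 - 1 / (2 * a * t)) *
        heatKernel a t (x - y + s • e))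
      hf hs univ_mem (Continuous.continuousOn (by fun_prop)) (Continuous.continuousOn (by fun_prop))
      (fun s _ y => hasDerivAt_heatKernel_line_two _ _ he _)
  rw [funext fun s => (h1 s).deriv, h2.deriv]
  simp

/-- Summing the second derivatives of the Gaussian over an orthonormal basis gives exactly the
integrand of the time derivative in `hasDerivAt_heatFlow_time`, so the flow solves the heat
equation. -/
lemma laplacian_heatFlow (ha : 0 < a) (ht : 0 < t) (hf : ContDiff ℝ 2 f)
    (hs : HasCompactSupport f) (x : RSpace N) :
    a * Laplacian.laplacian (heatFlow a f t) x =
      ∫ y, ((‖x - y‖ ^ 2 / (4 * a * t ^ 2) - N / (2 * t)) * heatKernel a t (x - y)) * f y := by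
  have hK : Continuous (heatKernel a t : RSpace N → ℝ) := continuous_heatKernel
  have hf' := hf.continuous
  have hint : ∀ i, Integrable (fun y => (((inner ℝ (x - y) (EuclideanSpace.basisFun (Fin N) ℝ i) /
      (2 * a * t)) ^ 2 - 1 / (2 * a * t)) * heatKernel a t (x - y)) * f y) := by
    intro i
    have h1 : Continuous (fun y => ((inner ℝ (x - y) (EuclideanSpace.basisFun (Fin N) ℝ i) /
      (2 * a * t)) ^ 2 - 1 / (2 * a * t)) * heatKernel a t (x - y)) := by fun_prop
    exact (h1.mul hf').integrable_of_hasCompactSupport hs.mul_left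
  rw [laplacian_eq_sum_line (contDiff_heatFlow hf hs)]
  rw [Finset.sum_congr rfl fun i _ => deriv_deriv_heatFlow_line (a := a) (t := t) hf' hs x
    (EuclideanSpace.basisFun (Fin N) ℝ i) (by simp)]
  rw [← integral_finsetSum (f := fun i y => (((inner ℝ (x - y) (EuclideanSpace.basisFun (Fin N) ℝ i) /
      (2 * a * t)) ^ 2 - 1 / (2 * a * t)) * heatKernel a t (x - y)) * f y) _ fun i _ =>
    hint i, ← integral_const_mul]
  congr 1
  funext y
  rw [← Finset.sum_mul, ← Finset.sum_mul, EuclideanSpace.real_norm_sq_eq, Finset.sum_sub_distrib]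
  simp only [EuclideanSpace.basisFun_apply, EuclideanSpace.inner_single_right, one_mul, div_pow,
    ← Finset.sum_div]
  simp
  field_simp
  ring

end HeatFlow

/-! ### Representation of solutions of the heat equation by the heat flow -/

section Representation

variable {N : ℕ} {a t : ℝ} {f : RSpace N → ℝ}

/-- A smooth cutoff equal to `1` on the ball of radius `R` and to `0` off the ball of radius
`2 R`. -/
noncomputable def ballBump (N : ℕ) {R : ℝ} (hR : 0 < R) : ContDiffBump (0 : RSpace N) :=
  ⟨R, 2 * R, hR, by linarith⟩

lemma ballBump_eq_one {R : ℝ} (hR : 0 < R) {x : RSpace N} (hx : ‖x‖ ≤ R) :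
    ballBump N hR x = 1 :=
  (ballBump N hR).one_of_mem_closedBall (mem_closedBall_zero_iff.2 hx)

lemma abs_one_sub_ballBump_le {R : ℝ} (hR : 0 < R) (x : RSpace N) :
    |1 - ballBump N hR x| ≤ 1 := by
  have h1 := (ballBump N hR).nonneg (x := x)
  have h2 := (ballBump N hR).le_one (x := x)
  rw [abs_le]; constructor <;> linarith

lemma integrable_heatKernel_sub (ha : 0 < a) (ht : 0 < t) (x : RSpace N) :
    Integrable (fun y => heatKernel a t (x - y)) :=
  (integrable_heatKernel ha ht).comp_sub_left x

lemma integral_heatKernel_sub (ha : 0 < a) (ht : 0 < t) (x : RSpace N) :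
    ∫ y, heatKernel a t (x - y) = 1 := by
  rw [integral_sub_left_eq_self _ volume x, integral_heatKernel ha ht]

lemma integrable_heatKernel_mul (ha : 0 < a) (ht : 0 < t) {M : ℝ}
    (hf : AEStronglyMeasurable f) (hM : ∀ᵐ y, |f y| ≤ M) (x : RSpace N) :
    Integrable (fun y => heatKernel a t (x - y) * f y) :=
  (integrable_heatKernel_sub ha ht x).mul_bdd hf hM

/-- At time `s` the solution and its truncation agree on the ball of radius `R`, and outside it they
differ by at most `M ≤ (M/R²)|y|²`. This is the initial condition of `heat_max_principle` with `ε =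
M/R²`; the sign `σ` yields both one-sided bounds. -/
lemma sub_heatFlow_bump_le {v : ℝ → RSpace N → ℝ} {s M σ R : ℝ} (ha : 0 < a) (hσ : |σ| = 1)
    (hcont : ContinuousOn (fun p : ℝ × RSpace N => v p.1 p.2) (Set.Ioi 0 ×ˢ Set.univ))
    (hC2 : ∀ t, 0 < t → ContDiff ℝ 2 (v t))
    (heq : ∀ t, 0 < t → ∀ x, HasDerivAt (fun s => v s x) (a * Laplacian.laplacian (v t) x) t)
    (hs : 0 < s) (hM : ∀ t, s ≤ t → ∀ x, |v t x| ≤ M) (hR : 0 < R) (ht : 0 < t)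
    (x : RSpace N) :
    σ * (v (s + t) x - heatFlow a (fun y => ballBump N hR y * v s y) t x) ≤
      M / R ^ 2 * (‖x‖ ^ 2 + 2 * N * a * t) := by
  set g : RSpace N → ℝ := fun y => ballBump N hR y * v s y with hg
  have hM0 : 0 ≤ M := (abs_nonneg _).trans (hM s le_rfl 0)
  have hg2 : ContDiff ℝ 2 g := (ballBump N hR).contDiff.mul (hC2 s hs)
  have hgs : HasCompactSupport g := (ballBump N hR).hasCompactSupport.mul_right
  have hgM : ∀ y, |g y| ≤ M := by
    intro y
    rw [hg, abs_mul, abs_of_nonneg (ballBump N hR).nonneg]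
    exact (mul_le_of_le_one_left (abs_nonneg _) (ballBump N hR).le_one).trans (hM s le_rfl y)
  -- The scaled form of the flow is used so that `w` is continuous down to `τ = 0`.
  set w : ℝ → RSpace N → ℝ := fun τ =>
    σ • (v (s + τ) - fun x => ∫ z, heatKernel a 1 z * g (x - √τ • z)) with hw
  have hwt : ∀ τ, 0 < τ → w τ = σ • (v (s + τ) - heatFlow a g τ) := by
    intro τ hτ
    simp only [hw]
    rw [show heatFlow a g τ = _ from funext fun x => heatFlow_eq_integral_scaled ha hτ x]
  have hC : ∀ τ, 0 < τ → ContDiff ℝ 2 (v (s + τ) - heatFlow a g τ) := fun τ hτ =>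
    (hC2 _ (add_pos hs hτ)).sub (contDiff_heatFlow hg2 hgs)
  have hmain := heat_max_principle (T := t) (M := 2 * M) (ε := M / R ^ 2) ha.le (by positivity)
    (w := w) ?_ ?_ ?_ ?_ ?_ ht.le le_rfl x
  · rw [hwt t ht] at hmain
    exact hmain
  · refine ContinuousOn.const_smul (ContinuousOn.sub ?_
      (continuous_integral_scaled ha hg2.continuous hgs).continuousOn) σ
    exact hcont.comp (f := fun p : ℝ × RSpace N => (s + p.1, p.2)) (by fun_prop)
      (fun p hp => ⟨add_pos_of_pos_of_nonneg hs hp.1.1, trivial⟩)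
  · intro τ hτ _
    rw [hwt τ hτ]
    exact contDiff_const.smul (hC τ hτ)
  · intro τ hτ _ x
    rw [hwt τ hτ, InnerProductSpace.laplacian_smul _ (hC τ hτ).contDiffAt,
      (hC2 _ (add_pos hs hτ)).contDiffAt.laplacian_sub (contDiff_heatFlow hg2 hgs).contDiffAt]
    have h1 : HasDerivAt (fun τ => v (s + τ) x)
        (a * Laplacian.laplacian (v (s + τ)) x) τ := by
      simpa using HasDerivAt.comp_const_add s τ (heq (s + τ) (add_pos hs hτ) x)
    have h2 := hasDerivAt_heatFlow_time ha hτ hg2.continuous hgs x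
    rw [← laplacian_heatFlow ha hτ hg2 hgs] at h2
    have h3 := (h1.fun_sub h2).const_mul σ
    have h4 : (fun τ => w τ x) =ᶠ[𝓝 τ] fun τ => σ * (v (s + τ) x - heatFlow a g τ x) := by
      filter_upwards [Ioi_mem_nhds hτ] with τ' hτ'
      rw [hwt τ' hτ']
      rfl
    refine (h3.congr_of_eventuallyEq h4).congr_deriv ?_
    simp only [smul_eq_mul]
    ring
  · intro τ hτ _ y
    refine (le_abs_self _).trans ?_
    have h1 := hM (s + τ) (by linarith) y
    have h2 := abs_integral_scaled_le ha hgM τ y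
    simp only [hw, Pi.smul_apply, Pi.sub_apply, smul_eq_mul, abs_mul, hσ, one_mul]
    exact (abs_sub _ _).trans (by linarith)
  · intro y
    have h1 : w 0 y = σ * (v s y * (1 - ballBump N hR y)) := by
      simp only [hw, Pi.smul_apply, Pi.sub_apply, smul_eq_mul, Real.sqrt_zero, zero_smul, sub_zero,
        add_zero, integral_mul_const, integral_heatKernel ha one_pos, hg]
      ring
    rw [h1]
    refine (le_abs_self _).trans ?_
    rw [abs_mul, hσ, one_mul]
    by_cases hy : ‖y‖ ≤ R
    · rw [ballBump_eq_one hR hy]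
      simp only [sub_self, mul_zero, abs_zero]
      positivity
    · rw [abs_mul]
      have h2 : M ≤ M / R ^ 2 * ‖y‖ ^ 2 := by
        rw [div_mul_eq_mul_div, le_div_iff₀ (by positivity)]
        gcongr
        exact (not_le.1 hy).le
      exact (mul_le_of_le_one_right (abs_nonneg _) (abs_one_sub_ballBump_le hR y)).trans
        ((hM s le_rfl y).trans h2)

/-- The cutoff radius tends to infinity: the error is `O(R^{-2})` at a fixed point, and the
truncated flows converge by dominated convergence. -/
theorem heat_semigroup {v : ℝ → RSpace N → ℝ} {s M : ℝ} (ha : 0 < a)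
    (hcont : ContinuousOn (fun p : ℝ × RSpace N => v p.1 p.2) (Set.Ioi 0 ×ˢ Set.univ))
    (hC2 : ∀ t, 0 < t → ContDiff ℝ 2 (v t))
    (heq : ∀ t, 0 < t → ∀ x, HasDerivAt (fun s => v s x) (a * Laplacian.laplacian (v t) x) t)
    (hs : 0 < s) (hM : ∀ t, s ≤ t → ∀ x, |v t x| ≤ M) (ht : 0 < t) (x : RSpace N) :
    v (s + t) x = heatFlow a (v s) t x := by
  have hpos : ∀ n : ℕ, (0 : ℝ) < n + 1 := fun n => by positivity
  have hbound : ∀ n : ℕ,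
      |v (s + t) x - heatFlow a (fun y => ballBump N (hpos n) y * v s y) t x| ≤
        M / ((n : ℝ) + 1) ^ 2 * (‖x‖ ^ 2 + 2 * N * a * t) := by
    intro n
    have h1 := sub_heatFlow_bump_le (σ := 1) ha (by simp) hcont hC2 heq hs hM (hpos n) ht x
    have h2 := sub_heatFlow_bump_le (σ := -1) ha (by simp) hcont hC2 heq hs hM (hpos n) ht x
    rw [abs_le]
    constructor <;> linarith
  have hlim1 : Tendsto (fun n : ℕ => M / ((n : ℝ) + 1) ^ 2 * (‖x‖ ^ 2 + 2 * N * a * t)) atTop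
      (𝓝 0) := by
    have h1 : Tendsto (fun n : ℕ => ((n : ℝ) + 1) ^ 2) atTop atTop :=
      (tendsto_pow_atTop two_ne_zero).comp
        (tendsto_atTop_add_const_right _ _ tendsto_natCast_atTop_atTop)
    simpa using (h1.const_div_atTop M).mul_const (‖x‖ ^ 2 + 2 * N * a * t)
  have hlim2 : Tendsto (fun n : ℕ => heatFlow a (fun y => ballBump N (hpos n) y * v s y) t x) atTop
      (𝓝 (heatFlow a (v s) t x)) := by
    have hvs := (hC2 s hs).continuous
    refine tendsto_integral_of_dominated_convergence (fun y => heatKernel a t (x - y) * M)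
      (fun n => ?_) ((integrable_heatKernel_sub ha ht x).mul_const M)
      (fun n => Eventually.of_forall fun y => ?_) (Eventually.of_forall fun y => ?_)
    · have hK : Continuous (heatKernel a t : RSpace N → ℝ) := continuous_heatKernel
      have hb : Continuous (ballBump N (hpos n)) := (ballBump N (hpos n)).continuous
      exact Continuous.aestronglyMeasurable (by fun_prop)
    · rw [norm_mul, Real.norm_of_nonneg (heatKernel_pos ha ht _).le]
      refine mul_le_mul_of_nonneg_left ?_ (heatKernel_pos ha ht _).le
      rw [norm_mul, Real.norm_of_nonneg (ballBump N (hpos n)).nonneg]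
      exact (mul_le_of_le_one_left (norm_nonneg _) (ballBump N (hpos n)).le_one).trans
        (hM s le_rfl y)
    · refine tendsto_const_nhds.congr' ?_
      filter_upwards [eventually_ge_atTop ⌈‖y‖⌉₊] with n hn
      have : ‖y‖ ≤ n + 1 := (Nat.le_ceil _).trans (by
        have : (⌈‖y‖⌉₊ : ℝ) ≤ n := by exact_mod_cast hn
        linarith)
      rw [ballBump_eq_one (hpos n) this, one_mul]
  have h3 := (tendsto_const_nhds (x := v (s + t) x)).sub hlim2
  have h4 : Tendsto (fun n : ℕ =>
      v (s + t) x - heatFlow a (fun y => ballBump N (hpos n) y * v s y) t x) atTop (𝓝 0) :=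
    squeeze_zero_norm hbound hlim1
  exact sub_eq_zero.1 (tendsto_nhds_unique h3 h4)

/-- The factor in front of the kernel at time `2t` is bounded and tends to zero at infinity. An
integral bound at time `2t` therefore gives small tails at time `t`. -/
lemma heatKernel_eq_mul_double (ha : 0 < a) (ht : 0 < t) (z : RSpace N) :
    heatKernel a t z =
      (2 ^ ((N : ℝ) / 2) * Real.exp (-‖z‖ ^ 2 / (8 * a * t))) * heatKernel a (2 * t) z := by
  have := Real.pi_pos
  unfold heatKernel
  have h1 : (4 * Real.pi * a * (2 * t)) ^ (-(N : ℝ) / 2) =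
      2 ^ (-(N : ℝ) / 2) * (4 * Real.pi * a * t) ^ (-(N : ℝ) / 2) := by
    rw [← Real.mul_rpow (by norm_num) (by positivity)]
    congr 1; ring
  have h2 : (2 : ℝ) ^ ((N : ℝ) / 2) * 2 ^ (-(N : ℝ) / 2) = 1 := by
    rw [← Real.rpow_add two_pos, neg_div, add_neg_cancel, Real.rpow_zero]
  have h3 : Real.exp (-‖z‖ ^ 2 / (4 * a * t)) = Real.exp (-‖z‖ ^ 2 / (8 * a * t)) *
      Real.exp (-‖z‖ ^ 2 / (4 * a * (2 * t))) := by
    rw [← Real.exp_add]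
    congr 1
    field_simp
    ring
  rw [h1, h3]
  linear_combination (-(4 * Real.pi * a * t) ^ (-(N : ℝ) / 2) * Real.exp (-‖z‖ ^ 2 / (8 * a * t)) *
      Real.exp (-‖z‖ ^ 2 / (4 * a * (2 * t)))) * h2

lemma abs_integral_sub_integral_mul_le {E : Type*} [MeasurableSpace E] {m : Measure E}
    {q χ h : E → ℝ} {η : ℝ} (hh : Integrable h m) (hq : ∀ y, |q y * (1 - χ y)| ≤ η)
    (h1 : Integrable (fun y => q y * h y) m) (h2 : Integrable (fun y => q y * χ y * h y) m) :
    |∫ y, q y * h y ∂m - ∫ y, q y * χ y * h y ∂m| ≤ η * ∫ y, |h y| ∂m := by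
  rw [← integral_sub h1 h2, ← integral_const_mul, ← Real.norm_eq_abs]
  refine norm_integral_le_of_norm_le (hh.abs.const_mul η) (Eventually.of_forall fun y => ?_)
  rw [Real.norm_eq_abs, show q y * h y - q y * χ y * h y = (q y * (1 - χ y)) * h y by ring, abs_mul]
  exact mul_le_mul_of_nonneg_right (hq y) (abs_nonneg _)

/-- The aim is to let `s → 0` in `v(s + t) = G_t * v(s)`, but the datum is attained only against
compactly supported functions and `G_t` is not one. By `heatKernel_eq_mul_double`, cutting `G_t` off
at a large radius costs at most `η ∫ G_{2t}|v(s)| ≤ ηM`, uniformly in `s`. The bound `hM` comes from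
boundedness in one solution class and from positivity in the other. -/
theorem heat_representation {v : ℝ → RSpace N → ℝ} (ha : 0 < a) (hv : IsHeatSolution a f v)
    (hb : ∀ τ, 0 < τ → ∃ M : ℝ, ∀ t, τ ≤ t → ∀ x, |v t x| ≤ M) (ht : 0 < t) (x : RSpace N)
    {M : ℝ} (hM : ∀ s, 0 < s → ∫ y, |heatKernel a (2 * t) (x - y) * v s y| ≤ M)
    (hf : Integrable (fun y => heatKernel a (2 * t) (x - y) * f y)) :
    v t x = heatFlow a f t x := by
  have h2t : 0 < 2 * t := by linarith
  set q : RSpace N → ℝ := fun y => 2 ^ ((N : ℝ) / 2) * Real.exp (-‖x - y‖ ^ 2 / (8 * a * t))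
    with hq
  have hqc : Continuous q := by fun_prop
  have hq0 : ∀ y, 0 ≤ q y := fun y => by positivity
  have hqle : ∀ y, |q y| ≤ 2 ^ ((N : ℝ) / 2) := by
    intro y
    rw [abs_of_nonneg (hq0 y)]
    refine mul_le_of_le_one_right (by positivity) (Real.exp_le_one_iff.2 ?_)
    rw [neg_div]
    exact neg_nonpos.2 (by positivity)
  have hflow : ∀ g : RSpace N → ℝ,
      heatFlow a g t x = ∫ y, q y * (heatKernel a (2 * t) (x - y) * g y) := by
    intro g
    unfold heatFlow
    simp_rw [heatKernel_eq_mul_double ha ht, mul_assoc, hq, mul_assoc]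
  set I := ∫ y, |heatKernel a (2 * t) (x - y) * f y| with hI
  have hI0 : 0 ≤ I := integral_nonneg fun y => abs_nonneg _
  have hM0 : 0 ≤ M := (integral_nonneg fun y => abs_nonneg _).trans (hM 1 one_pos)
  have key : ∀ η, 0 < η → |v t x - heatFlow a f t x| ≤ η * (M + I) := by
    intro η hη
    -- Beyond radius `R` the quotient `q` of the kernels at times `t` and `2t` is below `η`.
    obtain ⟨R, hR, hqR⟩ : ∃ R : ℝ, 0 < R ∧ ∀ y, R ≤ ‖y‖ → q y ≤ η := by
      have h1 : Tendsto q (cocompact _) (𝓝 0) := by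
        have h2 : Tendsto (fun y : RSpace N => ‖x - y‖) (cocompact _) atTop := by
          refine tendsto_norm_cocompact_atTop.comp ?_
          exact (Homeomorph.subLeft x).isClosedEmbedding.tendsto_cocompact
        have h3 := (tendsto_pow_atTop two_ne_zero).comp h2
        have h4 := Real.tendsto_exp_atBot.comp
          (tendsto_neg_atTop_atBot.comp (h3.atTop_div_const (r := 8 * a * t) (by positivity)))
        have h5 := h4.const_mul ((2 : ℝ) ^ ((N : ℝ) / 2))
        rw [mul_zero] at h5
        refine h5.congr fun y => ?_
        simp [hq, neg_div]
      have h2 := h1.eventually (gt_mem_nhds hη)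
      rw [← Metric.cobounded_eq_cocompact, eventually_iff,
        (hasBasis_cobounded_norm (E := RSpace N)).mem_iff] at h2
      obtain ⟨R, -, hR⟩ := h2
      exact ⟨max R 1, by positivity, fun y hy => (hR ((le_max_left _ _).trans hy)).le⟩
    set χ : RSpace N → ℝ := ⇑(ballBump N hR) with hχ
    have hχc : Continuous χ := (ballBump N hR).continuous
    have hχs : HasCompactSupport χ := (ballBump N hR).hasCompactSupport
    have hqχ : ∀ y, |q y * (1 - χ y)| ≤ η := by
      intro y
      by_cases hy : ‖y‖ ≤ R
      · rw [hχ, ballBump_eq_one hR hy]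
        simpa using hη.le
      · rw [abs_mul, abs_of_nonneg (hq0 y)]
        exact (mul_le_of_le_one_right (hq0 y) (abs_one_sub_ballBump_le hR y)).trans
          (hqR y (not_le.1 hy).le)
    have hqχ' : ∀ y, |q y * χ y| ≤ 2 ^ ((N : ℝ) / 2) := by
      intro y
      rw [abs_mul, hχ, abs_of_nonneg (ballBump N hR).nonneg]
      exact (mul_le_of_le_one_right (abs_nonneg _) (ballBump N hR).le_one).trans (hqle y)
    have happ : ∀ g : RSpace N → ℝ, Integrable (fun y => heatKernel a (2 * t) (x - y) * g y) →
        |heatFlow a g t x - ∫ y, g y * (heatKernel a t (x - y) * χ y)| ≤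
          η * ∫ y, |heatKernel a (2 * t) (x - y) * g y| := by
      intro g hg
      have h0 : ∫ y, g y * (heatKernel a t (x - y) * χ y) =
          ∫ y, q y * χ y * (heatKernel a (2 * t) (x - y) * g y) := by
        congr 1
        funext y
        rw [heatKernel_eq_mul_double ha ht]
        simp only [hq]
        ring
      rw [h0, hflow]
      exact abs_integral_sub_integral_mul_le hg hqχ
        (hg.bdd_mul hqc.aestronglyMeasurable (Eventually.of_forall hqle))
        (hg.bdd_mul (hqc.mul hχc).aestronglyMeasurable (Eventually.of_forall hqχ'))
    have hφ : Tendsto (fun s => ∫ y, v s y * (heatKernel a t (x - y) * χ y)) (𝓝[>] 0)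
        (𝓝 (∫ y, f y * (heatKernel a t (x - y) * χ y))) := by
      have hK : Continuous (heatKernel a t : RSpace N → ℝ) := continuous_heatKernel
      exact hv.initial _ (by fun_prop) hχs.mul_left
    have hvt : Tendsto (fun s => v (s + t) x) (𝓝[>] 0) (𝓝 (v t x)) := by
      have h1 : ContinuousAt (fun s => v s x) t := (hv.equation t ht x).continuousAt
      have h2 : Tendsto (fun s : ℝ => s + t) (𝓝[>] 0) (𝓝 t) := by
        have : Tendsto (fun s : ℝ => s + t) (𝓝 0) (𝓝 (0 + t)) :=
          Continuous.tendsto (by fun_prop) 0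
        rw [zero_add] at this
        exact this.mono_left nhdsWithin_le_nhds
      exact h1.tendsto.comp h2
    have h1 : ∀ᶠ s in 𝓝[>] (0 : ℝ),
        |v (s + t) x - ∫ y, v s y * (heatKernel a t (x - y) * χ y)| ≤ η * M := by
      filter_upwards [self_mem_nhdsWithin] with s hs
      obtain ⟨M', hM'⟩ := hb s hs
      rw [heat_semigroup ha hv.continuousOn hv.contDiff hv.equation hs hM' ht x]
      refine (happ (v s) ?_).trans (mul_le_mul_of_nonneg_left (hM s hs) hη.le)
      exact integrable_heatKernel_mul ha h2t (hv.contDiff s hs).continuous.aestronglyMeasurable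
        (Eventually.of_forall (hM' s le_rfl)) x
    have h2 := le_of_tendsto (hvt.sub hφ).abs h1
    have h3 := happ f hf
    have h4 := abs_sub_le (v t x) (∫ y, f y * (heatKernel a t (x - y) * χ y)) (heatFlow a f t x)
    rw [abs_sub_comm (heatFlow a f t x)] at h3
    linarith
  have hlim : Tendsto (fun η : ℝ => η * (M + I)) (𝓝[>] 0) (𝓝 (0 * (M + I))) :=
    (Continuous.tendsto (by fun_prop) 0).mono_left nhdsWithin_le_nhds
  rw [zero_mul] at hlim
  have := ge_of_tendsto hlim (eventually_mem_nhdsWithin.mono fun η h => key η h)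
  exact sub_eq_zero.1 (abs_nonpos_iff.1 this)

theorem IsBoundedHeatSolution.eq_heatFlow {v : ℝ → RSpace N → ℝ} (ha : 0 < a)
    (hv : IsBoundedHeatSolution a f v) (hf : MemLp f ∞) (ht : 0 < t) (x : RSpace N) :
    v t x = heatFlow a f t x := by
  obtain ⟨M, hM⟩ := hv.bounded
  have h2t : 0 < 2 * t := by linarith
  refine heat_representation (M := M) ha hv.toIsHeatSolution
    (fun τ hτ => ⟨M, fun t ht => hM t (hτ.trans_le ht)⟩) ht x (fun s hs => ?_)
    (integrable_heatKernel_mul ha h2t hf.1 (ae_le_lpNorm_exponent_top hf) x)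
  have h := integral_mono (μ := volume)
    (integrable_heatKernel_mul ha h2t (hv.contDiff s hs).continuous.aestronglyMeasurable
      (Eventually.of_forall (hM s hs)) x).abs
    ((integrable_heatKernel_sub ha h2t x).mul_const M) fun y => by
      simp only [abs_mul, abs_of_pos (heatKernel_pos ha h2t (x - y))]
      exact mul_le_mul_of_nonneg_left (hM s hs y) (heatKernel_pos ha h2t _).le
  rwa [integral_mul_const, integral_heatKernel_sub ha h2t, one_mul] at h

end Representation

/-! ### Integrals of powers of the norm and convolution estimates -/

section NormPowers

variable {N : ℕ}

/-- The surface area of the unit sphere, `N |B_1|`. -/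
noncomputable def sphereArea (N : ℕ) : ℝ :=
  N * volume.real (Metric.ball (0 : RSpace N) 1)

lemma sphereArea_nonneg : 0 ≤ sphereArea N := by
  unfold sphereArea
  positivity

lemma measurableSet_annulus (r ρ : ℝ) : MeasurableSet {y : RSpace N | ‖y‖ ∈ Set.Ioc r ρ} :=
  measurable_norm measurableSet_Ioc

lemma nontrivial_RSpace (hN : 0 < N) : Nontrivial (RSpace N) := by
  have : Nonempty (Fin N) := ⟨⟨0, hN⟩⟩
  exact inferInstanceAs (Nontrivial (EuclideanSpace ℝ (Fin N)))

lemma indicator_annulus (r ρ : ℝ) (f : ℝ → ℝ) :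
    Set.indicator {y : RSpace N | ‖y‖ ∈ Set.Ioc r ρ} (fun y => f ‖y‖) =
      fun y => (Set.Ioc r ρ).indicator f ‖y‖ := by
  funext y
  by_cases h : ‖y‖ ∈ Set.Ioc r ρ
  · rw [Set.indicator_of_mem h, Set.indicator_of_mem (s := {y : RSpace N | ‖y‖ ∈ Set.Ioc r ρ}) h]
  · rw [Set.indicator_of_notMem h,
      Set.indicator_of_notMem (s := {y : RSpace N | ‖y‖ ∈ Set.Ioc r ρ}) h]

lemma smul_indicator_Ioc (r ρ : ℝ) (f : ℝ → ℝ) :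
    (fun s : ℝ => s ^ (N - 1) • (Set.Ioc r ρ).indicator f s) =
      (Set.Ioc r ρ).indicator (fun s => s ^ (N - 1) * f s) := by
  funext s
  simp only [Set.indicator, smul_eq_mul, mul_ite, mul_zero]

lemma Ioc_subset_Ioi_zero {r ρ : ℝ} (hr : 0 ≤ r) : Set.Ioc r ρ ⊆ Set.Ioi 0 :=
  fun _ hs => lt_of_le_of_lt hr hs.1

lemma setIntegral_annulus {r ρ : ℝ} (hN : 0 < N) (hr : 0 ≤ r) (f : ℝ → ℝ) :
    ∫ y in {y : RSpace N | ‖y‖ ∈ Set.Ioc r ρ}, f ‖y‖ =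
      sphereArea N * ∫ s in Set.Ioc r ρ, s ^ (N - 1) * f s := by
  have := nontrivial_RSpace hN
  rw [← integral_indicator (measurableSet_annulus r ρ), indicator_annulus,
    integral_fun_norm_addHaar volume, finrank_euclideanSpace_fin, smul_indicator_Ioc,
    setIntegral_indicator measurableSet_Ioc, Set.inter_eq_right.2 (Ioc_subset_Ioi_zero hr),
    nsmul_eq_mul, smul_eq_mul, sphereArea, mul_assoc]

lemma integrableOn_annulus_iff {r ρ : ℝ} (hN : 0 < N) (hr : 0 ≤ r) (f : ℝ → ℝ) :
    IntegrableOn (fun y : RSpace N => f ‖y‖) {y : RSpace N | ‖y‖ ∈ Set.Ioc r ρ} ↔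
      IntegrableOn (fun s => s ^ (N - 1) * f s) (Set.Ioc r ρ) := by
  have := nontrivial_RSpace hN
  have h3 := integrable_fun_norm_addHaar (volume : Measure (RSpace N))
    (f := (Set.Ioc r ρ).indicator f)
  rwa [← indicator_annulus, integrable_indicator_iff (measurableSet_annulus r ρ),
    finrank_euclideanSpace_fin, smul_indicator_Ioc, integrableOn_indicator_iff measurableSet_Ioc,
    Set.inter_eq_left.2 (Ioc_subset_Ioi_zero hr)] at h3

lemma pow_mul_rpow_neg {s β : ℝ} (hN : 0 < N) (hs : 0 < s) :
    s ^ (N - 1) * s ^ (-β) = s ^ ((N : ℝ) - 1 - β) := by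
  rw [← Real.rpow_natCast, ← Real.rpow_add hs, Nat.cast_pred hN]
  congr 1

lemma integrableOn_annulus_rpow {r ρ β : ℝ} (hN : 0 < N) (hr : 0 ≤ r) (hβ : β < N ∨ 0 < r) :
    IntegrableOn (fun y : RSpace N => ‖y‖ ^ (-β)) {y : RSpace N | ‖y‖ ∈ Set.Ioc r ρ} := by
  refine (integrableOn_annulus_iff (ρ := ρ) hN hr (fun s => s ^ (-β))).2 ?_
  rw [integrableOn_congr_fun (fun s hs => pow_mul_rpow_neg hN (hr.trans_lt hs.1)) measurableSet_Ioc]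
  rcases le_or_gt ρ r with h | h
  · simp [h]
  rw [← intervalIntegrable_iff_integrableOn_Ioc_of_le h.le]
  rcases hβ with hβ | hr
  · exact intervalIntegral.intervalIntegrable_rpow' (by linarith)
  · refine intervalIntegral.intervalIntegrable_rpow (Or.inr ?_)
    rw [Set.uIcc_of_le h.le]
    exact fun h => absurd h.1 (not_le.2 hr)

lemma setIntegral_ball_rpow {ρ β : ℝ} (hN : 0 < N) (hρ : 0 ≤ ρ) (hβ : β < N) :
    ∫ y in {y : RSpace N | ‖y‖ ∈ Set.Ioc 0 ρ}, ‖y‖ ^ (-β) =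
      sphereArea N / (N - β) * ρ ^ ((N : ℝ) - β) := by
  rw [setIntegral_annulus hN le_rfl (fun s => s ^ (-β)),
    setIntegral_congr_fun measurableSet_Ioc (fun s hs => pow_mul_rpow_neg hN hs.1),
    ← intervalIntegral.integral_of_le hρ, integral_rpow (Or.inl (by linarith)),
    show (N : ℝ) - 1 - β + 1 = N - β by ring, Real.zero_rpow (by linarith)]
  ring

lemma setIntegral_annulus_inv_pow {r ρ : ℝ} (hN : 0 < N) (hr : 0 < r) (hρ : r ≤ ρ) :
    ∫ y in {y : RSpace N | ‖y‖ ∈ Set.Ioc r ρ}, ‖y‖ ^ (-(N : ℝ)) =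
      sphereArea N * (Real.log ρ - Real.log r) := by
  have h : ∀ s ∈ Set.Ioc r ρ, s ^ (N - 1) * s ^ (-(N : ℝ)) = s⁻¹ := by
    intro s hs
    rw [pow_mul_rpow_neg hN (hr.trans hs.1), ← Real.rpow_neg_one]
    congr 1
    ring
  rw [setIntegral_annulus hN hr.le (fun s => s ^ (-(N : ℝ))),
    setIntegral_congr_fun measurableSet_Ioc h, ← intervalIntegral.integral_of_le hρ,
    integral_inv_of_pos hr (hr.trans_le hρ), Real.log_div (hr.trans_le hρ).ne' hr.ne']

lemma ae_norm_pos (hN : 0 < N) : ∀ᵐ y : RSpace N, 0 < ‖y‖ := by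
  have := nontrivial_RSpace hN
  filter_upwards [Measure.ae_ne volume (0 : RSpace N)] with y hy using norm_pos_iff.2 hy

/-- A kernel bounded by `B` and of mass `m`, integrated against a function of size `|y|^{-β}`. -/
theorem integral_mul_le_of_le_rpow {k h : RSpace N → ℝ} {B C m β : ℝ} (hN : 0 < N)
    (hβ0 : 0 ≤ β) (hβ : β < N) (hC : 0 ≤ C) (hB : 0 < B) (hk : Integrable k)
    (hkB : ∀ y, |k y| ≤ B) (hkm : ∫ y, |k y| ≤ m) (hh : AEStronglyMeasurable h)
    (hhC : ∀ᵐ y, |h y| ≤ C * ‖y‖ ^ (-β)) :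
    Integrable (fun y => k y * h y) ∧
      |∫ y, k y * h y| ≤ C * (sphereArea N / (N - β) + m) * B ^ (β / N) := by
  have hN' : (0 : ℝ) < N := by exact_mod_cast hN
  -- This radius balances the two contributions: the sup bound inside gives `Bρ^{N-β}`, the mass
  -- bound outside gives `ρ^{-β}`, and both equal `B^{β/N}`.
  set ρ : ℝ := B ^ (-(1 / (N : ℝ))) with hρ
  have hρ0 : 0 < ρ := Real.rpow_pos_of_pos hB _
  set S := {y : RSpace N | ‖y‖ ∈ Set.Ioc 0 ρ} with hS
  set D : RSpace N → ℝ := fun y =>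
    B * C * S.indicator (fun y => ‖y‖ ^ (-β)) y + C * ρ ^ (-β) * |k y| with hD
  have hI : Integrable (S.indicator fun y : RSpace N => ‖y‖ ^ (-β)) :=
    (integrable_indicator_iff (measurableSet_annulus 0 ρ)).2
      (integrableOn_annulus_rpow hN le_rfl (Or.inl hβ))
  have hDi : Integrable D := (hI.const_mul _).add (hk.abs.const_mul _)
  have hle : ∀ᵐ y, ‖k y * h y‖ ≤ D y := by
    filter_upwards [hhC, ae_norm_pos hN] with y hy hy0
    rw [Real.norm_eq_abs, abs_mul]
    by_cases hyρ : ‖y‖ ≤ ρ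
    · have hyS : y ∈ S := ⟨hy0, hyρ⟩
      have h1 : |k y| * |h y| ≤ B * (C * ‖y‖ ^ (-β)) :=
        mul_le_mul (hkB y) hy (abs_nonneg _) hB.le
      have h2 : 0 ≤ C * ρ ^ (-β) * |k y| := by positivity
      simp only [hD, Set.indicator_of_mem hyS]
      linarith
    · have hyS : y ∉ S := fun h => hyρ h.2
      have h1 : ‖y‖ ^ (-β) ≤ ρ ^ (-β) :=
        Real.rpow_le_rpow_of_nonpos hρ0 (not_le.1 hyρ).le (by linarith)
      have h2 : |h y| ≤ C * ρ ^ (-β) := hy.trans (mul_le_mul_of_nonneg_left h1 hC)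
      have h3 := mul_le_mul_of_nonneg_left h2 (abs_nonneg (k y))
      simp only [hD, Set.indicator_of_notMem hyS]
      linarith
  refine ⟨hDi.mono' (hk.1.mul hh) hle, (norm_integral_le_of_norm_le hDi hle).trans ?_⟩
  rw [hD, integral_add (hI.const_mul _) (hk.abs.const_mul _), integral_const_mul,
    integral_const_mul, integral_indicator (measurableSet_annulus 0 ρ),
    setIntegral_ball_rpow hN hρ0.le hβ]
  have h1 : B * ρ ^ ((N : ℝ) - β) = B ^ (β / N) := by
    rw [hρ, ← Real.rpow_mul hB.le]
    nth_rewrite 1 [← Real.rpow_one B]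
    rw [← Real.rpow_add hB]
    congr 1
    field_simp
    ring
  have h2 : ρ ^ (-β) = B ^ (β / N) := by
    rw [hρ, ← Real.rpow_mul hB.le]
    congr 1
    field_simp
  rw [h2]
  have h3 : C * B ^ (β / N) * ∫ y, |k y| ≤ C * B ^ (β / N) * m :=
    mul_le_mul_of_nonneg_left hkm (by positivity)
  linear_combination h3 + (C * (sphereArea N / (N - β))) * h1

end NormPowers

/-! ### Decay of the heat flow -/

section Decay

variable {N : ℕ} {a t : ℝ} {f : RSpace N → ℝ}

lemma integral_abs_heatKernel_sub (ha : 0 < a) (ht : 0 < t) (x : RSpace N) :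
    ∫ y, |heatKernel a t (x - y)| = 1 := by
  simp_rw [abs_of_pos (heatKernel_pos ha ht _)]
  exact integral_heatKernel_sub ha ht x

/-- The general estimate for a kernel of mass `1` with sup bound `B = (4πat)^{-N/2}`, for which
`B^{β/N}` is of order `t^{-β/2}`. -/
lemma heatFlow_le_of_le_rpow {C β : ℝ} (hN : 0 < N) (ha : 0 < a) (ht : 0 < t) (hβ0 : 0 ≤ β)
    (hβ : β < N) (hC : 0 ≤ C) (hf : AEStronglyMeasurable f)
    (hfC : ∀ᵐ y, |f y| ≤ C * ‖y‖ ^ (-β)) (x : RSpace N) :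
    Integrable (fun y => heatKernel a t (x - y) * f y) ∧
    |heatFlow a f t x| ≤
      C * ((sphereArea N / (N - β) + 1) * (4 * Real.pi * a) ^ (-β / 2)) * t ^ (-β / 2) := by
  have hN' : (0 : ℝ) < N := by exact_mod_cast hN
  have hpi := Real.pi_pos
  have hkB : ∀ y, |heatKernel a t (x - y)| ≤ (4 * Real.pi * a * t) ^ (-(N : ℝ) / 2) := fun y => by
    rw [abs_of_pos (heatKernel_pos ha ht _)]
    exact heatKernel_le ha ht _
  obtain ⟨h1, h2⟩ := integral_mul_le_of_le_rpow (k := fun y => heatKernel a t (x - y))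
    (B := (4 * Real.pi * a * t) ^ (-(N : ℝ) / 2)) hN hβ0 hβ hC (by positivity)
    (integrable_heatKernel_sub ha ht x) hkB (integral_abs_heatKernel_sub ha ht x).le hf hfC
  refine ⟨h1, h2.trans_eq ?_⟩
  rw [← Real.rpow_mul (by positivity), show -(N : ℝ) / 2 * (β / N) = -β / 2 by field_simp,
    Real.mul_rpow (by positivity) ht.le]
  ring

lemma rpow_mul_heatKernel_le (ha : 0 < a) (ht : 0 < t) (x : RSpace N) :
    t ^ ((N : ℝ) / 2) * heatKernel a t x ≤ (4 * Real.pi * a) ^ (-(N : ℝ) / 2) := by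
  have hpi := Real.pi_pos
  have h := mul_le_mul_of_nonneg_left (heatKernel_le ha ht x)
    (Real.rpow_nonneg ht.le ((N : ℝ) / 2))
  refine h.trans_eq ?_
  rw [Real.mul_rpow (by positivity) ht.le, mul_left_comm, ← Real.rpow_add ht, neg_div,
    add_neg_cancel, Real.rpow_zero, mul_one]

/-- The part of `f` in a large ball is integrable because `α < N`, so it contributes `O(t^{-N/2}) =
o(t^{-α/2})`. The part outside satisfies the power bound with a constant as small as desired. -/
theorem heatFlow_decay_of_small_at_infinity {C α : ℝ} (hN : 0 < N) (ha : 0 < a) (hα0 : 0 ≤ α)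
    (hα : α < N) (hC : 0 ≤ C) (hf : AEStronglyMeasurable f)
    (hfC : ∀ᵐ y, |f y| ≤ C * ‖y‖ ^ (-α))
    (hsmall : ∀ ε, 0 < ε → ∃ R : ℝ, ∀ᵐ y, R ≤ ‖y‖ → |f y| ≤ ε * ‖y‖ ^ (-α)) {ε : ℝ} (hε : 0 < ε) :
    ∃ T : ℝ, ∀ t, T ≤ t → ∀ x, t ^ (α / 2) * |heatFlow a f t x| ≤ ε := by
  have hpi := Real.pi_pos
  have hNα : 0 < (N : ℝ) - α := by linarith
  set K := (sphereArea N / (N - α) + 1) * (4 * Real.pi * a) ^ (-α / 2) with hK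
  have hK0 : 0 < K := by
    have := sphereArea_nonneg (N := N)
    positivity
  obtain ⟨R, hR⟩ := hsmall (ε / 2 / K) (by positivity)
  set S := Metric.closedBall (0 : RSpace N) R with hS
  have hSm : MeasurableSet S := Metric.isClosed_closedBall.measurableSet
  have hfS : IntegrableOn f S := by
    have h1 : LocallyIntegrable f := by
      refine locallyIntegrable_of_norm_le_rpow (C := C) (α := α) ?_ ?_ hfC hf
      · simpa using Nat.succ_le_of_lt hN
      · simpa using hα
    exact h1.integrableOn_isCompact (isCompact_closedBall _ _)
  set I := ∫ y in S, |f y| with hI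
  have hI0 : 0 ≤ I := integral_nonneg fun y => abs_nonneg _
  have hbound : ∀ t, 0 < t → ∀ x, t ^ (α / 2) * |heatFlow a f t x| ≤
      (4 * Real.pi * a) ^ (-(N : ℝ) / 2) * I * t ^ (-((N - α) / 2)) + ε / 2 := by
    intro t ht x
    have hG := (heatFlow_le_of_le_rpow (t := t) hN ha ht hα0 hα hC hf hfC x).1
    have hin : |∫ y in S, heatKernel a t (x - y) * f y| ≤
        (4 * Real.pi * a * t) ^ (-(N : ℝ) / 2) * I := by
      rw [hI, ← integral_const_mul, ← Real.norm_eq_abs]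
      refine norm_integral_le_of_norm_le (hfS.abs.const_mul _) (Eventually.of_forall fun y => ?_)
      rw [Real.norm_eq_abs, abs_mul, abs_of_pos (heatKernel_pos ha ht _)]
      exact mul_le_mul_of_nonneg_right (heatKernel_le ha ht _) (abs_nonneg _)
    have hout : |∫ y in Sᶜ, heatKernel a t (x - y) * f y| ≤ ε / 2 / K * K * t ^ (-α / 2) := by
      have h1 := (heatFlow_le_of_le_rpow (f := Sᶜ.indicator f) (C := ε / 2 / K) hN ha ht hα0 hα
        (by positivity) (hf.indicator hSm.compl) ?_ x).2
      · rw [← integral_indicator hSm.compl]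
        convert h1 using 2
        unfold heatFlow
        congr 1
        funext y
        by_cases hy : y ∈ Sᶜ
        · simp [Set.indicator_of_mem hy]
        · simp [Set.indicator_of_notMem hy]
      · filter_upwards [hR] with y hy
        by_cases hyS : y ∈ Sᶜ
        · rw [Set.indicator_of_mem hyS]
          refine hy ?_
          have : ¬ ‖y‖ ≤ R := by simpa [hS] using hyS
          exact (not_le.1 this).le
        · rw [Set.indicator_of_notMem hyS, abs_zero]
          positivity
    have hsum : heatFlow a f t x = (∫ y in S, heatKernel a t (x - y) * f y) +
        ∫ y in Sᶜ, heatKernel a t (x - y) * f y := (integral_add_compl hSm hG).symm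
    have h3 : |heatFlow a f t x| ≤ (4 * Real.pi * a * t) ^ (-(N : ℝ) / 2) * I +
        ε / 2 * t ^ (-α / 2) := by
      rw [hsum]
      rw [div_mul_cancel₀ _ hK0.ne'] at hout
      exact (abs_add_le _ _).trans (add_le_add hin hout)
    refine (mul_le_mul_of_nonneg_left h3 (Real.rpow_nonneg ht.le _)).trans_eq ?_
    rw [Real.mul_rpow (by positivity) ht.le, mul_add]
    have h4 : t ^ (α / 2) * t ^ (-(N : ℝ) / 2) = t ^ (-((N - α) / 2)) := by
      rw [← Real.rpow_add ht]; congr 1; ring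
    have h5 : t ^ (α / 2) * t ^ (-α / 2) = 1 := by
      rw [← Real.rpow_add ht, neg_div, add_neg_cancel, Real.rpow_zero]
    linear_combination ((4 * Real.pi * a) ^ (-(N : ℝ) / 2) * I) * h4 + ε / 2 * h5
  have hlim := ((tendsto_rpow_neg_atTop (y := (N - α) / 2) (by positivity)).const_mul
    ((4 * Real.pi * a) ^ (-(N : ℝ) / 2) * I))
  rw [mul_zero] at hlim
  obtain ⟨T, hT⟩ := eventually_atTop.1 (hlim.eventually (gt_mem_nhds (half_pos hε)))
  refine ⟨max T 1, fun t ht x => ?_⟩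
  have h1 := hT t ((le_max_left _ _).trans ht)
  have h2 := hbound t (zero_lt_one.trans_le ((le_max_right _ _).trans ht)) x
  linarith

end Decay

/-- Positivity supplies the bound uniform in `s`: by the semigroup identity `∫ G_{2t}(x - y)|U(s,y)|
dy` equals `U(s + 2t, x)`, and `U` is bounded for times at least `2t`. -/
theorem IsPowerHeatSolution.eq_heatFlow {N : ℕ} {a α A t : ℝ} {U : ℝ → RSpace N → ℝ} (hN : 0 < N)
    (ha : 0 < a) (hα0 : 0 ≤ α) (hα : α < N) (hU : IsPowerHeatSolution a α A U) (ht : 0 < t)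
    (x : RSpace N) : U t x = heatFlow a (fun y => A / ‖y‖ ^ α) t x := by
  have h2t : 0 < 2 * t := by linarith
  have hb : ∀ τ, 0 < τ → ∃ M : ℝ, ∀ t, τ ≤ t → ∀ x, |U t x| ≤ M := by
    intro τ hτ
    obtain ⟨M, hM⟩ := hU.bounded_of_pos τ hτ
    refine ⟨M, fun t ht x => ?_⟩
    rw [abs_of_nonneg (hU.nonneg t (hτ.trans_le ht) x)]
    exact hM t ht x
  obtain ⟨M, hM⟩ := hb (2 * t) h2t
  have hf : AEStronglyMeasurable (fun y : RSpace N => A / ‖y‖ ^ α) :=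
    (measurable_const.div (measurable_norm.pow_const α)).aestronglyMeasurable
  refine heat_representation (M := M) ha hU.toIsHeatSolution hb ht x (fun s hs => ?_)
    (heatFlow_le_of_le_rpow (C := |A|) hN ha h2t hα0 hα (abs_nonneg A) hf
      (Eventually.of_forall fun y => ?_) x).1
  · obtain ⟨M', hM'⟩ := hb s hs
    have h1 := heat_semigroup ha hU.continuousOn hU.contDiff hU.equation hs hM' h2t x
    have h2 : ∫ y, |heatKernel a (2 * t) (x - y) * U s y| = U (s + 2 * t) x := by
      rw [h1]
      unfold heatFlow
      congr 1
      funext y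
      exact abs_of_nonneg (mul_nonneg (heatKernel_pos ha h2t _).le (hU.nonneg s hs y))
    rw [h2]
    exact (le_abs_self _).trans (hM _ (by linarith) x)
  · rw [abs_div, abs_of_nonneg (Real.rpow_nonneg (norm_nonneg y) α), Real.rpow_neg (norm_nonneg y)]
    rfl

/-! ### The heat flow of data with critical decay `|y|^{-N}` -/

/-- With `y = |r|/√c`, the derivative has size `(1/√c)·2y e^{-y²}`, and `2y ≤ y² + 1 ≤ e^{y²}`. -/
lemma abs_exp_neg_sq_div_sub_le {c : ℝ} (hc : 0 < c) (r s : ℝ) :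
    |Real.exp (-r ^ 2 / c) - Real.exp (-s ^ 2 / c)| ≤ 1 / √c * |r - s| := by
  have hd : ∀ r : ℝ, HasDerivAt (fun r : ℝ => Real.exp (-r ^ 2 / c))
      (Real.exp (-r ^ 2 / c) * (-(2 * r) / c)) r := by
    intro r
    have := ((hasDerivAt_pow 2 r).fun_neg.div_const c).exp
    exact this.congr_deriv (by simp)
  have hb : ∀ r : ℝ, ‖Real.exp (-r ^ 2 / c) * (-(2 * r) / c)‖ ≤ 1 / √c := by
    intro r
    have hsc := Real.sqrt_pos.2 hc
    have h1 : r ^ 2 / c + 1 ≤ Real.exp (r ^ 2 / c) := Real.add_one_le_exp _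
    have h2 : 2 * (|r| / √c) ≤ r ^ 2 / c + 1 := by
      have h3 : r ^ 2 / c = (|r| / √c) ^ 2 := by rw [div_pow, sq_abs, Real.sq_sqrt hc.le]
      rw [h3]
      nlinarith [sq_nonneg (|r| / √c - 1)]
    rw [Real.norm_eq_abs, abs_mul, abs_of_pos (Real.exp_pos _), neg_div, Real.exp_neg, abs_div,
      abs_neg, abs_mul, abs_of_pos hc, abs_two]
    rw [inv_mul_le_iff₀ (Real.exp_pos _)]
    calc 2 * |r| / c = 2 * (|r| / √c) * (1 / √c) := by
          field_simp
          rw [Real.sq_sqrt hc.le]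
      _ ≤ Real.exp (r ^ 2 / c) * (1 / √c) := by
          gcongr
          exact h2.trans h1
  have := Convex.norm_image_sub_le_of_norm_hasDerivWithin_le (s := Set.univ)
    (fun r _ => (hd r).hasDerivWithinAt) (fun r _ => hb r) convex_univ (Set.mem_univ s)
    (Set.mem_univ r)
  simpa using this

section Critical

variable {N : ℕ} {a t A C : ℝ} {f : RSpace N → ℝ}

lemma abs_heatKernel_sub_le (ha : 0 < a) (ht : 0 < t) (p q : RSpace N) :
    |heatKernel a t p - heatKernel a t q| ≤
      (4 * Real.pi * a * t) ^ (-(N : ℝ) / 2) * (1 / √(4 * a * t)) * ‖p - q‖ := by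
  have hpi := Real.pi_pos
  unfold heatKernel
  rw [← mul_sub, abs_mul,
    abs_of_pos (show 0 < (4 * Real.pi * a * t) ^ (-(N : ℝ) / 2) by positivity),
    mul_assoc ((4 * Real.pi * a * t) ^ (-(N : ℝ) / 2))]
  refine mul_le_mul_of_nonneg_left ?_ (by positivity)
  refine (abs_exp_neg_sq_div_sub_le (by positivity) _ _).trans ?_
  exact mul_le_mul_of_nonneg_left (abs_norm_sub_norm_le p q) (by positivity)

lemma measure_annulus_lt_top (r ρ : ℝ) : volume {y : RSpace N | ‖y‖ ∈ Set.Ioc r ρ} < ⊤ := by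
  refine (measure_mono (fun y hy => ?_)).trans_lt
    (measure_closedBall_lt_top (μ := volume) (x := (0 : RSpace N)) (r := ρ))
  exact mem_closedBall_zero_iff.2 hy.2

lemma integrableOn_annulus_of_bounded {M : ℝ} (hf : AEStronglyMeasurable f)
    (hM : ∀ᵐ y, |f y| ≤ M) (r ρ : ℝ) :
    IntegrableOn f {y : RSpace N | ‖y‖ ∈ Set.Ioc r ρ} :=
  Measure.integrableOn_of_bounded (measure_annulus_lt_top r ρ).ne hf (ae_restrict_of_ae hM)

/-- The mass up to a fixed radius `R` is a constant; beyond it `f` is within `ε'|y|^{-N}` of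
`A|y|^{-N}`, whose integral in polar coordinates is `Aσ(log ρ - log R)`. -/
lemma integral_annulus_div_log {M : ℝ} (hN : 0 < N) (hf : AEStronglyMeasurable f)
    (hM : ∀ᵐ y, |f y| ≤ M)
    (hlim : ∀ ε, 0 < ε → ∃ R : ℝ, ∀ᵐ y, R ≤ ‖y‖ →
      |f y - A * ‖y‖ ^ (-(N : ℝ))| ≤ ε * ‖y‖ ^ (-(N : ℝ))) {ε : ℝ} (hε : 0 < ε) :
    ∃ ρ₀ : ℝ, ∀ ρ, ρ₀ ≤ ρ →
      |(∫ y in {y : RSpace N | ‖y‖ ∈ Set.Ioc 0 ρ}, f y) / Real.log ρ - A * sphereArea N| ≤ ε := by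
  have hσ := sphereArea_nonneg (N := N)
  set ε' := ε / 2 / (sphereArea N + 1) with hε'
  have hε'0 : 0 < ε' := by positivity
  obtain ⟨R', hR'⟩ := hlim ε' hε'0
  set R := max R' 1 with hRdef
  have hR1 : 1 ≤ R := le_max_right _ _
  have hR0 : 0 < R := by linarith
  -- `K` bounds the terms that do not grow with `ρ`. The threshold `exp(2K/ε + 1)` makes `K ≤ (ε/2)
  -- log ρ`, and the `+ 1` keeps `log ρ` positive.
  set K := |∫ y in {y : RSpace N | ‖y‖ ∈ Set.Ioc 0 R}, f y| + |A| * sphereArea N * Real.log R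
    with hK
  refine ⟨max R (Real.exp (2 * K / ε + 1)), fun ρ hρ => ?_⟩
  have hRρ : R ≤ ρ := (le_max_left _ _).trans hρ
  have hlogR : 0 ≤ Real.log R := Real.log_nonneg hR1
  have hlog : 2 * K / ε + 1 ≤ Real.log ρ := by
    rw [Real.le_log_iff_exp_le (hR0.trans_le hRρ)]
    exact (le_max_right _ _).trans hρ
  have hK0 : 0 ≤ K := by positivity
  have hlog0 : 0 < Real.log ρ := by
    have : 0 ≤ 2 * K / ε := by positivity
    linarith
  have hKlog : K ≤ ε / 2 * Real.log ρ := by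
    have h1 : 2 * K / ε ≤ Real.log ρ := by linarith
    rw [div_le_iff₀ hε] at h1
    linarith
  have hunion : {y : RSpace N | ‖y‖ ∈ Set.Ioc 0 ρ} =
      {y : RSpace N | ‖y‖ ∈ Set.Ioc 0 R} ∪ {y : RSpace N | ‖y‖ ∈ Set.Ioc R ρ} := by
    ext y
    have := Set.Ioc_union_Ioc_eq_Ioc hR0.le hRρ
    exact Set.ext_iff.1 this.symm ‖y‖
  have hdisj : Disjoint {y : RSpace N | ‖y‖ ∈ Set.Ioc 0 R} {y : RSpace N | ‖y‖ ∈ Set.Ioc R ρ} :=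
    Set.disjoint_left.2 fun y h1 h2 => absurd h1.2 (not_le.2 h2.1)
  rw [hunion, setIntegral_union hdisj (measurableSet_annulus R ρ)
    (integrableOn_annulus_of_bounded hf hM 0 R) (integrableOn_annulus_of_bounded hf hM R ρ)]
  set S₁ := ∫ y in {y : RSpace N | ‖y‖ ∈ Set.Ioc 0 R}, f y
  set S₂ := ∫ y in {y : RSpace N | ‖y‖ ∈ Set.Ioc R ρ}, f y with hS₂
  have hpow : IntegrableOn (fun y : RSpace N => ‖y‖ ^ (-(N : ℝ)))
      {y : RSpace N | ‖y‖ ∈ Set.Ioc R ρ} := integrableOn_annulus_rpow hN hR0.le (Or.inr hR0)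
  have h2 : |S₂ - A * (sphereArea N * (Real.log ρ - Real.log R))| ≤
      ε' * (sphereArea N * (Real.log ρ - Real.log R)) := by
    rw [← setIntegral_annulus_inv_pow hN hR0 hRρ, hS₂, ← integral_const_mul, ← integral_const_mul,
      ← integral_sub (integrableOn_annulus_of_bounded hf hM R ρ) (hpow.const_mul A),
      ← Real.norm_eq_abs]
    refine norm_integral_le_of_norm_le (hpow.const_mul ε') ?_
    filter_upwards [ae_restrict_mem (measurableSet_annulus R ρ), ae_restrict_of_ae hR'] with y hy h
    exact h ((le_max_left _ _).trans hy.1.le)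
  have h3 : ε' * (sphereArea N * (Real.log ρ - Real.log R)) ≤ ε / 2 * Real.log ρ := by
    have h4 : ε' * sphereArea N ≤ ε / 2 := by
      rw [hε', div_mul_eq_mul_div, div_le_iff₀ (by positivity)]
      have : 0 ≤ ε / 2 := by positivity
      nlinarith
    calc ε' * (sphereArea N * (Real.log ρ - Real.log R))
        = ε' * sphereArea N * (Real.log ρ - Real.log R) := by ring
      _ ≤ ε' * sphereArea N * Real.log ρ :=
          mul_le_mul_of_nonneg_left (by linarith) (by positivity)
      _ ≤ ε / 2 * Real.log ρ := mul_le_mul_of_nonneg_right h4 hlog0.le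
  have h5 : (S₁ + S₂) / Real.log ρ - A * sphereArea N =
      (S₁ - A * sphereArea N * Real.log R +
        (S₂ - A * (sphereArea N * (Real.log ρ - Real.log R)))) / Real.log ρ := by
    field_simp
    ring
  rw [h5, abs_div, abs_of_pos hlog0, div_le_iff₀ hlog0]
  have h6 : |S₁ - A * sphereArea N * Real.log R| ≤ K := by
    refine (abs_sub _ _).trans_eq ?_
    rw [abs_mul, abs_mul, abs_of_nonneg hσ, abs_of_nonneg hlogR]
  calc |_| ≤ _ := abs_add_le _ _
    _ ≤ ε / 2 * Real.log ρ + ε / 2 * Real.log ρ :=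
        add_le_add (h6.trans hKlog) (h2.trans h3)
    _ = ε * Real.log ρ := by ring

/-- For `|y| ≤ √t`, replacing `G_t(x - y)` by `G_t(x)` costs `O(t^{-(N+1)/2})|y|` by the Lipschitz
bound; against `|y|^{-N}` the integral of `|y|^{1-N}` gives a factor `√t`. For `|y| > √t` one has
`|f| ≤ C t^{-N/2}`, and the kernel has mass one. -/
lemma heatFlow_sub_mass_mul_heatKernel_le {M : ℝ} (hN : 0 < N) (ha : 0 < a) (hC : 0 ≤ C)
    (hf : AEStronglyMeasurable f) (hM : ∀ᵐ y, |f y| ≤ M)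
    (hfC : ∀ᵐ y, |f y| ≤ C * ‖y‖ ^ (-(N : ℝ))) :
    ∃ K : ℝ, ∀ t, 0 < t → ∀ x, t ^ ((N : ℝ) / 2) * |heatFlow a f t x -
      heatKernel a t x * ∫ y in {y : RSpace N | ‖y‖ ∈ Set.Ioc 0 √t}, f y| ≤ K := by
  have hpi := Real.pi_pos
  refine ⟨(4 * Real.pi * a) ^ (-(N : ℝ) / 2) * (1 / √(4 * a)) * C * sphereArea N + C,
    fun t ht x => ?_⟩
  have hst := Real.sqrt_pos.2 ht
  set S := {y : RSpace N | ‖y‖ ∈ Set.Ioc 0 √t} with hS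
  have hSm : MeasurableSet S := measurableSet_annulus 0 √t
  have hint := integrable_heatKernel_mul ha ht hf hM x
  have hfS : IntegrableOn f S := integrableOn_annulus_of_bounded hf hM 0 √t
  have hsplit : heatFlow a f t x - heatKernel a t x * ∫ y in S, f y =
      (∫ y in S, (heatKernel a t (x - y) - heatKernel a t x) * f y) +
        ∫ y in Sᶜ, heatKernel a t (x - y) * f y := by
    simp_rw [sub_mul]
    rw [integral_sub hint.integrableOn (hfS.const_mul _), integral_const_mul]
    have : heatFlow a f t x = _ := (integral_add_compl hSm hint).symm
    rw [this]
    ring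
  set D := (4 * Real.pi * a * t) ^ (-(N : ℝ) / 2) * (1 / √(4 * a * t)) with hD
  have hD0 : 0 ≤ D := by positivity
  have hin : |∫ y in S, (heatKernel a t (x - y) - heatKernel a t x) * f y| ≤
      D * C * (sphereArea N * √t) := by
    have hβ : ((N : ℝ) - 1) < N := by linarith
    have h1 := setIntegral_ball_rpow hN hst.le hβ
    rw [show (N : ℝ) - (N - 1) = 1 by ring, div_one, Real.rpow_one] at h1
    rw [← h1, ← integral_const_mul, ← Real.norm_eq_abs]
    refine norm_integral_le_of_norm_le
      ((integrableOn_annulus_rpow hN le_rfl (Or.inl hβ)).const_mul _) ?_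
    filter_upwards [ae_restrict_mem hSm, ae_restrict_of_ae hfC] with y hy h
    rw [Real.norm_eq_abs, abs_mul]
    have h2 := abs_heatKernel_sub_le ha ht (x - y) x
    rw [sub_sub_cancel_left, norm_neg] at h2
    refine (mul_le_mul h2 h (abs_nonneg _) (by positivity)).trans_eq ?_
    have h3 : ‖y‖ ^ (-((N : ℝ) - 1)) = ‖y‖ * ‖y‖ ^ (-(N : ℝ)) := by
      rw [neg_sub, sub_eq_add_neg, Real.rpow_add hy.1, Real.rpow_one]
    rw [h3, hD]
    ring
  have hout : |∫ y in Sᶜ, heatKernel a t (x - y) * f y| ≤ C * t ^ (-((N : ℝ) / 2)) := by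
    have hki : Integrable (fun y => heatKernel a t (x - y) * (C * t ^ (-((N : ℝ) / 2)))) :=
      (integrable_heatKernel_sub ha ht x).mul_const _
    have h1 : |∫ y in Sᶜ, heatKernel a t (x - y) * f y| ≤
        ∫ y in Sᶜ, heatKernel a t (x - y) * (C * t ^ (-((N : ℝ) / 2))) := by
      rw [← Real.norm_eq_abs]
      refine norm_integral_le_of_norm_le hki.integrableOn ?_
      filter_upwards [ae_restrict_mem hSm.compl, ae_restrict_of_ae hfC,
        ae_restrict_of_ae (ae_norm_pos hN)] with y hy h hy0
      rw [Real.norm_eq_abs, abs_mul, abs_of_pos (heatKernel_pos ha ht _)]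
      refine mul_le_mul_of_nonneg_left (h.trans (mul_le_mul_of_nonneg_left ?_ hC))
        (heatKernel_pos ha ht _).le
      have hy' : √t ≤ ‖y‖ := by
        by_contra! hlt
        exact hy ⟨hy0, hlt.le⟩
      refine (Real.rpow_le_rpow_of_nonpos hst hy' (by simp)).trans_eq ?_
      rw [Real.sqrt_eq_rpow, ← Real.rpow_mul ht.le]
      congr 1
      ring
    refine h1.trans ((setIntegral_le_integral hki (Eventually.of_forall fun y =>
      mul_nonneg (heatKernel_pos ha ht _).le (by positivity))).trans_eq ?_)
    rw [integral_mul_const, integral_heatKernel_sub ha ht, one_mul]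
  rw [hsplit]
  refine (mul_le_mul_of_nonneg_left ((abs_add_le _ _).trans (add_le_add hin hout))
    (Real.rpow_nonneg ht.le _)).trans_eq ?_
  have h4 : t ^ ((N : ℝ) / 2) * t ^ (-((N : ℝ) / 2)) = 1 := by
    rw [← Real.rpow_add ht, add_neg_cancel, Real.rpow_zero]
  have h5 : D * √t = (4 * Real.pi * a) ^ (-(N : ℝ) / 2) * (1 / √(4 * a)) *
      t ^ (-((N : ℝ) / 2)) := by
    rw [hD, Real.mul_rpow (by positivity) ht.le, Real.sqrt_mul (by positivity), neg_div]
    field_simp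
  linear_combination (t ^ ((N : ℝ) / 2) * C * sphereArea N) * h5 + ((4 * Real.pi * a) ^ (-(N : ℝ) / 2) * (1 / √(4 * a)) * C * sphereArea N + C) * h4

/-- After division by `log t` the `O(t^{-N/2})` error is negligible. The factor `1/2` in the
constant comes from `log √t = (log t)/2`, as the relevant ball has radius `√t`. -/
theorem heatFlow_critical_asymptotics {M : ℝ} (hN : 0 < N) (ha : 0 < a) (hC : 0 ≤ C)
    (hf : AEStronglyMeasurable f) (hM : ∀ᵐ y, |f y| ≤ M)
    (hfC : ∀ᵐ y, |f y| ≤ C * ‖y‖ ^ (-(N : ℝ)))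
    (hlim : ∀ ε, 0 < ε → ∃ R : ℝ, ∀ᵐ y, R ≤ ‖y‖ →
      |f y - A * ‖y‖ ^ (-(N : ℝ))| ≤ ε * ‖y‖ ^ (-(N : ℝ))) {ε : ℝ} (hε : 0 < ε) :
    ∃ T : ℝ, ∀ t, T ≤ t → ∀ x, t ^ ((N : ℝ) / 2) *
      |heatFlow a f t x / Real.log t - A * sphereArea N / 2 * heatKernel a t x| ≤ ε := by
  have hpi := Real.pi_pos
  obtain ⟨K, hK⟩ := heatFlow_sub_mass_mul_heatKernel_le hN ha hC hf hM hfC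
  set P := (4 * Real.pi * a) ^ (-(N : ℝ) / 2) with hP
  have hP0 : 0 < P := by positivity
  obtain ⟨ρ₀, hρ₀⟩ := integral_annulus_div_log hN hf hM hlim (ε := ε / P) (by positivity)
  refine ⟨max (max 1 (ρ₀ ^ 2)) (Real.exp (2 * |K| / ε + 1)), fun t hT x => ?_⟩
  have ht1 : 1 ≤ t := ((le_max_left _ _).trans (le_max_left _ _)).trans hT
  have ht : 0 < t := by linarith
  have htρ : ρ₀ ≤ √t := Real.le_sqrt_of_sq_le (((le_max_right _ _).trans (le_max_left _ _)).trans hT)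
  have hlog : 2 * |K| / ε + 1 ≤ Real.log t := by
    rw [Real.le_log_iff_exp_le ht]
    exact (le_max_right _ _).trans hT
  have hlog0 : 0 < Real.log t := by
    have : 0 ≤ 2 * |K| / ε := by positivity
    linarith
  have hKlog : K / Real.log t ≤ ε / 2 := by
    rw [div_le_iff₀ hlog0]
    have h1 : 2 * |K| / ε ≤ Real.log t := by linarith
    rw [div_le_iff₀ hε] at h1
    linarith [le_abs_self K]
  have h1 := hK t ht x
  have h2 := hρ₀ √t htρ
  set S := ∫ y in {y : RSpace N | ‖y‖ ∈ Set.Ioc 0 √t}, f y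
  rw [Real.log_sqrt ht.le] at h2
  have h3 : heatFlow a f t x / Real.log t - A * sphereArea N / 2 * heatKernel a t x =
      (heatFlow a f t x - heatKernel a t x * S) / Real.log t +
        heatKernel a t x / 2 * (S / (Real.log t / 2) - A * sphereArea N) := by
    field_simp
    ring
  have h4 : t ^ ((N : ℝ) / 2) * |(heatFlow a f t x - heatKernel a t x * S) / Real.log t| ≤
      ε / 2 := by
    rw [abs_div, abs_of_pos hlog0, ← mul_div_assoc]
    exact (div_le_div_of_nonneg_right h1 hlog0.le).trans hKlog
  have h5 : t ^ ((N : ℝ) / 2) *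
      |heatKernel a t x / 2 * (S / (Real.log t / 2) - A * sphereArea N)| ≤ ε / 2 := by
    rw [abs_mul, abs_of_pos (half_pos (heatKernel_pos ha ht x)), ← mul_assoc, ← mul_div_assoc]
    have hG : t ^ ((N : ℝ) / 2) * heatKernel a t x ≤ P := rpow_mul_heatKernel_le ha ht x
    refine (mul_le_mul (div_le_div_of_nonneg_right hG two_pos.le) h2
      (abs_nonneg _) (by positivity)).trans_eq ?_
    field_simp
  rw [h3]
  refine (mul_le_mul_of_nonneg_left (abs_add_le _ _) (Real.rpow_nonneg ht.le _)).trans ?_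
  rw [mul_add]
  linarith

end Critical

/-! ### Iterated kernels and the Duhamel expansion of the nonlocal equation -/

section KernelConvolution

variable {N : ℕ} {J k f g : RSpace N → ℝ} {M : ℝ}

/-- The convolution `k * f` as an integral. -/
noncomputable def kernelConv (k f : RSpace N → ℝ) (x : RSpace N) : ℝ :=
  ∫ y, k (x - y) * f y

lemma kernelConv_eq_convolution (k f : RSpace N → ℝ) :
    kernelConv k f = convolution k f (ContinuousLinearMap.mul ℝ ℝ) volume :=
  funext fun _ => (convolution_mul_swap (μ := volume)).symm

lemma integrable_kernelConv (hk : Integrable k) (hf : AEStronglyMeasurable f)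
    (hM : ∀ᵐ y, |f y| ≤ M) (x : RSpace N) : Integrable (fun y => k (x - y) * f y) :=
  (hk.comp_sub_left x).mul_bdd hf hM

lemma abs_kernelConv_le (hk : Integrable k) (hM : ∀ᵐ y, |f y| ≤ M) (x : RSpace N) :
    |kernelConv k f x| ≤ (∫ y, |k y|) * M := by
  have h := norm_integral_le_of_norm_le (f := fun y => k (x - y) * f y)
    ((hk.comp_sub_left x).abs.mul_const M) (hM.mono fun y hy => by
      rw [norm_mul]
      exact mul_le_mul_of_nonneg_left hy (norm_nonneg _))
  rw [integral_mul_const, integral_sub_left_eq_self (fun y => |k y|) volume x] at h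
  exact h

lemma continuous_kernelConv (hk : Continuous k) (hs : HasCompactSupport k)
    (hf : LocallyIntegrable f) : Continuous (kernelConv k f) := by
  rw [kernelConv_eq_convolution]
  exact hs.continuous_convolution_left _ hk hf

lemma locallyIntegrable_of_bounded (hf : AEStronglyMeasurable f) (hM : ∀ᵐ y, |f y| ≤ M) :
    LocallyIntegrable f :=
  (memLp_top_of_bound hf M hM).locallyIntegrable le_top

lemma kernelConv_assoc (hJ : Continuous J) (hJs : HasCompactSupport J) (hk : Continuous k)
    (hks : HasCompactSupport k) (hf : AEStronglyMeasurable f) (hM : ∀ᵐ y, |f y| ≤ M) :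
    kernelConv (kernelConv J k) f = kernelConv J (kernelConv k f) := by
  have hfl := locallyIntegrable_of_bounded hf hM
  have hfn : LocallyIntegrable (fun x => ‖f x‖) :=
    locallyIntegrable_of_bounded (M := M) hf.norm (by simpa using hM)
  simp only [kernelConv_eq_convolution]
  funext x
  refine convolution_assoc _ _ _ _ (fun a b c => mul_assoc a b c) hJ.aestronglyMeasurable
    hk.aestronglyMeasurable hf (Eventually.of_forall fun y => ?_) (Eventually.of_forall fun y => ?_)
    ?_
  · exact hks.convolutionExists_right _ hJ.locallyIntegrable hk y
  · exact hks.norm.convolutionExists_left _ hk.norm hfn y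
  · exact hJs.norm.convolutionExists_left _ hJ.norm
      (hks.norm.continuous_convolution_left _ hk.norm hfn).locallyIntegrable x

/-- The iterated convolutions `J^{*(k+1)}`. -/
noncomputable def iterKernel (J : RSpace N → ℝ) : ℕ → RSpace N → ℝ
  | 0 => J
  | k + 1 => kernelConv J (iterKernel J k)

lemma IsDispersalKernel.continuous (hJ : IsDispersalKernel J) : Continuous J :=
  hJ.smooth.continuous

lemma IsDispersalKernel.integrable (hJ : IsDispersalKernel J) : Integrable J :=
  hJ.continuous.integrable_of_hasCompactSupport hJ.compactSupport

lemma iterKernel_continuous_hasCompactSupport (hJ : IsDispersalKernel J) (k : ℕ) :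
    Continuous (iterKernel J k) ∧ HasCompactSupport (iterKernel J k) := by
  induction k with
  | zero => exact ⟨hJ.continuous, hJ.compactSupport⟩
  | succ k ih =>
    refine ⟨continuous_kernelConv hJ.continuous hJ.compactSupport ih.1.locallyIntegrable, ?_⟩
    change HasCompactSupport (kernelConv J (iterKernel J k))
    rw [kernelConv_eq_convolution]
    exact hJ.compactSupport.convolution _ ih.2

lemma continuous_iterKernel (hJ : IsDispersalKernel J) (k : ℕ) : Continuous (iterKernel J k) :=
  (iterKernel_continuous_hasCompactSupport hJ k).1

lemma hasCompactSupport_iterKernel (hJ : IsDispersalKernel J) (k : ℕ) :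
    HasCompactSupport (iterKernel J k) :=
  (iterKernel_continuous_hasCompactSupport hJ k).2

lemma integrable_iterKernel (hJ : IsDispersalKernel J) (k : ℕ) : Integrable (iterKernel J k) :=
  (continuous_iterKernel hJ k).integrable_of_hasCompactSupport (hasCompactSupport_iterKernel hJ k)

lemma iterKernel_nonneg (hJ : IsDispersalKernel J) (k : ℕ) (x : RSpace N) :
    0 ≤ iterKernel J k x := by
  induction k generalizing x with
  | zero => exact hJ.nonneg x
  | succ k ih => exact integral_nonneg fun y => mul_nonneg (hJ.nonneg _) (ih y)

lemma integral_iterKernel (hJ : IsDispersalKernel J) (k : ℕ) : ∫ x, iterKernel J k x = 1 := by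
  induction k with
  | zero => exact hJ.integral_eq_one
  | succ k ih =>
    change ∫ x, kernelConv J (iterKernel J k) x = 1
    rw [kernelConv_eq_convolution,
      integral_convolution _ hJ.integrable (integrable_iterKernel hJ k), hJ.integral_eq_one, ih]
    simp

/-- Partial sums of the regular part `e^{-t} ∑_{k ≥ 1} (t^k / k!) J^{*k}` of the fundamental
solution of the nonlocal equation. -/
noncomputable def partialKernel (J : RSpace N → ℝ) (n : ℕ) (t : ℝ) (x : RSpace N) : ℝ :=
  Real.exp (-t) * ∑ k ∈ Finset.range n, t ^ (k + 1) / (k + 1).factorial * iterKernel J k x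

lemma continuous_partialKernel (hJ : IsDispersalKernel J) (n : ℕ) (t : ℝ) :
    Continuous (partialKernel J n t) := by
  have := continuous_iterKernel hJ
  unfold partialKernel
  fun_prop

lemma integrable_partialKernel (hJ : IsDispersalKernel J) (n : ℕ) (t : ℝ) :
    Integrable (partialKernel J n t) :=
  (integrable_finsetSum _ fun k _ => (integrable_iterKernel hJ k).const_mul _).const_mul _

lemma partialKernel_nonneg (hJ : IsDispersalKernel J) (n : ℕ) {t : ℝ} (ht : 0 ≤ t)
    (x : RSpace N) : 0 ≤ partialKernel J n t x :=
  mul_nonneg (Real.exp_pos _).le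
    (Finset.sum_nonneg fun k _ => mul_nonneg (by positivity) (iterKernel_nonneg hJ k x))

lemma integral_abs_partialKernel_le (hJ : IsDispersalKernel J) (n : ℕ) {t : ℝ} (ht : 0 ≤ t) :
    ∫ x, |partialKernel J n t x| ≤ 1 := by
  simp_rw [abs_of_nonneg (partialKernel_nonneg hJ n ht _)]
  unfold partialKernel
  rw [integral_const_mul, integral_finsetSum _
    fun k _ => (integrable_iterKernel hJ k).const_mul _]
  simp_rw [integral_const_mul, integral_iterKernel hJ, mul_one]
  have h := Real.sum_le_exp_of_nonneg ht (n + 1)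
  rw [Finset.sum_range_succ'] at h
  have h0 : (0 : ℝ) ≤ t ^ 0 / (Nat.factorial 0) := by positivity
  rw [Real.exp_neg, inv_mul_le_iff₀ (Real.exp_pos t)]
  linarith

lemma kernelConv_partialKernel (hJ : IsDispersalKernel J) (n : ℕ) (t : ℝ)
    (hf : AEStronglyMeasurable f) (hM : ∀ᵐ y, |f y| ≤ M) (x : RSpace N) :
    kernelConv (partialKernel J n t) f x = Real.exp (-t) *
      ∑ k ∈ Finset.range n, t ^ (k + 1) / (k + 1).factorial * kernelConv (iterKernel J k) f x := by
  unfold kernelConv partialKernel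
  simp_rw [mul_assoc, Finset.sum_mul]
  rw [integral_const_mul, integral_finsetSum]
  · simp_rw [mul_assoc, integral_const_mul]
  · intro k _
    simp_rw [mul_assoc]
    exact (integrable_kernelConv (integrable_iterKernel hJ k) hf hM x).const_mul _

lemma nonlocalOp_eq (hJ : IsDispersalKernel J) (hf : AEStronglyMeasurable f)
    (hM : ∀ᵐ y, |f y| ≤ M) (x : RSpace N) : nonlocalOp J f x = kernelConv J f x - f x := by
  unfold nonlocalOp kernelConv
  simp_rw [mul_sub]
  rw [integral_sub (integrable_kernelConv hJ.integrable hf hM x)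
    ((hJ.integrable.comp_sub_left x).mul_const _), integral_mul_const,
    integral_sub_left_eq_self J volume x, hJ.integral_eq_one, one_mul]

end KernelConvolution

/-! ### The Duhamel expansion -/

section Duhamel

variable {N : ℕ} {J u₀ : RSpace N → ℝ} {M : ℝ}

/-- Partial sums of `e^t` times the solution operator of the nonlocal equation. -/
noncomputable def partialSum (J u₀ : RSpace N → ℝ) (n : ℕ) (t : ℝ) (x : RSpace N) : ℝ :=
  u₀ x + ∑ k ∈ Finset.range n, t ^ (k + 1) / (k + 1).factorial * kernelConv (iterKernel J k) u₀ x

/-- Convolution with `J` raises each convolution power by one: `u₀` becomes the term `k = 0` and `n`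
terms become `n + 1`. The result is the time derivative of the partial sum of length `n + 1`. -/
lemma kernelConv_partialSum (hJ : IsDispersalKernel J) (hf : AEStronglyMeasurable u₀)
    (hM : ∀ᵐ y, |u₀ y| ≤ M) (n : ℕ) (t : ℝ) (x : RSpace N) :
    kernelConv J (partialSum J u₀ n t) x =
      ∑ k ∈ Finset.range (n + 1), t ^ k / k.factorial * kernelConv (iterKernel J k) u₀ x := by
  have hl := locallyIntegrable_of_bounded hf hM
  have hz : ∀ k, Integrable (fun y => J (x - y) * kernelConv (iterKernel J k) u₀ y) := fun k =>
    integrable_kernelConv hJ.integrable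
      (continuous_kernelConv (continuous_iterKernel hJ k) (hasCompactSupport_iterKernel hJ k)
        hl).aestronglyMeasurable
      (Eventually.of_forall (abs_kernelConv_le (integrable_iterKernel hJ k) hM)) x
  have hs : ∀ k, kernelConv (iterKernel J (k + 1)) u₀ x =
      ∫ y, J (x - y) * kernelConv (iterKernel J k) u₀ y := fun k =>
    congr_fun (kernelConv_assoc hJ.continuous hJ.compactSupport (continuous_iterKernel hJ k)
      (hasCompactSupport_iterKernel hJ k) hf hM) x
  rw [Finset.sum_range_succ']
  simp_rw [hs]
  have h1 : ∀ y, J (x - y) * partialSum J u₀ n t y = J (x - y) * u₀ y +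
      ∑ k ∈ Finset.range n, t ^ (k + 1) / (k + 1).factorial *
        (J (x - y) * kernelConv (iterKernel J k) u₀ y) := by
    intro y
    rw [partialSum, mul_add, Finset.mul_sum]
    congr 1
    exact Finset.sum_congr rfl fun k _ => by ring
  unfold kernelConv
  rw [integral_congr_ae (Eventually.of_forall h1),
    integral_add (integrable_kernelConv hJ.integrable hf hM x)
      (integrable_finsetSum _ fun k _ => (hz k).const_mul _),
    integral_finsetSum _ fun k _ => (hz k).const_mul _]
  simp_rw [integral_const_mul]
  simp [iterKernel, kernelConv, add_comm]

lemma hasDerivAt_partialSum (hJ : IsDispersalKernel J) (hf : AEStronglyMeasurable u₀)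
    (hM : ∀ᵐ y, |u₀ y| ≤ M) (n : ℕ) (t : ℝ) (x : RSpace N) :
    HasDerivAt (fun s => partialSum J u₀ (n + 1) s x)
      (kernelConv J (partialSum J u₀ n t) x) t := by
  rw [kernelConv_partialSum hJ hf hM]
  unfold partialSum
  refine (HasDerivAt.fun_sum fun k _ => ?_).const_add (u₀ x)
  refine ((((hasDerivAt_pow (k + 1) t).div_const _).mul_const _)).congr_deriv ?_
  rw [Nat.factorial_succ]
  push_cast
  field_simp

lemma continuous_partialSum_time (n : ℕ) (x : RSpace N) :
    Continuous (fun s => partialSum J u₀ n s x) := by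
  unfold partialSum
  fun_prop

lemma aestronglyMeasurable_partialSum (hJ : IsDispersalKernel J) (hf : AEStronglyMeasurable u₀)
    (hM : ∀ᵐ y, |u₀ y| ≤ M) (n : ℕ) (t : ℝ) : AEStronglyMeasurable (partialSum J u₀ n t) := by
  have hz : ∀ k, Continuous (kernelConv (iterKernel J k) u₀) := fun k =>
    continuous_kernelConv (continuous_iterKernel hJ k) (hasCompactSupport_iterKernel hJ k)
      (locallyIntegrable_of_bounded hf hM)
  have h : Continuous (fun x => ∑ k ∈ Finset.range n,
      t ^ (k + 1) / (k + 1).factorial * kernelConv (iterKernel J k) u₀ x) := by fun_prop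
  exact hf.add h.aestronglyMeasurable

/-- Both `B - D` and `B + D` are nondecreasing and vanish at zero. -/
lemma abs_le_of_abs_hasDerivAt_le {D D' B B' : ℝ → ℝ} {T : ℝ}
    (hDc : ContinuousOn D (Set.Icc 0 T)) (hD : ∀ t ∈ Set.Ioo 0 T, HasDerivAt D (D' t) t)
    (hBc : ContinuousOn B (Set.Icc 0 T)) (hB : ∀ t ∈ Set.Ioo 0 T, HasDerivAt B (B' t) t)
    (hle : ∀ t ∈ Set.Ioo 0 T, |D' t| ≤ B' t) (hD0 : D 0 = 0) (hB0 : B 0 = 0) {t : ℝ}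
    (ht : t ∈ Set.Icc 0 T) : |D t| ≤ B t := by
  have h0 : (0 : ℝ) ∈ Set.Icc 0 T := ⟨le_rfl, ht.1.trans ht.2⟩
  have h1 : MonotoneOn (fun s => B s - D s) (Set.Icc 0 T) := by
    refine monotoneOn_of_hasDerivWithinAt_nonneg (f' := fun s => B' s - D' s) (convex_Icc 0 T)
      (hBc.sub hDc) (fun s hs => ?_) (fun s hs => ?_)
    · rw [interior_Icc] at hs
      exact ((hB s hs).fun_sub (hD s hs)).hasDerivWithinAt
    · rw [interior_Icc] at hs
      exact sub_nonneg.2 ((le_abs_self _).trans (hle s hs))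
  have h2 : MonotoneOn (fun s => B s + D s) (Set.Icc 0 T) := by
    refine monotoneOn_of_hasDerivWithinAt_nonneg (f' := fun s => B' s + D' s) (convex_Icc 0 T)
      (hBc.add hDc) (fun s hs => ?_) (fun s hs => ?_)
    · rw [interior_Icc] at hs
      exact ((hB s hs).fun_add (hD s hs)).hasDerivWithinAt
    · rw [interior_Icc] at hs
      linarith [neg_abs_le (D' s), hle s hs]
  have h3 := h1 h0 ht ht.1
  have h4 := h2 h0 ht ht.1
  simp only [hD0, hB0, sub_zero, add_zero] at h3 h4
  rw [abs_le]
  constructor <;> linarith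

/-- Let `D_n = e^t u - partialSum n`. The equation gives `D_{n+1}' = J * D_n` with `D_{n+1}(0) = 0`,
and convolution with `J` does not increase the sup norm, so each step integrates `t^n/n!` to
`t^{n+1}/(n+1)!`. -/
theorem nonlocal_duhamel (hJ : IsDispersalKernel J) {u : ℝ → RSpace N → ℝ}
    (hu : IsNonlocalSolution J u₀ u) (hf : AEStronglyMeasurable u₀) (hM : ∀ᵐ y, |u₀ y| ≤ M)
    (hMu : ∀ t, 0 ≤ t → ∀ᵐ y, |u t y| ≤ M) {T : ℝ} (hT : 0 ≤ T) (n : ℕ) :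
    ∀ t ∈ Set.Icc 0 T, ∀ᵐ x, |Real.exp t * u t x - partialSum J u₀ n t x| ≤
      2 * M * Real.exp T * (t ^ n / n.factorial) := by
  have hM0 : 0 ≤ M := by
    obtain ⟨y, hy⟩ := hM.exists
    exact (abs_nonneg _).trans hy
  induction n with
  | zero =>
    intro t ht
    filter_upwards [hM, hMu t ht.1] with x h1 h2
    have h3 : Real.exp t ≤ Real.exp T := Real.exp_le_exp.2 ht.2
    have h4 : 1 ≤ Real.exp T := Real.one_le_exp hT
    simp only [partialSum, Finset.range_zero, Finset.sum_empty, add_zero, pow_zero,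
      Nat.factorial_zero, Nat.cast_one, div_one, mul_one]
    refine (abs_sub _ _).trans ?_
    rw [abs_mul, abs_of_pos (Real.exp_pos t)]
    have h5 : Real.exp t * |u t x| ≤ Real.exp T * M :=
      mul_le_mul h3 h2 (abs_nonneg _) (Real.exp_pos T).le
    nlinarith
  | succ n ih =>
    intro t ht
    -- These null sets are independent of time. The bound `ih` at time `s` enters only under the
    -- convolution, which ignores null sets, so no uncountable union of exceptional sets arises.
    filter_upwards [hu.initial, hu.continuous_at_zero, hu.equation] with x hx0 hxc hxe
    refine abs_le_of_abs_hasDerivAt_le (T := T)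
      (D := fun s => Real.exp s * u s x - partialSum J u₀ (n + 1) s x)
      (D' := fun s => kernelConv J (fun y => Real.exp s * u s y - partialSum J u₀ n s y) x)
      (B := fun s => 2 * M * Real.exp T * (s ^ (n + 1) / (n + 1).factorial))
      (B' := fun s => 2 * M * Real.exp T * (s ^ n / n.factorial)) ?_ ?_ ?_ ?_ ?_ ?_ ?_ ht
    · have hc : ContinuousOn (fun s => u s x) (Set.Icc 0 T) := by
        intro s hs
        rcases hs.1.eq_or_lt with h | h
        · rw [← h]
          exact hxc.mono Set.Icc_subset_Ici_self
        · exact (hxe s h).continuousAt.continuousWithinAt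
      exact (Real.continuous_exp.continuousOn.mul hc).sub
        (continuous_partialSum_time (n + 1) x).continuousOn
    · intro s hs
      have hus := hu.aestronglyMeasurable s hs.1.le
      have h1 := ((Real.hasDerivAt_exp s).fun_mul (hxe s hs.1)).fun_sub
        (hasDerivAt_partialSum hJ hf hM n s x)
      refine h1.congr_deriv ?_
      rw [nonlocalOp_eq hJ hus (hMu s hs.1.le)]
      have h2 : kernelConv J (fun y => Real.exp s * u s y - partialSum J u₀ n s y) x =
          Real.exp s * kernelConv J (u s) x - kernelConv J (partialSum J u₀ n s) x := by
        have hi := integrable_kernelConv hJ.integrable hus (hMu s hs.1.le) x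
        have hp : Integrable (fun y => J (x - y) * partialSum J u₀ n s y) := by
          refine integrable_kernelConv (M := Real.exp s * M +
            2 * M * Real.exp T * (s ^ n / n.factorial)) hJ.integrable
            (aestronglyMeasurable_partialSum hJ hf hM n s) ?_ x
          filter_upwards [ih s ⟨hs.1.le, hs.2.le⟩, hMu s hs.1.le] with y h3 h4
          have h5 : |Real.exp s * u s y| ≤ Real.exp s * M := by
            rw [abs_mul, abs_of_pos (Real.exp_pos s)]
            exact mul_le_mul_of_nonneg_left h4 (Real.exp_pos s).le
          have h6 := abs_sub_abs_le_abs_sub (partialSum J u₀ n s y) (Real.exp s * u s y)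
          rw [abs_sub_comm] at h6
          linarith
        unfold kernelConv
        rw [← integral_const_mul, ← integral_sub (hi.const_mul _) hp]
        congr 1
        funext y
        ring
      rw [h2]
      ring
    · exact Continuous.continuousOn (by fun_prop)
    · intro s _
      refine (((hasDerivAt_pow (n + 1) s).div_const _).const_mul _).congr_deriv ?_
      rw [Nat.factorial_succ]
      push_cast
      field_simp
    · intro s hs
      have h := abs_kernelConv_le hJ.integrable (ih s ⟨hs.1.le, hs.2.le⟩) x
      simp_rw [abs_of_nonneg (hJ.nonneg _), hJ.integral_eq_one, one_mul] at h
      exact h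
    · simp [partialSum, hx0]
    · simp

/-- The previous bound is used with `T = t`, so that multiplication by `e^{-t}` cancels the factor
`e^T`. -/
theorem nonlocal_solution_expansion (hJ : IsDispersalKernel J) {u : ℝ → RSpace N → ℝ}
    (hu : IsNonlocalSolution J u₀ u) (hf : AEStronglyMeasurable u₀) (hM : ∀ᵐ y, |u₀ y| ≤ M)
    (hMu : ∀ t, 0 ≤ t → ∀ᵐ y, |u t y| ≤ M) {t : ℝ} (ht : 0 ≤ t) (n : ℕ) :
    ∀ᵐ x, |u t x - Real.exp (-t) * u₀ x - kernelConv (partialKernel J n t) u₀ x| ≤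
      2 * M * (t ^ n / n.factorial) := by
  filter_upwards [nonlocal_duhamel hJ hu hf hM hMu ht n t ⟨ht, le_rfl⟩] with x hx
  rw [kernelConv_partialKernel hJ n t hf hM]
  have h1 : u t x - Real.exp (-t) * u₀ x - Real.exp (-t) * ∑ k ∈ Finset.range n,
      t ^ (k + 1) / (k + 1).factorial * kernelConv (iterKernel J k) u₀ x =
      Real.exp (-t) * (Real.exp t * u t x - partialSum J u₀ n t x) := by
    rw [partialSum, mul_sub, ← mul_assoc, ← Real.exp_add, neg_add_cancel, Real.exp_zero]
    ring
  rw [h1, abs_mul, abs_of_pos (Real.exp_pos _), Real.exp_neg, inv_mul_le_iff₀ (Real.exp_pos t)]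
  linarith

end Duhamel

/-! ### The Fourier transform of the dispersal kernel -/

section CosTransform

open scoped FourierTransform

variable {N : ℕ} {J : RSpace N → ℝ}

/-- The (real) Fourier transform `∫ cos(2π ⟨x, ξ⟩) J(x) dx` of an even function. -/
noncomputable def cosTransform (J : RSpace N → ℝ) (ξ : RSpace N) : ℝ :=
  ∫ x, Real.cos (2 * Real.pi * inner ℝ x ξ) * J x

lemma integrable_mul_kernel (hJ : IsDispersalKernel J) {g : RSpace N → ℝ} (hg : Continuous g) :
    Integrable (fun x => g x * J x) :=
  (hg.mul hJ.continuous).integrable_of_hasCompactSupport hJ.compactSupport.mul_left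

lemma fourier_kernel (hJ : IsDispersalKernel J) (ξ : RSpace N) :
    𝓕 (fun x => (J x : ℂ)) ξ = (cosTransform J ξ : ℂ) := by
  have hsin : ∫ x, Real.sin (2 * Real.pi * inner ℝ x ξ) * J x = 0 := by
    have h := integral_neg_eq_self (fun x => Real.sin (2 * Real.pi * inner ℝ x ξ) * J x) volume
    have h2 : ∀ x, Real.sin (2 * Real.pi * inner ℝ (-x) ξ) * J (-x) =
        -(Real.sin (2 * Real.pi * inner ℝ x ξ) * J x) := by
      intro x
      rw [inner_neg_left, mul_neg, Real.sin_neg, hJ.radial (-x) x (norm_neg x), neg_mul]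
    simp_rw [h2] at h
    rw [integral_neg] at h
    linarith
  rw [Real.fourier_eq']
  have h1 : ∀ x, Complex.exp (((-2 * Real.pi * inner ℝ x ξ : ℝ) : ℂ) * Complex.I) • (J x : ℂ) =
      ((Real.cos (2 * Real.pi * inner ℝ x ξ) * J x : ℝ) : ℂ) -
        Complex.I * ((Real.sin (2 * Real.pi * inner ℝ x ξ) * J x : ℝ) : ℂ) := by
    intro x
    rw [Complex.exp_mul_I, ← Complex.ofReal_cos, ← Complex.ofReal_sin,
      show -2 * Real.pi * inner ℝ x ξ = -(2 * Real.pi * inner ℝ x ξ) by ring, Real.cos_neg,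
      Real.sin_neg, smul_eq_mul]
    push_cast
    ring
  simp_rw [h1]
  rw [integral_sub, integral_const_mul, integral_complex_ofReal, integral_complex_ofReal, hsin]
  · simp [cosTransform]
  · exact (integrable_mul_kernel hJ (by fun_prop)).ofReal
  · exact ((integrable_mul_kernel hJ (by fun_prop)).ofReal).const_mul _

/-- Source of the continuity, integrability and decay at infinity of `Ĵ`. -/
lemma exists_schwartz_cosTransform (hJ : IsDispersalKernel J) :
    ∃ S : SchwartzMap (RSpace N) ℂ, ∀ ξ, S ξ = (cosTransform J ξ : ℂ) := by
  have h1 : HasCompactSupport (fun x => (J x : ℂ)) :=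
    hJ.compactSupport.comp_left (g := fun r : ℝ => (r : ℂ)) (by simp)
  have h2 : ContDiff ℝ ∞ (fun x => (J x : ℂ)) := Complex.ofRealCLM.contDiff.comp hJ.smooth
  refine ⟨𝓕 (h1.toSchwartzMap h2), fun ξ => ?_⟩
  rw [← fourier_kernel hJ, SchwartzMap.fourier_coe]
  rfl

lemma continuous_cosTransform (hJ : IsDispersalKernel J) : Continuous (cosTransform J) := by
  obtain ⟨S, hS⟩ := exists_schwartz_cosTransform hJ
  have : cosTransform J = fun ξ => (S ξ).re := funext fun ξ => by rw [hS, Complex.ofReal_re]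
  rw [this]
  exact Complex.continuous_re.comp S.continuous

lemma integrable_cosTransform (hJ : IsDispersalKernel J) : Integrable (cosTransform J) := by
  obtain ⟨S, hS⟩ := exists_schwartz_cosTransform hJ
  have : cosTransform J = fun ξ => (S ξ).re := funext fun ξ => by rw [hS, Complex.ofReal_re]
  rw [this]
  exact S.integrable.re

lemma tendsto_cosTransform (hJ : IsDispersalKernel J) :
    Tendsto (cosTransform J) (cocompact (RSpace N)) (𝓝 0) := by
  obtain ⟨S, hS⟩ := exists_schwartz_cosTransform hJ
  have : cosTransform J = fun ξ => (S ξ).re := funext fun ξ => by rw [hS, Complex.ofReal_re]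
  rw [this]
  exact (Complex.continuous_re.tendsto' 0 0 (by simp)).comp
    (ZeroAtInftyContinuousMapClass.zero_at_infty S)

lemma abs_cosTransform_le_one (hJ : IsDispersalKernel J) (ξ : RSpace N) :
    |cosTransform J ξ| ≤ 1 := by
  rw [← hJ.integral_eq_one, ← Real.norm_eq_abs]
  refine norm_integral_le_of_norm_le hJ.integrable (Eventually.of_forall fun x => ?_)
  rw [norm_mul, Real.norm_of_nonneg (hJ.nonneg x)]
  exact mul_le_of_le_one_left (hJ.nonneg x) (Real.abs_cos_le_one _)

lemma one_sub_cosTransform (hJ : IsDispersalKernel J) (ξ : RSpace N) :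
    1 - cosTransform J ξ = ∫ x, (1 - Real.cos (2 * Real.pi * inner ℝ x ξ)) * J x := by
  simp_rw [sub_mul, one_mul]
  rw [integral_sub hJ.integrable (integrable_mul_kernel hJ (by fun_prop)), hJ.integral_eq_one]
  rfl

/-- Equality would force `cos(2π⟨x,ξ⟩) = 1` wherever `J ≠ 0`. That set is open, and a small
displacement along `ξ` changes the phase. -/
lemma cosTransform_lt_one (hJ : IsDispersalKernel J) {ξ : RSpace N} (hξ : ξ ≠ 0) :
    cosTransform J ξ < 1 := by
  obtain ⟨x₀, hx₀⟩ : ∃ x, J x ≠ 0 := by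
    by_contra! h
    have := hJ.integral_eq_one
    simp [h] at this
  obtain ⟨x, hx, hcos⟩ : ∃ x, J x ≠ 0 ∧ Real.cos (2 * Real.pi * inner ℝ x ξ) ≠ 1 := by
    by_cases h0 : Real.cos (2 * Real.pi * inner ℝ x₀ ξ) = 1
    swap
    · exact ⟨x₀, hx₀, h0⟩
    have hsin : Real.sin (2 * Real.pi * inner ℝ x₀ ξ) = 0 := by
      have := Real.sin_sq_add_cos_sq (2 * Real.pi * inner ℝ x₀ ξ)
      rw [h0] at this
      nlinarith
    have h1 : ∀ᶠ s in 𝓝 (0 : ℝ), J (x₀ + s • ξ) ≠ 0 := by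
      have hJc := hJ.continuous
      have hc : Continuous (fun s : ℝ => J (x₀ + s • ξ)) := by fun_prop
      exact (hc.continuousAt (x := 0)).eventually_ne (by simpa using hx₀)
    have hξ2 : 0 < ‖ξ‖ ^ 2 := by positivity
    -- The phase increment `2πs|ξ|²` then lies strictly between `0` and `2π`.
    have h2 : ∀ᶠ s in 𝓝[>] (0 : ℝ), s < 1 / ‖ξ‖ ^ 2 :=
      (eventually_lt_nhds (by positivity)).filter_mono nhdsWithin_le_nhds
    obtain ⟨s, ⟨hs1, hs2⟩, hs0⟩ :=
      ((h1.filter_mono nhdsWithin_le_nhds).and h2 |>.and eventually_mem_nhdsWithin).exists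
    refine ⟨x₀ + s • ξ, hs1, ?_⟩
    have hs0' : 0 < s := hs0
    rw [lt_div_iff₀ hξ2] at hs2
    rw [inner_add_left, real_inner_smul_left, real_inner_self_eq_norm_sq, mul_add, Real.cos_add, h0,
      hsin, one_mul, zero_mul, sub_zero]
    have hpi := Real.pi_pos
    have hpos : 0 < 2 * Real.pi * (s * ‖ξ‖ ^ 2) := by positivity
    rw [Ne, Real.cos_eq_one_iff_of_lt_of_lt (by linarith) (by nlinarith)]
    exact hpos.ne'
  have hJc := hJ.continuous
  have hpos : 0 < ∫ x, (1 - Real.cos (2 * Real.pi * inner ℝ x ξ)) * J x := by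
    refine Continuous.integral_pos_of_hasCompactSupport_nonneg_nonzero (x := x) (by fun_prop)
      hJ.compactSupport.mul_left (fun y => ?_) ?_
    · exact mul_nonneg (sub_nonneg.2 (Real.cos_le_one _)) (hJ.nonneg y)
    · exact mul_ne_zero (sub_ne_zero.2 hcos.symm) hx
  rw [← one_sub_cosTransform hJ] at hpos
  linarith

/-- The reflection exchanging `ξ` and `η` preserves both Lebesgue measure and the radial kernel. -/
lemma integral_inner_sq_eq_of_norm_eq (hJ : IsDispersalKernel J) {ξ η : RSpace N}
    (h : ‖ξ‖ = ‖η‖) : ∫ x, inner ℝ x ξ ^ 2 * J x = ∫ x, inner ℝ x η ^ 2 * J x := by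
  set ρ := (Submodule.span ℝ {ξ - η})ᗮ.reflection with hρ
  have hρξ : ρ ξ = η := Submodule.reflection_sub h
  have h1 := ρ.measurePreserving.integral_comp ρ.toHomeomorph.measurableEmbedding
    (fun x => inner ℝ x η ^ 2 * J x)
  rw [← h1]
  congr 1
  funext x
  rw [← hρξ, ρ.inner_map_map, hJ.radial (ρ x) x (ρ.norm_map x)]

/-- By rotation invariance `ξ` may be replaced by `|ξ|` times any coordinate vector; the `N` equal
second moments add up to `|ξ|² ∫ J|x|² = 2N𝔞|ξ|²`. -/
lemma integral_inner_sq (hJ : IsDispersalKernel J) (hN : 0 < N) (ξ : RSpace N) :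
    ∫ x, inner ℝ x ξ ^ 2 * J x = 2 * diffusivity J * ‖ξ‖ ^ 2 := by
  have hN' : (N : ℝ) ≠ 0 := by exact_mod_cast hN.ne'
  have h1 : ∀ i, ∫ x, inner ℝ x (‖ξ‖ • EuclideanSpace.basisFun (Fin N) ℝ i) ^ 2 * J x =
      ∫ x, inner ℝ x ξ ^ 2 * J x := fun i =>
    integral_inner_sq_eq_of_norm_eq hJ (by simp [norm_smul])
  have h2 : ∑ i, ∫ x, inner ℝ x (‖ξ‖ • EuclideanSpace.basisFun (Fin N) ℝ i) ^ 2 * J x =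
      ‖ξ‖ ^ 2 * ∫ x, J x * ‖x‖ ^ 2 := by
    rw [← integral_finsetSum _ fun i _ => integrable_mul_kernel hJ (by fun_prop),
      ← integral_const_mul]
    congr 1
    funext x
    rw [EuclideanSpace.real_norm_sq_eq x, ← Finset.sum_mul, Finset.mul_sum, Finset.mul_sum,
      Finset.sum_mul]
    refine Finset.sum_congr rfl fun i _ => ?_
    rw [real_inner_smul_right, EuclideanSpace.basisFun_apply, EuclideanSpace.inner_single_right]
    simp
    ring
  simp_rw [h1] at h2
  rw [Finset.sum_const, Finset.card_univ, Fintype.card_fin, nsmul_eq_mul] at h2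
  unfold diffusivity
  field_simp
  linarith

lemma cos_sub_taylor_bounds (θ : ℝ) :
    0 ≤ Real.cos θ - 1 + θ ^ 2 / 2 ∧ Real.cos θ - 1 + θ ^ 2 / 2 ≤ θ ^ 4 / 2 := by
  refine ⟨by linarith [Real.one_sub_sq_div_two_le_cos (x := θ)], ?_⟩
  rcases le_or_gt |θ| 1 with h | h
  · have h1 := (abs_le.1 (Real.cos_bound h)).2
    have h2 : |θ| ^ 4 = θ ^ 4 := by rw [← abs_pow]; exact abs_of_nonneg (by positivity)
    rw [h2] at h1
    have : 0 ≤ θ ^ 4 := by positivity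
    linarith
  · have h1 : 1 < θ ^ 2 := by
      rw [← sq_abs]
      nlinarith
    nlinarith [Real.cos_le_one θ]

/-- The expansion `Ĵ(ξ) = 1 - 4π²𝔞|ξ|² + O(|ξ|⁴)`. -/
lemma cosTransform_expansion (hJ : IsDispersalKernel J) (hN : 0 < N) :
    ∃ C : ℝ, 0 ≤ C ∧ ∀ ξ, 0 ≤ cosTransform J ξ - 1 + 4 * Real.pi ^ 2 * diffusivity J * ‖ξ‖ ^ 2 ∧
      cosTransform J ξ - 1 + 4 * Real.pi ^ 2 * diffusivity J * ‖ξ‖ ^ 2 ≤ C * ‖ξ‖ ^ 4 := by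
  refine ⟨(2 * Real.pi) ^ 4 / 2 * ∫ x, ‖x‖ ^ 4 * J x, ?_, fun ξ => ?_⟩
  · exact mul_nonneg (by positivity) (integral_nonneg fun x => mul_nonneg (by positivity)
      (hJ.nonneg x))
  set θ : RSpace N → ℝ := fun x => 2 * Real.pi * inner ℝ x ξ with hθ
  have hθc : Continuous θ := by fun_prop
  have h1 : cosTransform J ξ - 1 + 4 * Real.pi ^ 2 * diffusivity J * ‖ξ‖ ^ 2 =
      ∫ x, (Real.cos (θ x) - 1 + θ x ^ 2 / 2) * J x := by
    simp_rw [add_mul, sub_mul, one_mul]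
    have hi1 : Integrable (fun x => Real.cos (θ x) * J x) := integrable_mul_kernel hJ (by fun_prop)
    have hi2 : Integrable (fun x => θ x ^ 2 / 2 * J x) := integrable_mul_kernel hJ (by fun_prop)
    have hi3 : Integrable (fun x => Real.cos (θ x) * J x - J x) := hi1.sub hJ.integrable
    rw [integral_add hi3 hi2, integral_sub hi1 hJ.integrable, hJ.integral_eq_one]
    have h2 : ∫ x, θ x ^ 2 / 2 * J x = 4 * Real.pi ^ 2 * diffusivity J * ‖ξ‖ ^ 2 := by
      have h3 : ∀ x, θ x ^ 2 / 2 * J x = 2 * Real.pi ^ 2 * (inner ℝ x ξ ^ 2 * J x) := by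
        intro x
        simp only [hθ]
        ring
      simp_rw [h3]
      rw [integral_const_mul, integral_inner_sq hJ hN]
      ring
    rw [h2]
    rfl
  rw [h1]
  constructor
  · exact integral_nonneg fun x => mul_nonneg (cos_sub_taylor_bounds _).1 (hJ.nonneg x)
  · rw [mul_assoc, mul_comm _ (‖ξ‖ ^ 4), ← integral_const_mul, ← integral_const_mul]
    refine integral_mono (integrable_mul_kernel hJ (by fun_prop))
      (((integrable_mul_kernel hJ (by fun_prop)).const_mul _).const_mul _) fun x => ?_
    have h2 : θ x ^ 4 ≤ (2 * Real.pi) ^ 4 * (‖ξ‖ ^ 4 * ‖x‖ ^ 4) := by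
      have h3 : |inner ℝ x ξ| ≤ ‖x‖ * ‖ξ‖ := abs_real_inner_le_norm x ξ
      have h4 : (inner ℝ x ξ) ^ 4 ≤ (‖x‖ * ‖ξ‖) ^ 4 := by
        have h5 : |inner ℝ x ξ| ^ 4 = (inner ℝ x ξ) ^ 4 := by
          rw [← abs_pow]
          exact abs_of_nonneg (by positivity)
        rw [← h5]
        gcongr
      simp only [hθ]
      rw [mul_pow]
      refine mul_le_mul_of_nonneg_left (h4.trans_eq (by ring)) (by positivity)
    have h3 := mul_le_mul_of_nonneg_right ((cos_sub_taylor_bounds (θ x)).2.trans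
      (div_le_div_of_nonneg_right h2 two_pos.le)) (hJ.nonneg x)
    refine h3.trans_eq ?_
    ring

/-- The expansion gives `Ĵ(ξ) ≥ 1 - 4π²𝔞|ξ|²`, whereas `Ĵ(ξ) < 1` for `ξ ≠ 0`. -/
lemma diffusivity_pos (hJ : IsDispersalKernel J) (hN : 0 < N) : 0 < diffusivity J := by
  have := nontrivial_RSpace hN
  obtain ⟨ξ, hξ⟩ := exists_ne (0 : RSpace N)
  obtain ⟨C, -, hC⟩ := cosTransform_expansion hJ hN
  have h1 := (hC ξ).1
  have h2 := cosTransform_lt_one hJ hξ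
  have h3 : 0 < diffusivity J * (4 * Real.pi ^ 2 * ‖ξ‖ ^ 2) := by linarith
  exact pos_of_mul_pos_left h3 (by positivity)

/-- Near infinity `Ĵ < 1/2`; on the compact set that remains `Ĵ` attains a maximum below one. -/
lemma cosTransform_le_away (hJ : IsDispersalKernel J) {r : ℝ} (hr : 0 < r) :
    ∃ δ : ℝ, 0 < δ ∧ δ ≤ 1 ∧ ∀ ξ, r ≤ ‖ξ‖ → cosTransform J ξ ≤ 1 - δ := by
  have h1 := (tendsto_cosTransform hJ).eventually (gt_mem_nhds (show (0 : ℝ) < 1 / 2 by norm_num))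
  rw [← Metric.cobounded_eq_cocompact, eventually_iff,
    (hasBasis_cobounded_norm (E := RSpace N)).mem_iff] at h1
  obtain ⟨R, -, hR⟩ := h1
  have hK : IsCompact (Metric.closedBall (0 : RSpace N) R ∩ {ξ | r ≤ ‖ξ‖}) :=
    (isCompact_closedBall _ _).inter_right (isClosed_le continuous_const continuous_norm)
  rcases (Metric.closedBall (0 : RSpace N) R ∩ {ξ | r ≤ ‖ξ‖}).eq_empty_or_nonempty with he | hne
  · refine ⟨1 / 2, by norm_num, by norm_num, fun ξ hξ => ?_⟩
    have h2 : R ≤ ‖ξ‖ := by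
      by_contra! hlt
      have : ξ ∈ Metric.closedBall (0 : RSpace N) R ∩ {ξ | r ≤ ‖ξ‖} :=
        ⟨mem_closedBall_zero_iff.2 hlt.le, hξ⟩
      rw [he] at this
      exact this
    have h3 : cosTransform J ξ < 1 / 2 := hR h2
    linarith
  · obtain ⟨ξ₀, ⟨-, hξ₀⟩, hmax⟩ := hK.exists_isMaxOn hne (continuous_cosTransform hJ).continuousOn
    have hlt := cosTransform_lt_one hJ (norm_pos_iff.1 (hr.trans_le hξ₀))
    refine ⟨min (1 - cosTransform J ξ₀) (1 / 2), lt_min (by linarith) (by norm_num),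
      (min_le_right _ _).trans (by norm_num), fun ξ hξ => ?_⟩
    rcases le_or_gt R ‖ξ‖ with h2 | h2
    · have h3 : cosTransform J ξ < 1 / 2 := hR h2
      linarith [min_le_right (1 - cosTransform J ξ₀) (1 / 2)]
    · have h3 : cosTransform J ξ ≤ cosTransform J ξ₀ :=
        hmax (a := ξ) ⟨mem_closedBall_zero_iff.2 h2.le, hξ⟩
      linarith [min_le_left (1 - cosTransform J ξ₀) (1 / 2)]

end CosTransform

/-! ### Comparison of the symbols -/

section Symbols

variable {N : ℕ} {J : RSpace N → ℝ}

lemma abs_exp_sub_exp_le {x y m : ℝ} (hx : x ≤ m) (hy : y ≤ m) :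
    |Real.exp x - Real.exp y| ≤ |x - y| * Real.exp m := by
  have key : ∀ x y : ℝ, x ≤ m → Real.exp x - Real.exp y ≤ |x - y| * Real.exp m := by
    intro x y hx
    have h1 := Real.add_one_le_exp (y - x)
    have h2 : Real.exp x * Real.exp (y - x) = Real.exp y := by
      rw [← Real.exp_add]
      congr 1
      ring
    have h3 := Real.exp_pos x
    have h4 : Real.exp x - Real.exp y ≤ |x - y| * Real.exp x := by
      nlinarith [le_abs_self (x - y)]
    exact h4.trans (mul_le_mul_of_nonneg_left (Real.exp_le_exp.2 hx) (abs_nonneg _))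
  rw [abs_le]
  have h1 := key y x hy
  rw [abs_sub_comm] at h1
  exact ⟨by linarith, key x y hx⟩

/-- Since `ts² = t⁻¹(ts)²`, half of the exponential decay absorbs `(ts)²` and the other half is kept
for integrability; a factor `t⁻¹` is gained. -/
lemma mul_sq_mul_exp_le {b t s : ℝ} (hb : 0 < b) (ht : 0 < t) (hs : 0 ≤ s) :
    t * s ^ 2 * Real.exp (-(b / 2 * t * s)) ≤
      32 / b ^ 2 * t⁻¹ * Real.exp (-(b / 4 * t) * s) := by
  set y := b / 4 * t * s with hy
  have hy0 : 0 ≤ y := by positivity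
  have h1 : y ^ 2 / 2 ≤ Real.exp y := by
    have := Real.quadratic_le_exp_of_nonneg hy0
    linarith
  have h2 : Real.exp (-(b / 2 * t * s)) = Real.exp (-y) * Real.exp (-y) := by
    rw [← Real.exp_add]
    congr 1
    rw [hy]
    ring
  have h3 : Real.exp (-(b / 4 * t) * s) = Real.exp (-y) := by
    congr 1
    rw [hy]
    ring
  have h4 : t * s ^ 2 = 32 / b ^ 2 * t⁻¹ * (y ^ 2 / 2) := by
    rw [hy]
    field_simp
    ring
  have h5 : y ^ 2 / 2 * Real.exp (-y) ≤ 1 := by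
    rw [Real.exp_neg, ← div_eq_mul_inv, div_le_one (Real.exp_pos y)]
    exact h1
  rw [h2, h3, h4]
  calc 32 / b ^ 2 * t⁻¹ * (y ^ 2 / 2) * (Real.exp (-y) * Real.exp (-y))
      = 32 / b ^ 2 * t⁻¹ * (y ^ 2 / 2 * Real.exp (-y)) * Real.exp (-y) := by ring
    _ ≤ 32 / b ^ 2 * t⁻¹ * 1 * Real.exp (-y) := by gcongr
    _ = _ := by ring

/-- The Fourier transform `e^{-t} (e^{t Ĵ} - 1)` of the regular part of the nonlocal fundamental
solution. -/
noncomputable def nonlocalSymbol (J : RSpace N → ℝ) (t : ℝ) (ξ : RSpace N) : ℝ :=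
  Real.exp (-t) * (Real.exp (t * cosTransform J ξ) - 1)

/-- The Fourier transform of the heat kernel. -/
noncomputable def heatSymbol (N : ℕ) (a t : ℝ) (ξ : RSpace N) : ℝ :=
  Real.exp (-(4 * Real.pi ^ 2 * a * t) * ‖ξ‖ ^ 2)

/-- For `|ξ| < r` both exponents are at most `-bt|ξ|²/2` and differ by at most `Ct|ξ|⁴`, giving the
Gaussian term with `t⁻¹`; the subtracted `e^{-t}` gives the indicator. For `|ξ| ≥ r` the symbols are
estimated separately, and `e^{tĴ} - 1` retains a factor `|Ĵ|`, which makes its exponentially small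
bound integrable in `ξ`. -/
lemma abs_nonlocalSymbol_sub_heatSymbol_le (hJ : IsDispersalKernel J) (hN : 0 < N) :
    ∃ r K δ : ℝ, 0 ≤ K ∧ 0 < δ ∧ δ ≤ 1 ∧ ∀ t, 1 ≤ t → ∀ ξ,
      |nonlocalSymbol J t ξ - heatSymbol N (diffusivity J) t ξ| ≤
        (Metric.ball (0 : RSpace N) r).indicator (fun _ => Real.exp (-t)) ξ +
        K * t⁻¹ * Real.exp (-(Real.pi ^ 2 * diffusivity J * t) * ‖ξ‖ ^ 2) +
        t * Real.exp (-(δ * t)) * |cosTransform J ξ| := by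
  have hpi := Real.pi_pos
  have ha := diffusivity_pos hJ hN
  obtain ⟨C, hC0, hC⟩ := cosTransform_expansion hJ hN
  set b := 4 * Real.pi ^ 2 * diffusivity J with hb
  have hb0 : 0 < b := by positivity
  -- For `|ξ| ≤ r` the quartic error is at most half of the quadratic term; `C + 1` avoids dividing
  -- by zero.
  set r := √(b / (2 * (C + 1))) with hr
  have hr0 : 0 < r := Real.sqrt_pos.2 (by positivity)
  have hr2 : C * r ^ 2 ≤ b / 2 := by
    rw [hr, Real.sq_sqrt (by positivity), mul_div_assoc', div_le_div_iff₀ (by positivity) two_pos]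
    nlinarith
  obtain ⟨δ, hδ0, hδ1, hδ⟩ := cosTransform_le_away hJ hr0
  refine ⟨r, (C + 1 / r ^ 4) * (32 / b ^ 2), δ, by positivity, hδ0, hδ1, fun t ht ξ => ?_⟩
  have ht0 : 0 < t := by linarith
  have hmain := mul_sq_mul_exp_le hb0 ht0 (sq_nonneg ‖ξ‖)
  have he : Real.exp (-(Real.pi ^ 2 * diffusivity J * t) * ‖ξ‖ ^ 2) =
      Real.exp (-(b / 4 * t) * ‖ξ‖ ^ 2) := by
    congr 1
    rw [hb]
    ring
  have hh : heatSymbol N (diffusivity J) t ξ = Real.exp (-(b * t * ‖ξ‖ ^ 2)) := by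
    unfold heatSymbol
    congr 1
    rw [hb]
    ring
  rw [he, hh]
  set s := ‖ξ‖ ^ 2 with hs
  have hs0 : 0 ≤ s := sq_nonneg _
  have hs4 : ‖ξ‖ ^ 4 = s ^ 2 := by rw [hs]; ring
  have hCξ := hC ξ
  rw [hs4] at hCξ
  set E := Real.exp (-(b / 2 * t * s)) with hE
  have hE0 : 0 < E := Real.exp_pos _
  set F := 32 / b ^ 2 * t⁻¹ * Real.exp (-(b / 4 * t) * s) with hF
  have hF0 : 0 ≤ F := by positivity
  have hKF : (C + 1 / r ^ 4) * (32 / b ^ 2) * t⁻¹ * Real.exp (-(b / 4 * t) * s) =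
      (C + 1 / r ^ 4) * F := by
    rw [hF]
    ring
  rw [hKF]
  have hr4 : 0 ≤ 1 / r ^ 4 * F := by positivity
  have hCF : 0 ≤ C * F := by positivity
  have hlast : 0 ≤ t * Real.exp (-(δ * t)) * |cosTransform J ξ| := by positivity
  rcases lt_or_ge ‖ξ‖ r with hξ | hξ
  · rw [Set.indicator_of_mem (mem_ball_zero_iff.2 hξ)]
    have hsr : s ≤ r ^ 2 := by
      rw [hs]
      gcongr
    have h1 : cosTransform J ξ - 1 ≤ -(b / 2 * s) := by
      nlinarith [mul_le_mul_of_nonneg_left hsr hC0]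
    have h2 : |Real.exp (t * (cosTransform J ξ - 1)) - Real.exp (-(b * t * s))| ≤ C * F := by
      have h3 : t * (cosTransform J ξ - 1) ≤ -(b / 2 * t * s) := by nlinarith
      have h4 : -(b * t * s) ≤ -(b / 2 * t * s) := by
        have : 0 ≤ b * t * s := by positivity
        linarith
      refine (abs_exp_sub_exp_le h3 h4).trans ?_
      have h5 : t * (cosTransform J ξ - 1) - -(b * t * s) =
          t * (cosTransform J ξ - 1 + b * s) := by ring
      rw [h5, abs_mul, abs_of_pos ht0, abs_of_nonneg hCξ.1]
      calc t * (cosTransform J ξ - 1 + b * s) * E ≤ t * (C * s ^ 2) * E := by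
            gcongr
            exact hCξ.2
        _ = C * (t * s ^ 2 * E) := by ring
        _ ≤ C * F := mul_le_mul_of_nonneg_left hmain hC0
    have h6 : nonlocalSymbol J t ξ - Real.exp (-(b * t * s)) =
        -Real.exp (-t) + (Real.exp (t * (cosTransform J ξ - 1)) - Real.exp (-(b * t * s))) := by
      unfold nonlocalSymbol
      rw [mul_sub, ← Real.exp_add, show -t + t * cosTransform J ξ = t * (cosTransform J ξ - 1) by
        ring]
      ring
    rw [h6]
    refine (abs_add_le _ _).trans ?_
    rw [abs_neg, abs_of_pos (Real.exp_pos _)]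
    linarith
  · rw [Set.indicator_of_notMem (by simpa using hξ), zero_add]
    have h1 : |nonlocalSymbol J t ξ| ≤ t * Real.exp (-(δ * t)) * |cosTransform J ξ| := by
      have h2 : t * cosTransform J ξ ≤ (1 - δ) * t := by
        have := mul_le_mul_of_nonneg_left (hδ ξ hξ) ht0.le
        linarith
      have h3 : (0 : ℝ) ≤ (1 - δ) * t := mul_nonneg (by linarith) ht0.le
      have h4 := abs_exp_sub_exp_le h2 h3
      rw [Real.exp_zero, sub_zero, abs_mul, abs_of_pos ht0] at h4
      unfold nonlocalSymbol
      rw [abs_mul, abs_of_pos (Real.exp_pos _)]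
      refine (mul_le_mul_of_nonneg_left h4 (Real.exp_pos _).le).trans_eq ?_
      have h5 : Real.exp (-t) * Real.exp ((1 - δ) * t) = Real.exp (-(δ * t)) := by
        rw [← Real.exp_add]
        congr 1
        ring
      linear_combination (t * |cosTransform J ξ|) * h5
    have h2 : Real.exp (-(b * t * s)) ≤ 1 / r ^ 4 * F := by
      have h3 : Real.exp (-(b * t * s)) ≤ E := by
        refine Real.exp_le_exp.2 ?_
        have : 0 ≤ b * t * s := by positivity
        linarith
      have h4 : r ^ 4 ≤ t * s ^ 2 := by
        rw [← hs4]
        have h5 : r ^ 4 ≤ ‖ξ‖ ^ 4 := by gcongr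
        have h6 : 0 ≤ ‖ξ‖ ^ 4 := by positivity
        nlinarith
      have h7 : r ^ 4 * E ≤ F := (mul_le_mul_of_nonneg_right h4 hE0.le).trans hmain
      rw [one_div, le_inv_mul_iff₀ (by positivity)]
      exact (mul_le_mul_of_nonneg_left h3 (by positivity)).trans h7
    refine (abs_sub _ _).trans ?_
    rw [abs_of_pos (Real.exp_pos (-(b * t * s)))]
    linarith

lemma integrable_exp_neg_mul_sq_norm {c : ℝ} (hc : 0 < c) :
    Integrable (fun ξ : RSpace N => Real.exp (-c * ‖ξ‖ ^ 2)) := by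
  by_contra h
  have h1 := GaussianFourier.integral_rexp_neg_mul_sq_norm (V := RSpace N) hc
  rw [integral_undef h] at h1
  have : 0 < (Real.pi / c) ^ ((Module.finrank ℝ (RSpace N) : ℝ) / 2) :=
    Real.rpow_pos_of_pos (div_pos Real.pi_pos hc) _
  linarith

lemma exists_mul_exp_neg_le_rpow {δ : ℝ} (hδ : 0 < δ) (p : ℝ) :
    ∃ C : ℝ, 0 ≤ C ∧ ∀ t, 1 ≤ t → t * Real.exp (-(δ * t)) ≤ C * t ^ (-p) := by
  -- The extra power absorbs the prefactor `t`.
  set m := ⌈p⌉₊ + 1 with hm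
  refine ⟨m.factorial / δ ^ m, by positivity, fun t ht => ?_⟩
  have ht0 : 0 < t := by linarith
  have h1 : (δ * t) ^ m / m.factorial ≤ Real.exp (δ * t) :=
    Real.pow_div_factorial_le_exp _ (by positivity) m
  have h2 : t * t ^ p ≤ t ^ m := by
    rw [hm, pow_succ, mul_comm]
    refine mul_le_mul_of_nonneg_right ?_ ht0.le
    rw [← Real.rpow_natCast]
    exact Real.rpow_le_rpow_of_exponent_le ht (Nat.le_ceil p)
  rw [Real.exp_neg, Real.rpow_neg ht0.le, ← div_eq_mul_inv, ← div_eq_mul_inv,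
    div_le_div_iff₀ (Real.exp_pos _) (Real.rpow_pos_of_pos ht0 p)]
  refine h2.trans ?_
  rw [div_mul_eq_mul_div, le_div_iff₀ (by positivity)]
  rw [div_le_iff₀ (by positivity), mul_pow] at h1
  linarith

lemma integral_abs_symbol_sub_le (hJ : IsDispersalKernel J) (hN : 0 < N) :
    ∃ C : ℝ, 0 ≤ C ∧ ∀ t, 1 ≤ t →
      ∫ ξ, |nonlocalSymbol J t ξ - heatSymbol N (diffusivity J) t ξ| ≤
        C * t ^ (-(((N : ℝ) + 1) / 2)) := by
  have hpi := Real.pi_pos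
  have ha := diffusivity_pos hJ hN
  obtain ⟨r, K, δ, hK, hδ0, hδ1, hbound⟩ := abs_nonlocalSymbol_sub_heatSymbol_le hJ hN
  obtain ⟨C₁, hC₁, h₁⟩ := exists_mul_exp_neg_le_rpow hδ0 (((N : ℝ) + 1) / 2)
  set V := volume.real (Metric.ball (0 : RSpace N) r) with hV
  set P := (Real.pi / (Real.pi ^ 2 * diffusivity J)) ^ ((N : ℝ) / 2) with hP
  set I := ∫ ξ, |cosTransform J ξ| with hI
  have hI0 : 0 ≤ I := integral_nonneg fun _ => abs_nonneg _
  refine ⟨C₁ * V + K * P + C₁ * I, by positivity, fun t ht => ?_⟩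
  have ht0 : 0 < t := by linarith
  set D₁ : RSpace N → ℝ := (Metric.ball (0 : RSpace N) r).indicator (fun _ => Real.exp (-t)) with hD₁
  have hi1 : Integrable D₁ := by
    rw [hD₁, integrable_indicator_iff Metric.isOpen_ball.measurableSet]
    exact integrableOn_const measure_ball_lt_top.ne
  have hi2 : Integrable (fun ξ : RSpace N =>
      K * t⁻¹ * Real.exp (-(Real.pi ^ 2 * diffusivity J * t) * ‖ξ‖ ^ 2)) :=
    (integrable_exp_neg_mul_sq_norm (by positivity)).const_mul _
  have hi3 : Integrable (fun ξ => t * Real.exp (-(δ * t)) * |cosTransform J ξ|) :=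
    (integrable_cosTransform hJ).abs.const_mul _
  have hi12 : Integrable (fun ξ => D₁ ξ +
      K * t⁻¹ * Real.exp (-(Real.pi ^ 2 * diffusivity J * t) * ‖ξ‖ ^ 2)) := hi1.add hi2
  have hle := integral_mono_of_nonneg (μ := volume) (Eventually.of_forall fun ξ => abs_nonneg
    (nonlocalSymbol J t ξ - heatSymbol N (diffusivity J) t ξ)) (hi12.add hi3)
    (Eventually.of_forall fun ξ => hbound t ht ξ)
  refine hle.trans ?_
  simp only [Pi.add_apply]
  rw [integral_add hi12 hi3, integral_add hi1 hi2, integral_const_mul, integral_const_mul,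
    GaussianFourier.integral_rexp_neg_mul_sq_norm (by positivity), finrank_euclideanSpace_fin, hD₁,
    integral_indicator Metric.isOpen_ball.measurableSet, setIntegral_const, smul_eq_mul, ← hV,
    ← hI]
  have h2 : (Real.pi / (Real.pi ^ 2 * diffusivity J * t)) ^ ((N : ℝ) / 2) =
      P * t ^ (-((N : ℝ) / 2)) := by
    rw [← div_div, Real.div_rpow (by positivity) ht0.le, Real.rpow_neg ht0.le]
    rfl
  -- A factor `t^{-1/2}` is given up here: the exponent `(N+1)/2` already yields the full range `μ <
  -- α/(2N)`.
  have h3 : t⁻¹ * t ^ (-((N : ℝ) / 2)) ≤ t ^ (-(((N : ℝ) + 1) / 2)) := by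
    rw [← Real.rpow_neg_one, ← Real.rpow_add ht0]
    exact Real.rpow_le_rpow_of_exponent_le ht (by linarith)
  have h4 : Real.exp (-t) ≤ C₁ * t ^ (-(((N : ℝ) + 1) / 2)) := by
    refine le_trans ?_ (h₁ t ht)
    have h5 : Real.exp (-t) ≤ Real.exp (-(δ * t)) := Real.exp_le_exp.2 (by nlinarith)
    have h6 := Real.exp_pos (-(δ * t))
    nlinarith
  rw [h2]
  have e1 : V * Real.exp (-t) ≤ V * (C₁ * t ^ (-(((N : ℝ) + 1) / 2))) :=
    mul_le_mul_of_nonneg_left h4 measureReal_nonneg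
  have e2 : K * t⁻¹ * (P * t ^ (-((N : ℝ) / 2))) ≤ K * P * t ^ (-(((N : ℝ) + 1) / 2)) := by
    calc K * t⁻¹ * (P * t ^ (-((N : ℝ) / 2))) = K * P * (t⁻¹ * t ^ (-((N : ℝ) / 2))) := by ring
      _ ≤ _ := mul_le_mul_of_nonneg_left h3 (by positivity)
  have e3 : t * Real.exp (-(δ * t)) * I ≤ C₁ * t ^ (-(((N : ℝ) + 1) / 2)) * I :=
    mul_le_mul_of_nonneg_right (h₁ t ht) hI0
  linarith

end Symbols

/-! ### Fourier inversion: comparison of the kernels -/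

section KernelComparison

open scoped FourierTransform

variable {N : ℕ} {J f g : RSpace N → ℝ}

lemma integrable_fourier_integrand (hf : Integrable f) (ξ : RSpace N) :
    Integrable (fun x => Real.fourierChar (-inner ℝ x ξ) • (f x : ℂ)) :=
  (Real.fourierIntegral_convergent_iff ξ).2 hf.ofReal

lemma fourier_ofReal_sub (hf : Integrable f) (hg : Integrable g) (ξ : RSpace N) :
    𝓕 (fun x => ((f x - g x : ℝ) : ℂ)) ξ =
      𝓕 (fun x => (f x : ℂ)) ξ - 𝓕 (fun x => (g x : ℂ)) ξ := by
  simp_rw [Real.fourier_eq, Complex.ofReal_sub, smul_sub]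
  exact integral_sub (integrable_fourier_integrand hf ξ) (integrable_fourier_integrand hg ξ)

lemma fourier_ofReal_const_mul (c : ℝ) (f : RSpace N → ℝ) (ξ : RSpace N) :
    𝓕 (fun x => ((c * f x : ℝ) : ℂ)) ξ = c * 𝓕 (fun x => (f x : ℂ)) ξ := by
  simp_rw [Real.fourier_eq, Complex.ofReal_mul]
  rw [← integral_const_mul]
  congr 1
  funext x
  rw [mul_smul_comm]

lemma fourier_ofReal_sum {ι : Type*} (s : Finset ι) {F : ι → RSpace N → ℝ}
    (hF : ∀ i, Integrable (F i)) (ξ : RSpace N) :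
    𝓕 (fun x => ((∑ i ∈ s, F i x : ℝ) : ℂ)) ξ = ∑ i ∈ s, 𝓕 (fun x => (F i x : ℂ)) ξ := by
  simp_rw [Real.fourier_eq, Complex.ofReal_sum, Finset.smul_sum]
  exact integral_finsetSum _ fun i _ => integrable_fourier_integrand (hF i) ξ

lemma fourier_iterKernel (hJ : IsDispersalKernel J) (k : ℕ) (ξ : RSpace N) :
    𝓕 (fun x => (iterKernel J k x : ℂ)) ξ = ((cosTransform J ξ ^ (k + 1) : ℝ) : ℂ) := by
  induction k with
  | zero => simpa [iterKernel] using fourier_kernel hJ ξ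
  | succ k ih =>
    have h1 : (fun x => (iterKernel J (k + 1) x : ℂ)) =
        convolution (fun x => (J x : ℂ)) (fun x => (iterKernel J k x : ℂ))
          (ContinuousLinearMap.mul ℂ ℂ) volume := by
      funext x
      rw [convolution_eq_swap]
      simp only [iterKernel, kernelConv, ContinuousLinearMap.mul_apply', ← Complex.ofReal_mul]
      rw [integral_complex_ofReal]
    have h2 := Real.fourier_mul_convolution_eq (R := ℂ) (f₁ := fun x => (J x : ℂ))
      (f₂ := fun x => (iterKernel J k x : ℂ)) hJ.integrable.ofReal
      (integrable_iterKernel hJ k).ofReal ξ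
    rw [h1]
    refine h2.trans ?_
    rw [ih, fourier_kernel hJ]
    push_cast
    ring

lemma fourier_partialKernel (hJ : IsDispersalKernel J) (n : ℕ) (t : ℝ) (ξ : RSpace N) :
    𝓕 (fun x => (partialKernel J n t x : ℂ)) ξ =
      ((Real.exp (-t) * ∑ k ∈ Finset.range n,
        t ^ (k + 1) / (k + 1).factorial * cosTransform J ξ ^ (k + 1) : ℝ) : ℂ) := by
  unfold partialKernel
  rw [fourier_ofReal_const_mul,
    fourier_ofReal_sum _ fun k => (integrable_iterKernel hJ k).const_mul _]
  simp_rw [fourier_ofReal_const_mul, fourier_iterKernel hJ]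
  push_cast
  rfl

lemma fourier_heatKernel {a t : ℝ} (ha : 0 < a) (ht : 0 < t) (ξ : RSpace N) :
    𝓕 (fun x => (heatKernel a t x : ℂ)) ξ = (heatSymbol N a t ξ : ℂ) := by
  have hpi := Real.pi_pos
  simp_rw [heatKernel_eq_mul_exp]
  rw [fourier_ofReal_const_mul]
  set c : ℝ := 1 / (4 * a * t) with hc
  have hc0 : 0 < c := by positivity
  have h1 := fourier_gaussian_innerProductSpace (V := RSpace N) (b := (c : ℂ)) (by simpa using hc0) ξ
  have h2 : (fun x : RSpace N => ((Real.exp (-c * ‖x‖ ^ 2) : ℝ) : ℂ)) =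
      fun x => Complex.exp (-(c : ℂ) * (‖x‖ : ℂ) ^ 2) := by
    funext x
    push_cast
    rfl
  rw [h2, h1]
  have h3 : ((Real.pi : ℂ) / c) ^ ((Module.finrank ℝ (RSpace N) : ℂ) / 2) =
      (((4 * Real.pi * a * t) ^ ((N : ℝ) / 2) : ℝ) : ℂ) := by
    rw [finrank_euclideanSpace_fin, Complex.ofReal_cpow (by positivity)]
    congr 1
    · rw [← Complex.ofReal_div]
      congr 1
      rw [hc]
      field_simp
    · push_cast
      rfl
  have h4 : Complex.exp (-(Real.pi : ℂ) ^ 2 * (‖ξ‖ : ℂ) ^ 2 / c) = (heatSymbol N a t ξ : ℂ) := by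
    unfold heatSymbol
    rw [Complex.ofReal_exp]
    congr 1
    rw [hc]
    push_cast
    field_simp
  rw [h3, h4, ← mul_assoc, ← Complex.ofReal_mul, ← Real.rpow_add (by positivity)]
  simp [neg_div]

lemma abs_le_integral_fourier (hc : Continuous f) (hf : Integrable f)
    (hF : Integrable (𝓕 (fun x => (f x : ℂ)))) (x : RSpace N) :
    |f x| ≤ ∫ ξ, ‖𝓕 (fun x => (f x : ℂ)) ξ‖ := by
  have h1 := Continuous.fourierInv_fourier_eq (f := fun x => (f x : ℂ))
    (Complex.continuous_ofReal.comp hc) hf.ofReal hF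
  have h2 : ‖(f x : ℂ)‖ = |f x| := by simp
  rw [← h2, ← congr_fun h1 x, Real.fourierInv_eq]
  refine (norm_integral_le_integral_norm _).trans_eq ?_
  simp

/-- For fixed `t` the symbols of the truncations converge in `L¹` to `nonlocalSymbol`, so for large
`n` they inherit its distance to the heat symbol, with `C + 1` in place of `C` as slack. Fourier
inversion makes the bound uniform in `x`. -/
theorem partialKernel_sub_heatKernel_le (hJ : IsDispersalKernel J) (hN : 0 < N) :
    ∃ C : ℝ, 0 < C ∧ ∀ t, 1 ≤ t → ∀ᶠ n in atTop, ∀ x,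
      |partialKernel J n t x - heatKernel (diffusivity J) t x| ≤
        C * t ^ (-(((N : ℝ) + 1) / 2)) := by
  have ha := diffusivity_pos hJ hN
  have hpi := Real.pi_pos
  obtain ⟨C, hC0, hC⟩ := integral_abs_symbol_sub_le hJ hN
  refine ⟨C + 1, by positivity, fun t ht => ?_⟩
  have ht0 : 0 < t := by linarith
  set S : ℕ → RSpace N → ℝ := fun n ξ => Real.exp (-t) * ∑ k ∈ Finset.range n,
        t ^ (k + 1) / (k + 1).factorial * cosTransform J ξ ^ (k + 1) with hS
  have hSc : ∀ n, Continuous (S n) := by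
    intro n
    have := continuous_cosTransform hJ
    fun_prop
  -- Every term contains at least one factor `Ĵ`, because the Dirac part has been removed; this
  -- provides the integrable majorant.
  have hSle : ∀ n ξ, |S n ξ| ≤ |cosTransform J ξ| := by
    intro n ξ
    have h1 : |∑ k ∈ Finset.range n, t ^ (k + 1) / (k + 1).factorial * cosTransform J ξ ^ (k + 1)| ≤
        (∑ k ∈ Finset.range n, t ^ (k + 1) / (k + 1).factorial) * |cosTransform J ξ| := by
      refine (Finset.abs_sum_le_sum_abs _ _).trans ?_
      rw [Finset.sum_mul]
      refine Finset.sum_le_sum fun k _ => ?_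
      rw [abs_mul, abs_of_nonneg (by positivity), abs_pow]
      refine mul_le_mul_of_nonneg_left ?_ (by positivity)
      rw [pow_succ]
      exact mul_le_of_le_one_left (abs_nonneg _)
        (pow_le_one₀ (abs_nonneg _) (abs_cosTransform_le_one hJ ξ))
    have h2 : (∑ k ∈ Finset.range n, t ^ (k + 1) / (k + 1).factorial) ≤ Real.exp t := by
      have h := Real.sum_le_exp_of_nonneg ht0.le (n + 1)
      rw [Finset.sum_range_succ'] at h
      have h0 : (0 : ℝ) ≤ t ^ 0 / (Nat.factorial 0) := by positivity
      linarith
    rw [hS, abs_mul, abs_of_pos (Real.exp_pos _), Real.exp_neg, inv_mul_le_iff₀ (Real.exp_pos t)]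
    exact h1.trans (mul_le_mul_of_nonneg_right h2 (abs_nonneg _))
  set H := heatSymbol N (diffusivity J) t with hH
  have hHi : Integrable H := integrable_exp_neg_mul_sq_norm (by positivity)
  have hSi : ∀ n, Integrable (S n) := fun n =>
    (integrable_cosTransform hJ).mono (hSc n).aestronglyMeasurable (Eventually.of_forall (hSle n))
  have hlim : Tendsto (fun n => ∫ ξ, |S n ξ - H ξ|) atTop
      (𝓝 (∫ ξ, |nonlocalSymbol J t ξ - H ξ|)) := by
    refine tendsto_integral_of_dominated_convergence (fun ξ => |cosTransform J ξ| + |H ξ|)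
      (fun n => ((hSi n).sub hHi).abs.1) ((integrable_cosTransform hJ).abs.add hHi.abs)
      (fun n => Eventually.of_forall fun ξ => ?_) (Eventually.of_forall fun ξ => ?_)
    · rw [Real.norm_eq_abs, abs_abs]
      have := hSle n ξ
      exact (abs_sub _ _).trans (by linarith)
    · refine Tendsto.abs (Tendsto.sub ?_ tendsto_const_nhds)
      have h1 : Tendsto (fun n => ∑ k ∈ Finset.range n, (t * cosTransform J ξ) ^ k / k.factorial)
          atTop (𝓝 (Real.exp (t * cosTransform J ξ))) := by
        rw [Real.exp_eq_exp_ℝ]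
        exact (NormedSpace.expSeries_div_hasSum_exp (t * cosTransform J ξ)).tendsto_sum_nat
      have h2 := (((tendsto_add_atTop_iff_nat 1).2 h1).sub_const 1).const_mul (Real.exp (-t))
      refine h2.congr fun n => ?_
      simp only [hS]
      rw [Finset.sum_range_succ']
      simp only [pow_zero, Nat.factorial_zero, Nat.cast_one, div_one, add_sub_cancel_right]
      congr 1
      refine Finset.sum_congr rfl fun k _ => ?_
      rw [mul_pow]
      ring
  have hlt : ∫ ξ, |nonlocalSymbol J t ξ - H ξ| < (C + 1) * t ^ (-(((N : ℝ) + 1) / 2)) := by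
    have h1 : 0 < t ^ (-(((N : ℝ) + 1) / 2)) := Real.rpow_pos_of_pos ht0 _
    linarith [hC t ht]
  filter_upwards [hlim.eventually (gt_mem_nhds hlt)] with n hn x
  have hFT : 𝓕 (fun x => ((partialKernel J n t x - heatKernel (diffusivity J) t x : ℝ) : ℂ)) =
      fun ξ => ((S n ξ - H ξ : ℝ) : ℂ) := by
    funext ξ
    rw [fourier_ofReal_sub (integrable_partialKernel hJ n t) (integrable_heatKernel ha ht0),
      fourier_partialKernel hJ, fourier_heatKernel ha ht0,
      ← Complex.ofReal_sub]
  have h1 := abs_le_integral_fourier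
    ((continuous_partialKernel hJ n t).sub (continuous_heatKernel (a := diffusivity J) (t := t)))
    ((integrable_partialKernel hJ n t).sub (integrable_heatKernel ha ht0))
    (by
      simp only [Pi.sub_apply]
      rw [hFT]
      exact ((hSi n).sub hHi).ofReal) x
  simp only [Pi.sub_apply] at h1
  rw [hFT] at h1
  simp only [Complex.norm_real, Real.norm_eq_abs] at h1
  exact h1.trans hn.le

end KernelComparison

/-! ### The nonlocal solution compared with the heat flow -/

section Comparison

variable {N : ℕ} {J u₀ : RSpace N → ℝ} {u : ℝ → RSpace N → ℝ} {A M α : ℝ}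

lemma abs_kernelConv_partialKernel_sub_heatFlow_le (hJ : IsDispersalKernel J) (hN : 0 < N)
    (hf : AEStronglyMeasurable u₀) (hM : ∀ᵐ y, |u₀ y| ≤ M) {β C : ℝ} (hβ0 : 0 ≤ β) (hβ : β < N)
    (hC : 0 ≤ C) (hfC : ∀ᵐ y, |u₀ y| ≤ C * ‖y‖ ^ (-β)) {B t : ℝ} (hB : 0 < B) (ht : 0 < t) {n : ℕ}
    (hn : ∀ x, |partialKernel J n t x - heatKernel (diffusivity J) t x| ≤ B) (x : RSpace N) :
    |kernelConv (partialKernel J n t) u₀ x - heatFlow (diffusivity J) u₀ t x| ≤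
      C * (sphereArea N / (N - β) + 2) * B ^ (β / N) := by
  have ha := diffusivity_pos hJ hN
  set a := diffusivity J
  have hW := (integrable_partialKernel hJ n t).comp_sub_left x
  have hG := integrable_heatKernel_sub ha ht x
  have hWint := integral_abs_partialKernel_le hJ n ht.le
  rw [← integral_sub_left_eq_self (fun y => |partialKernel J n t y|) volume x] at hWint
  have hmass : ∫ y, |partialKernel J n t (x - y) - heatKernel a t (x - y)| ≤ 2 := by
    have h1 := integral_mono (μ := volume) (hW.sub hG).abs (hW.abs.add hG.abs)
      (fun y => abs_sub (partialKernel J n t (x - y)) (heatKernel a t (x - y)))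
    have h2 : ∫ y, (|partialKernel J n t (x - y)| + |heatKernel a t (x - y)|) =
        (∫ y, |partialKernel J n t (x - y)|) + ∫ y, |heatKernel a t (x - y)| :=
      integral_add hW.abs hG.abs
    rw [integral_abs_heatKernel_sub ha ht] at h2
    have h3 : ∫ y, |partialKernel J n t (x - y) - heatKernel a t (x - y)| ≤
      ∫ y, (|partialKernel J n t (x - y)| + |heatKernel a t (x - y)|) := h1
    linarith
  have h := (integral_mul_le_of_le_rpow
    (k := fun y => partialKernel J n t (x - y) - heatKernel a t (x - y)) hN hβ0 hβ hC hB
    (hW.sub hG) (fun y => hn (x - y)) hmass hf hfC).2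
  have h4 : kernelConv (partialKernel J n t) u₀ x - heatFlow a u₀ t x =
      ∫ y, (partialKernel J n t (x - y) - heatKernel a t (x - y)) * u₀ y := by
    simp_rw [sub_mul]
    exact (integral_sub (integrable_kernelConv (integrable_partialKernel hJ n t) hf hM x)
      (integrable_heatKernel_mul ha ht hf hM x)).symm
  rw [h4]
  exact h

/-- The error consists of the Duhamel remainder, the term `e^{-t}u₀`, and `(W_t - G_t) * u₀`; the
last dictates the rate. -/
theorem nonlocal_sub_heatFlow_le_of_le_rpow (hJ : IsDispersalKernel J) (hN : 0 < N)
    (hu : IsNonlocalSolution J u₀ u) (hf : AEStronglyMeasurable u₀) (hM : ∀ᵐ y, |u₀ y| ≤ M)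
    (hMu : ∀ t, 0 ≤ t → ∀ᵐ y, |u t y| ≤ M) {β C : ℝ} (hβ0 : 0 ≤ β) (hβ : β < N) (hC : 0 ≤ C)
    (hfC : ∀ᵐ y, |u₀ y| ≤ C * ‖y‖ ^ (-β)) :
    ∃ K : ℝ, 0 ≤ K ∧ ∀ t, 1 ≤ t → ∀ᵐ x, |u t x - heatFlow (diffusivity J) u₀ t x| ≤
      K * t ^ (-(β * (N + 1) / (2 * N))) := by
  have hN' : (0 : ℝ) < N := by exact_mod_cast hN
  have hM0 : 0 ≤ M := by
    obtain ⟨y, hy⟩ := hM.exists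
    exact (abs_nonneg _).trans hy
  set q := β * (N + 1) / (2 * N) with hq
  obtain ⟨C₁, hC₁, h₁⟩ := partialKernel_sub_heatKernel_le hJ hN
  obtain ⟨C₂, hC₂, h₂⟩ := exists_mul_exp_neg_le_rpow one_pos q
  have hNβ : 0 < (N : ℝ) - β := by linarith
  have hσ := sphereArea_nonneg (N := N)
  refine ⟨1 + C₂ * M + C * (sphereArea N / (N - β) + 2) * C₁ ^ (β / N), by positivity,
    fun t ht => ?_⟩
  have ht0 : 0 < t := by linarith
  -- With `t` fixed, `n` is taken so large that the factorial remainder falls below the target rate.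
  have hfact : ∀ᶠ n : ℕ in atTop, 2 * M * (t ^ n / n.factorial) < t ^ (-q) := by
    have h := (FloorSemiring.tendsto_pow_div_factorial_atTop t).const_mul (2 * M)
    rw [mul_zero] at h
    exact h.eventually (gt_mem_nhds (Real.rpow_pos_of_pos ht0 _))
  obtain ⟨n, hn1, hn2⟩ := ((h₁ t ht).and hfact).exists
  filter_upwards [nonlocal_solution_expansion hJ hu hf hM hMu ht0.le n, hM] with x hx1 hx2
  have h3 := abs_kernelConv_partialKernel_sub_heatFlow_le hJ hN hf hM hβ0 hβ hC hfC
    (mul_pos hC₁ (Real.rpow_pos_of_pos ht0 _)) ht0 hn1 x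
  rw [Real.mul_rpow hC₁.le (Real.rpow_nonneg ht0.le _), ← Real.rpow_mul ht0.le,
    show -(((N : ℝ) + 1) / 2) * (β / N) = -q by rw [hq]; field_simp] at h3
  have h4 : |Real.exp (-t) * u₀ x| ≤ C₂ * M * t ^ (-q) := by
    rw [abs_mul, abs_of_pos (Real.exp_pos _)]
    have h5 := h₂ t ht
    rw [one_mul] at h5
    have h6 : Real.exp (-t) ≤ C₂ * t ^ (-q) := by
      refine le_trans ?_ h5
      exact le_mul_of_one_le_left (Real.exp_pos _).le ht
    calc Real.exp (-t) * |u₀ x| ≤ C₂ * t ^ (-q) * M :=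
          mul_le_mul h6 hx2 (abs_nonneg _) (by positivity)
      _ = _ := by ring
  have h7 : u t x - heatFlow (diffusivity J) u₀ t x =
      (u t x - Real.exp (-t) * u₀ x - kernelConv (partialKernel J n t) u₀ x) +
        Real.exp (-t) * u₀ x +
        (kernelConv (partialKernel J n t) u₀ x - heatFlow (diffusivity J) u₀ t x) := by ring
  rw [h7]
  refine (abs_add_three _ _ _).trans ?_
  have h8 := hx1.trans hn2.le
  linarith

/-! ### Decay of the datum and the resulting rate of approximation. -/

lemma exists_radius_of_tendsto
    (h : Tendsto (fun x => ‖x‖ ^ α * u₀ x) (cocompact (RSpace N) ⊓ ae volume) (𝓝 A)) {ε : ℝ}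
    (hε : 0 < ε) :
    ∃ R : ℝ, ∀ᵐ y, R ≤ ‖y‖ → |u₀ y - A * ‖y‖ ^ (-α)| ≤ ε * ‖y‖ ^ (-α) := by
  have h1 := (Metric.tendsto_nhds.1 h) ε hε
  rw [eventually_iff, mem_inf_iff] at h1
  obtain ⟨s, hs, t, ht, hst⟩ := h1
  rw [← Metric.cobounded_eq_cocompact, (hasBasis_cobounded_norm (E := RSpace N)).mem_iff] at hs
  obtain ⟨R, -, hR⟩ := hs
  refine ⟨max R 1, ?_⟩
  filter_upwards [ht] with y hy hRy
  have hy1 : 1 ≤ ‖y‖ := (le_max_right _ _).trans hRy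
  have hy0 : 0 < ‖y‖ := by linarith
  have h2 : y ∈ {x | dist (‖x‖ ^ α * u₀ x) A < ε} := by
    rw [hst]
    exact ⟨hR ((le_max_left _ _).trans hRy), hy⟩
  have h3 : |‖y‖ ^ α * u₀ y - A| < ε := h2
  have h4 : ‖y‖ ^ α * ‖y‖ ^ (-α) = 1 := by
    rw [← Real.rpow_add hy0, add_neg_cancel, Real.rpow_zero]
  have h5 : u₀ y - A * ‖y‖ ^ (-α) = (‖y‖ ^ α * u₀ y - A) * ‖y‖ ^ (-α) := by
    linear_combination (-u₀ y) * h4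
  have h6 : 0 < ‖y‖ ^ (-α) := Real.rpow_pos_of_pos hy0 _
  rw [h5, abs_mul, abs_of_pos h6]
  exact mul_le_mul_of_nonneg_right h3.le h6.le

/-- Beyond radius `R ≥ 1` the asymptotics give `|y|^{-α} ≤ |y|^{-β}` up to a constant; inside, `M ≤
M R^β |y|^{-β}`. The freedom `β < α` keeps the exponent below `N` when `α = N`. -/
lemma exists_abs_le_rpow (hN : 0 < N) (hM : ∀ᵐ y, |u₀ y| ≤ M)
    (h : Tendsto (fun x => ‖x‖ ^ α * u₀ x) (cocompact (RSpace N) ⊓ ae volume) (𝓝 A)) {β : ℝ}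
    (hβ0 : 0 ≤ β) (hβα : β ≤ α) :
    ∃ C : ℝ, 0 ≤ C ∧ ∀ᵐ y, |u₀ y| ≤ C * ‖y‖ ^ (-β) := by
  have hM0 : 0 ≤ M := by
    obtain ⟨y, hy⟩ := hM.exists
    exact (abs_nonneg _).trans hy
  obtain ⟨R', hR'⟩ := exists_radius_of_tendsto h one_pos
  set R := max R' 1 with hR
  have hR1 : 1 ≤ R := le_max_right _ _
  refine ⟨|A| + 1 + M * R ^ β, by positivity, ?_⟩
  filter_upwards [hM, hR', ae_norm_pos hN] with y h1 h2 hy0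
  have hp : 0 < ‖y‖ ^ (-β) := Real.rpow_pos_of_pos hy0 _
  rcases le_or_gt R ‖y‖ with hRy | hRy
  · have h3 := h2 ((le_max_left _ _).trans hRy)
    have h4 : ‖y‖ ^ (-α) ≤ ‖y‖ ^ (-β) :=
      Real.rpow_le_rpow_of_exponent_le (hR1.trans hRy) (by linarith)
    have h5 : |A * ‖y‖ ^ (-α)| = |A| * ‖y‖ ^ (-α) := by
      rw [abs_mul, abs_of_pos (Real.rpow_pos_of_pos hy0 _)]
    have h6 : |u₀ y| ≤ (|A| + 1) * ‖y‖ ^ (-α) := by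
      have := abs_sub_abs_le_abs_sub (u₀ y) (A * ‖y‖ ^ (-α))
      linarith
    have h7 : (|A| + 1) * ‖y‖ ^ (-α) ≤ (|A| + 1) * ‖y‖ ^ (-β) :=
      mul_le_mul_of_nonneg_left h4 (by positivity)
    have h8 : 0 ≤ M * R ^ β * ‖y‖ ^ (-β) := by positivity
    linarith
  · have h3 : R ^ (-β) ≤ ‖y‖ ^ (-β) := Real.rpow_le_rpow_of_nonpos hy0 hRy.le (by linarith)
    have h4 : R ^ β * R ^ (-β) = 1 := by
      rw [← Real.rpow_add (by linarith), add_neg_cancel, Real.rpow_zero]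
    have h5 : M * R ^ β * R ^ (-β) ≤ M * R ^ β * ‖y‖ ^ (-β) :=
      mul_le_mul_of_nonneg_left h3 (by positivity)
    have h6 : 0 ≤ (|A| + 1) * ‖y‖ ^ (-β) := by positivity
    rw [mul_assoc, h4, mul_one] at h5
    linarith

theorem nonlocal_sub_heatFlow_le (hJ : IsDispersalKernel J) (hN : 0 < N)
    (hu : IsNonlocalSolution J u₀ u) (hf : AEStronglyMeasurable u₀) (hM : ∀ᵐ y, |u₀ y| ≤ M)
    (hMu : ∀ t, 0 ≤ t → ∀ᵐ y, |u t y| ≤ M) (hα : 0 < α) (hαN : α ≤ N)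
    (h : Tendsto (fun x => ‖x‖ ^ α * u₀ x) (cocompact (RSpace N) ⊓ ae volume) (𝓝 A)) {μ : ℝ}
    (hμ0 : 0 < μ) (hμ : μ < α / (2 * N)) :
    ∃ K : ℝ, 0 ≤ K ∧ ∀ t, 1 ≤ t → ∀ᵐ x, |u t x - heatFlow (diffusivity J) u₀ t x| ≤
      K * t ^ (-(α / 2 + μ)) := by
  have hN' : (0 : ℝ) < N := by exact_mod_cast hN
  -- `β` solves `β(N+1)/(2N) = α/2 + μ`, and `β < α` is equivalent to `μ < α/(2N)`.
  set β := (α * N + 2 * N * μ) / (N + 1) with hβ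
  have hβ0 : 0 ≤ β := by positivity
  have hβα : β < α := by
    rw [hβ, div_lt_iff₀ (by positivity)]
    rw [lt_div_iff₀ (by positivity)] at hμ
    linarith
  have hq : β * (N + 1) / (2 * N) = α / 2 + μ := by
    rw [hβ]
    field_simp
  obtain ⟨C, hC, hfC⟩ := exists_abs_le_rpow hN hM h hβ0 hβα.le
  have := nonlocal_sub_heatFlow_le_of_le_rpow hJ hN hu hf hM hMu hβ0 (hβα.trans_le hαN) hC hfC
  rwa [hq] at this

lemma abs_heatFlow_le {a t : ℝ} (ha : 0 < a) (ht : 0 < t) (hM : ∀ᵐ y, |u₀ y| ≤ M)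
    (x : RSpace N) : |heatFlow a u₀ t x| ≤ M := by
  have h := abs_kernelConv_le (integrable_heatKernel ha ht) hM x
  rw [← integral_sub_left_eq_self (fun y => |heatKernel a t y|) volume x,
    integral_abs_heatKernel_sub ha ht, one_mul] at h
  exact h

/-! ### Conclusions in terms of `L^∞` norms. -/

lemma ofReal_mul_eLpNorm_le {m : Measure (RSpace N)} {g : RSpace N → ℝ} {s B D : ℝ} (hs : 0 ≤ s)
    (hg : ∀ᵐ x ∂m, |g x| ≤ B) (hB : s * B ≤ D) :
    ENNReal.ofReal s * eLpNorm g ∞ m ≤ ENNReal.ofReal D := by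
  have h1 : eLpNorm g ∞ m ≤ ENNReal.ofReal B := by
    rw [eLpNorm_exponent_top]
    exact eLpNormEssSup_le_of_ae_bound hg
  calc ENNReal.ofReal s * eLpNorm g ∞ m ≤ ENNReal.ofReal s * ENNReal.ofReal B := by gcongr
    _ = ENNReal.ofReal (s * B) := (ENNReal.ofReal_mul hs).symm
    _ ≤ ENNReal.ofReal D := ENNReal.ofReal_le_ofReal hB

/-- The pointwise estimates hold on the whole space, so `K` has no influence. -/
lemma tendsto_parabolicSupNorm_zero {p K : ℝ} {g : ℝ → RSpace N → ℝ}
    (h : ∀ ε, 0 < ε → ∃ T : ℝ, ∀ t, T ≤ t → ∀ᵐ x, t ^ p * |g t x| ≤ ε) :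
    Tendsto (fun t => ENNReal.ofReal (t ^ p) * parabolicSupNorm K t (g t)) atTop (𝓝 0) := by
  rw [ENNReal.tendsto_nhds_zero]
  intro ε hε
  obtain ⟨η, hη0, hηε⟩ := ENNReal.lt_iff_exists_nnreal_btwn.1 hε
  have hη : (0 : ℝ) < η := by exact_mod_cast hη0
  obtain ⟨T, hT⟩ := h η hη
  filter_upwards [eventually_ge_atTop T, eventually_gt_atTop 0] with t ht ht0
  have htp : 0 < t ^ p := Real.rpow_pos_of_pos ht0 p
  refine le_trans ?_ hηε.le
  rw [← ENNReal.ofReal_coe_nnreal]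
  refine ofReal_mul_eLpNorm_le (B := η / t ^ p) htp.le (ae_restrict_of_ae ?_)
    (mul_div_cancel₀ _ htp.ne').le
  filter_upwards [hT t ht] with x hx
  rw [le_div_iff₀ htp]
  linarith

lemma exists_mul_rpow_neg_le {K μ : ℝ} (hμ : 0 < μ) {ε : ℝ} (hε : 0 < ε) :
    ∃ T : ℝ, ∀ t, T ≤ t → K * t ^ (-μ) ≤ ε := by
  have h := (tendsto_rpow_neg_atTop hμ).const_mul K
  rw [mul_zero] at h
  obtain ⟨T, hT⟩ := eventually_atTop.1 (h.eventually (gt_mem_nhds hε))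
  exact ⟨T, fun t ht => (hT t ht).le⟩

lemma rpow_mul_le_of_le {K μ p t d : ℝ} (ht : 0 < t) (hd : d ≤ K * t ^ (-(p + μ))) :
    t ^ p * d ≤ K * t ^ (-μ) := by
  refine (mul_le_mul_of_nonneg_left hd (Real.rpow_nonneg ht.le p)).trans_eq ?_
  rw [mul_left_comm, ← Real.rpow_add ht]
  congr 2
  ring

theorem nonlocal_sub_heat_eLpNorm_le (hJ : IsDispersalKernel J) (hN : 0 < N)
    (hu : IsNonlocalSolution J u₀ u) (hf : MemLp u₀ ∞) (hM : ∀ᵐ y, |u₀ y| ≤ M)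
    (hMu : ∀ t, 0 ≤ t → ∀ᵐ y, |u t y| ≤ M) (hα : 0 < α) (hαN : α ≤ N)
    (h : Tendsto (fun x => ‖x‖ ^ α * u₀ x) (cocompact (RSpace N) ⊓ ae volume) (𝓝 A))
    {v : ℝ → RSpace N → ℝ} (hv : IsBoundedHeatSolution (diffusivity J) u₀ v) {μ : ℝ}
    (hμ0 : 0 < μ) (hμ : μ < α / (2 * N)) :
    ∃ C : ℝ, ∀ t : ℝ, 0 < t →
      ENNReal.ofReal (t ^ (α / 2)) * eLpNorm (fun x => u t x - v t x) ∞ volume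
        ≤ ENNReal.ofReal (C * t ^ (-μ)) := by
  have ha := diffusivity_pos hJ hN
  have hM0 : 0 ≤ M := by
    obtain ⟨y, hy⟩ := hM.exists
    exact (abs_nonneg _).trans hy
  obtain ⟨K, hK0, hK⟩ := nonlocal_sub_heatFlow_le hJ hN hu hf.1 hM hMu hα hαN h hμ0 hμ
  refine ⟨K + 2 * M, fun t ht => ?_⟩
  have hμt : 0 < t ^ (-μ) := Real.rpow_pos_of_pos ht _
  simp_rw [hv.eq_heatFlow ha hf ht]
  rcases le_or_gt 1 t with h1 | h1
  -- For `t < 1` boundedness suffices, because `t^{α/2} ≤ 1 ≤ t^{-μ}`.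
  · refine ofReal_mul_eLpNorm_le (Real.rpow_nonneg ht.le _) (hK t h1) ?_
    refine (rpow_mul_le_of_le ht le_rfl).trans ?_
    exact mul_le_mul_of_nonneg_right (by linarith) hμt.le
  · refine ofReal_mul_eLpNorm_le (B := 2 * M) (Real.rpow_nonneg ht.le _) ?_ ?_
    · filter_upwards [hMu t ht.le] with x hx
      have := abs_heatFlow_le ha ht hM x
      exact (abs_sub _ _).trans (by linarith)
    · have h2 : t ^ (α / 2) ≤ 1 := Real.rpow_le_one ht.le h1.le (by positivity)
      have h3 : 1 ≤ t ^ (-μ) := Real.one_le_rpow_of_pos_of_le_one_of_nonpos ht h1.le (by linarith)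
      have h4 : t ^ (α / 2) * (2 * M) ≤ 2 * M := mul_le_of_le_one_left (by positivity) h2
      have h5 : 2 * M ≤ 2 * M * t ^ (-μ) := le_mul_of_one_le_right (by positivity) h3
      have h6 : 0 ≤ K * t ^ (-μ) := by positivity
      linarith

/-- As `α < N`, the choice `β = α` is admissible, both for the heat flow and for the difference,
whose rate `α(N+1)/(2N)` exceeds `α/2`. Times below one are covered by `M`. -/
theorem nonlocal_le_rpow (hJ : IsDispersalKernel J) (hN : 0 < N)
    (hu : IsNonlocalSolution J u₀ u) (hf : AEStronglyMeasurable u₀) (hM : ∀ᵐ y, |u₀ y| ≤ M)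
    (hMu : ∀ t, 0 ≤ t → ∀ᵐ y, |u t y| ≤ M) (hα : 0 < α) (hαN : α < N)
    (h : Tendsto (fun x => ‖x‖ ^ α * u₀ x) (cocompact (RSpace N) ⊓ ae volume) (𝓝 A)) :
    ∃ C : ℝ, ∀ t : ℝ, 0 < t → ∀ᵐ x, u t x ≤ C * t ^ (-(α / 2)) := by
  have ha := diffusivity_pos hJ hN
  have hpi := Real.pi_pos
  have hN' : (0 : ℝ) < N := by exact_mod_cast hN
  have hNα : 0 < (N : ℝ) - α := by linarith
  have hσ := sphereArea_nonneg (N := N)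
  have hM0 : 0 ≤ M := by
    obtain ⟨y, hy⟩ := hM.exists
    exact (abs_nonneg _).trans hy
  obtain ⟨C, hC, hfC⟩ := exists_abs_le_rpow hN hM h hα.le le_rfl
  obtain ⟨K, hK0, hK⟩ := nonlocal_sub_heatFlow_le_of_le_rpow hJ hN hu hf hM hMu hα.le hαN hC hfC
  set P := C * ((sphereArea N / (N - α) + 1) * (4 * Real.pi * diffusivity J) ^ (-α / 2)) with hP
  have hP0 : 0 ≤ P := by positivity
  refine ⟨K + P + M, fun t ht => ?_⟩
  have htα : 0 < t ^ (-(α / 2)) := Real.rpow_pos_of_pos ht _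
  rcases le_or_gt 1 t with h1 | h1
  · filter_upwards [hK t h1] with x hx
    have h2 := (heatFlow_le_of_le_rpow hN ha ht hα.le hαN hC hf hfC x).2
    have h3 : t ^ (-(α * (N + 1) / (2 * N))) ≤ t ^ (-(α / 2)) := by
      refine Real.rpow_le_rpow_of_exponent_le h1 (neg_le_neg ?_)
      rw [div_le_div_iff₀ two_pos (by positivity)]
      nlinarith
    have h4 : K * t ^ (-(α * (N + 1) / (2 * N))) ≤ K * t ^ (-(α / 2)) :=
      mul_le_mul_of_nonneg_left h3 hK0
    have h5 : 0 ≤ M * t ^ (-(α / 2)) := by positivity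
    rw [neg_div] at h2
    rw [hP, neg_div]
    linarith [le_abs_self (u t x - heatFlow (diffusivity J) u₀ t x),
      le_abs_self (heatFlow (diffusivity J) u₀ t x)]
  · filter_upwards [hMu t ht.le] with x hx
    have h3 : 1 ≤ t ^ (-(α / 2)) :=
      Real.one_le_rpow_of_pos_of_le_one_of_nonpos ht h1.le (by linarith)
    have h4 : M ≤ M * t ^ (-(α / 2)) := le_mul_of_one_le_right hM0 h3
    have h5 : 0 ≤ (K + P) * t ^ (-(α / 2)) := by positivity
    linarith [le_abs_self (u t x)]

theorem nonlocal_tendsto_power_solution (hJ : IsDispersalKernel J) (hN : 0 < N)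
    (hu : IsNonlocalSolution J u₀ u) (hf : AEStronglyMeasurable u₀) (hM : ∀ᵐ y, |u₀ y| ≤ M)
    (hMu : ∀ t, 0 ≤ t → ∀ᵐ y, |u t y| ≤ M) (hα : 0 < α) (hαN : α < N)
    (h : Tendsto (fun x => ‖x‖ ^ α * u₀ x) (cocompact (RSpace N) ⊓ ae volume) (𝓝 A))
    {U : ℝ → RSpace N → ℝ} (hU : IsPowerHeatSolution (diffusivity J) α A U) (K : ℝ) :
    Tendsto (fun t : ℝ => ENNReal.ofReal (t ^ (α / 2)) *
      parabolicSupNorm K t (fun x => u t x - U t x)) atTop (𝓝 0) := by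
  have ha := diffusivity_pos hJ hN
  have hN' : (0 : ℝ) < N := by exact_mod_cast hN
  set g : RSpace N → ℝ := fun y => A / ‖y‖ ^ α with hg
  have hgm : AEStronglyMeasurable g :=
    (measurable_const.div (measurable_norm.pow_const α)).aestronglyMeasurable
  have hgeq : ∀ y, g y = A * ‖y‖ ^ (-α) := fun y => by
    rw [Real.rpow_neg (norm_nonneg y)]
    rfl
  have hgC : ∀ᵐ y, |g y| ≤ |A| * ‖y‖ ^ (-α) := Eventually.of_forall fun y => by
    rw [hgeq, abs_mul, abs_of_nonneg (Real.rpow_nonneg (norm_nonneg y) _)]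
  obtain ⟨C, hC, hfC⟩ := exists_abs_le_rpow hN hM h hα.le le_rfl
  have hdC : ∀ᵐ y, |u₀ y - g y| ≤ (C + |A|) * ‖y‖ ^ (-α) := by
    filter_upwards [hfC, hgC] with y h1 h2
    exact (abs_sub _ _).trans (by linarith)
  -- Any admissible `μ` would do; this is half of the upper limit.
  have hμ0 : 0 < α / (4 * N) := by positivity
  obtain ⟨K₁, hK₁0, hK₁⟩ := nonlocal_sub_heatFlow_le hJ hN hu hf hM hMu hα hαN.le h hμ0
    (by gcongr; norm_num)
  refine tendsto_parabolicSupNorm_zero fun ε hε => ?_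
  obtain ⟨T₁, hT₁⟩ := heatFlow_decay_of_small_at_infinity (f := fun y => u₀ y - g y) hN ha hα.le hαN
    (by positivity) (hf.sub hgm) hdC (fun η hη => by
      obtain ⟨R, hR⟩ := exists_radius_of_tendsto h hη
      refine ⟨R, ?_⟩
      filter_upwards [hR] with y hy hRy
      rw [hgeq]
      exact hy hRy) (half_pos hε)
  obtain ⟨T₂, hT₂⟩ := exists_mul_rpow_neg_le (K := K₁) hμ0 (half_pos hε)
  refine ⟨max (max T₁ T₂) 1, fun t ht => ?_⟩
  have ht1 : 1 ≤ t := (le_max_right _ _).trans ht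
  have ht0 : 0 < t := by linarith
  have hflow : ∀ x, heatFlow (diffusivity J) (fun y => u₀ y - g y) t x =
      heatFlow (diffusivity J) u₀ t x - U t x := by
    intro x
    rw [hU.eq_heatFlow hN ha hα.le hαN ht0]
    unfold heatFlow
    simp_rw [mul_sub]
    exact integral_sub (integrable_heatKernel_mul ha ht0 hf hM x)
      (heatFlow_le_of_le_rpow hN ha ht0 hα.le hαN (abs_nonneg A) hgm hgC x).1
  filter_upwards [hK₁ t ht1] with x hx
  have h1 := hT₁ t ((le_max_left _ _).trans ((le_max_left _ _).trans ht)) x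
  have h2 := (rpow_mul_le_of_le ht0 hx).trans
    (hT₂ t ((le_max_right _ _).trans ((le_max_left _ _).trans ht)))
  rw [hflow] at h1
  have h3 := mul_le_mul_of_nonneg_left (abs_sub_le (u t x) (heatFlow (diffusivity J) u₀ t x)
    (U t x)) (Real.rpow_nonneg ht0.le (α / 2))
  rw [mul_add] at h3
  linarith

theorem nonlocal_critical_asymptotics (hJ : IsDispersalKernel J) (hN : 0 < N)
    (hu : IsNonlocalSolution J u₀ u) (hf : AEStronglyMeasurable u₀) (hM : ∀ᵐ y, |u₀ y| ≤ M)
    (hMu : ∀ t, 0 ≤ t → ∀ᵐ y, |u t y| ≤ M)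
    (h : Tendsto (fun x => ‖x‖ ^ (N : ℝ) * u₀ x) (cocompact (RSpace N) ⊓ ae volume) (𝓝 A))
    {ε : ℝ} (hε : 0 < ε) :
    ∃ T : ℝ, ∀ t, T ≤ t → ∀ᵐ x, t ^ ((N : ℝ) / 2) *
      |u t x / Real.log t - A * sphereArea N / 2 * heatKernel (diffusivity J) t x| ≤ ε := by
  have ha := diffusivity_pos hJ hN
  have hN' : (0 : ℝ) < N := by exact_mod_cast hN
  obtain ⟨C, hC, hfC⟩ := exists_abs_le_rpow hN hM h hN'.le le_rfl
  -- For `α = N` the admissible range is `0 < μ < 1/2`.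
  have hμ0 : (0 : ℝ) < 1 / 4 := by norm_num
  obtain ⟨K, hK0, hK⟩ := nonlocal_sub_heatFlow_le hJ hN hu hf hM hMu hN' le_rfl h hμ0
    (by rw [lt_div_iff₀ (by positivity)]; linarith)
  obtain ⟨T₁, hT₁⟩ := heatFlow_critical_asymptotics hN ha hC hf hM hfC
    (fun η hη => exists_radius_of_tendsto h hη) (half_pos hε)
  obtain ⟨T₂, hT₂⟩ := exists_mul_rpow_neg_le (K := K) hμ0 (half_pos hε)
  refine ⟨max (max T₁ T₂) (Real.exp 1), fun t ht => ?_⟩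
  have hte : Real.exp 1 ≤ t := (le_max_right _ _).trans ht
  have ht1 : 1 ≤ t := (Real.one_le_exp zero_le_one).trans hte
  have ht0 : 0 < t := by linarith
  have hlog : 1 ≤ Real.log t := (Real.le_log_iff_exp_le ht0).2 hte
  filter_upwards [hK t ht1] with x hx
  have h1 := hT₁ t ((le_max_left _ _).trans ((le_max_left _ _).trans ht)) x
  have h2 := (rpow_mul_le_of_le ht0 hx).trans
    (hT₂ t ((le_max_right _ _).trans ((le_max_left _ _).trans ht)))
  set w := heatFlow (diffusivity J) u₀ t x
  have h3 : |u t x / Real.log t - w / Real.log t| ≤ |u t x - w| := by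
    rw [← sub_div, abs_div, abs_of_pos (show 0 < Real.log t by linarith)]
    exact div_le_self (abs_nonneg _) hlog
  have h4 := mul_le_mul_of_nonneg_left ((abs_sub_le (u t x / Real.log t) (w / Real.log t)
    (A * sphereArea N / 2 * heatKernel (diffusivity J) t x)).trans (add_le_add_left h3 _))
    (Real.rpow_nonneg ht0.le ((N : ℝ) / 2))
  rw [mul_add] at h4
  linarith

theorem nonlocal_le_rpow_mul_log (hJ : IsDispersalKernel J) (hN : 0 < N)
    (hu : IsNonlocalSolution J u₀ u) (hf : AEStronglyMeasurable u₀) (hM : ∀ᵐ y, |u₀ y| ≤ M)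
    (hMu : ∀ t, 0 ≤ t → ∀ᵐ y, |u t y| ≤ M)
    (h : Tendsto (fun x => ‖x‖ ^ (N : ℝ) * u₀ x) (cocompact (RSpace N) ⊓ ae volume) (𝓝 A)) :
    ∃ C : ℝ, ∀ t : ℝ, 2 ≤ t → ∀ᵐ x, u t x ≤ C * (t ^ (-((N : ℝ) / 2)) * Real.log t) := by
  have ha := diffusivity_pos hJ hN
  have hpi := Real.pi_pos
  have hM0 : 0 ≤ M := by
    obtain ⟨y, hy⟩ := hM.exists
    exact (abs_nonneg _).trans hy
  obtain ⟨T, hT⟩ := nonlocal_critical_asymptotics hJ hN hu hf hM hMu h one_pos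
  set c := A * sphereArea N / 2 with hc
  set P := (4 * Real.pi * diffusivity J) ^ (-(N : ℝ) / 2) with hP
  have hP0 : 0 < P := by positivity
  set T' := max T 2 with hT'
  have hT'2 : 2 ≤ T' := le_max_right _ _
  have hlog2 : 0 < Real.log 2 := Real.log_pos one_lt_two
  -- The first two terms serve `t ≥ T'`, where the asymptotics hold with error `1`; the last serves
  -- `2 ≤ t < T'`, where `u ≤ M` and `t^{-N/2} log t ≥ T'^{-N/2} log 2`.
  refine ⟨|c| * P + 1 + M * T' ^ ((N : ℝ) / 2) / Real.log 2, fun t ht => ?_⟩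
  have ht0 : 0 < t := by linarith
  have hlog : Real.log 2 ≤ Real.log t := Real.log_le_log two_pos ht
  have hlog0 : 0 < Real.log t := hlog2.trans_le hlog
  have htp : 0 < t ^ ((N : ℝ) / 2) := Real.rpow_pos_of_pos ht0 _
  have htpn : 0 < t ^ (-((N : ℝ) / 2)) := Real.rpow_pos_of_pos ht0 _
  have hinv : t ^ ((N : ℝ) / 2) * t ^ (-((N : ℝ) / 2)) = 1 := by
    rw [← Real.rpow_add ht0, add_neg_cancel, Real.rpow_zero]
  have hsecond : 0 ≤ M * T' ^ ((N : ℝ) / 2) / Real.log 2 := by positivity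
  have hfirst : 0 ≤ |c| * P + 1 := by positivity
  rcases le_or_gt T' t with h1 | h1
  · filter_upwards [hT t ((le_max_left _ _).trans h1)] with x hx
    have h2 := rpow_mul_heatKernel_le ha ht0 x
    rw [← hP] at h2
    have hG := heatKernel_pos ha ht0 x
    set G := heatKernel (diffusivity J) t x
    have h3 : t ^ ((N : ℝ) / 2) * (u t x / Real.log t) ≤ |c| * P + 1 := by
      have h4 : t ^ ((N : ℝ) / 2) * (u t x / Real.log t - c * G) ≤ 1 :=
        (mul_le_mul_of_nonneg_left (le_abs_self _) htp.le).trans hx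
      have h5 : t ^ ((N : ℝ) / 2) * (c * G) ≤ |c| * P := by
        calc t ^ ((N : ℝ) / 2) * (c * G) = c * (t ^ ((N : ℝ) / 2) * G) := by ring
          _ ≤ |c| * (t ^ ((N : ℝ) / 2) * G) :=
              mul_le_mul_of_nonneg_right (le_abs_self c) (by positivity)
          _ ≤ |c| * P := mul_le_mul_of_nonneg_left h2 (abs_nonneg c)
      linarith
    have h6 : u t x = t ^ ((N : ℝ) / 2) * (u t x / Real.log t) *
        (t ^ (-((N : ℝ) / 2)) * Real.log t) := by
      field_simp
      linear_combination (-u t x) * hinv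
    rw [h6]
    exact mul_le_mul_of_nonneg_right (by linarith) (by positivity)
  · filter_upwards [hMu t ht0.le] with x hx
    have h2 : t ^ ((N : ℝ) / 2) ≤ T' ^ ((N : ℝ) / 2) :=
      Real.rpow_le_rpow ht0.le h1.le (by positivity)
    have h3 : 1 ≤ T' ^ ((N : ℝ) / 2) * t ^ (-((N : ℝ) / 2)) := by
      rw [← hinv]
      exact mul_le_mul_of_nonneg_right h2 htpn.le
    have h4 : 1 ≤ Real.log t / Real.log 2 := (one_le_div hlog2).2 hlog
    have h5 : M ≤ M * T' ^ ((N : ℝ) / 2) / Real.log 2 * (t ^ (-((N : ℝ) / 2)) * Real.log t) := by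
      have h6 : 1 ≤ (T' ^ ((N : ℝ) / 2) * t ^ (-((N : ℝ) / 2))) * (Real.log t / Real.log 2) :=
        one_le_mul_of_one_le_of_one_le h3 h4
      calc M ≤ M * ((T' ^ ((N : ℝ) / 2) * t ^ (-((N : ℝ) / 2))) * (Real.log t / Real.log 2)) :=
            le_mul_of_one_le_right hM0 h6
        _ = _ := by ring
    have h7 : 0 ≤ (|c| * P + 1) * (t ^ (-((N : ℝ) / 2)) * Real.log t) := by positivity
    linarith [le_abs_self (u t x)]

end Comparison

theorem theorem2p1 (N : ℕ) (A : ℝ) (hA : 0 < A) :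
    -- the constant `c = C_{A,N}` depends on `A` and `N` only
    ∃ c : ℝ, ∀ J : RSpace N → ℝ, IsDispersalKernel J →
      ∀ α : ℝ, 0 < α → α ≤ N →
      ∀ u₀ : RSpace N → ℝ, MemLp u₀ ∞ volume → (∀ᵐ x, 0 ≤ u₀ x) →
      Tendsto (fun x => ‖x‖ ^ α * u₀ x) (cocompact (RSpace N) ⊓ ae volume) (𝓝 A) →
      ∀ u : ℝ → RSpace N → ℝ, IsNonlocalSolution J u₀ u →
        (∀ uΔ : ℝ → RSpace N → ℝ, IsBoundedHeatSolution (diffusivity J) u₀ uΔ →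
          ∀ μ : ℝ, 0 < μ → μ < α / (2 * N) →
            ∃ C : ℝ, ∀ t : ℝ, 0 < t →
              ENNReal.ofReal (t ^ (α / 2)) * eLpNorm (fun x => u t x - uΔ t x) ∞ volume
                ≤ ENNReal.ofReal (C * t ^ (-μ))) ∧
        (α < N →
          (∃ C : ℝ, ∀ t : ℝ, 0 < t → ∀ᵐ x, u t x ≤ C * t ^ (-(α / 2))) ∧
          ∀ U : ℝ → RSpace N → ℝ, IsPowerHeatSolution (diffusivity J) α A U →
            ∀ K : ℝ, 0 < K →
              Tendsto (fun t : ℝ => ENNReal.ofReal (t ^ (α / 2)) *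
                parabolicSupNorm K t (fun x => u t x - U t x)) atTop (𝓝 0)) ∧
        (α = N →
          (∃ C : ℝ, ∀ t : ℝ, 2 ≤ t → ∀ᵐ x, u t x ≤ C * (t ^ (-((N : ℝ) / 2)) * Real.log t)) ∧
          ∀ K : ℝ, 0 < K →
            Tendsto (fun t : ℝ => ENNReal.ofReal (t ^ ((N : ℝ) / 2)) *
              parabolicSupNorm K t
                (fun x => u t x / Real.log t - c * heatKernel (diffusivity J) t x))
              atTop (𝓝 0)) := by
  refine ⟨A * sphereArea N / 2, fun J hJ α hα hαN u₀ hu₀ _ hlim u hu => ?_⟩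
  have hN : 0 < N := by exact_mod_cast hα.trans_le hαN
  obtain ⟨M₁, hM₁⟩ := hu.bounded
  -- One constant bounds both the datum and the solution at all times, as the Duhamel estimate
  -- expects.
  have hM : ∀ᵐ y, |u₀ y| ≤ max M₁ (lpNorm u₀ ∞ volume) :=
    (ae_le_lpNorm_exponent_top hu₀).mono fun y hy => hy.trans (le_max_right _ _)
  have hMu : ∀ t, 0 ≤ t → ∀ᵐ y, |u t y| ≤ max M₁ (lpNorm u₀ ∞ volume) := fun t ht =>
    (hM₁ t ht).mono fun y hy => hy.trans (le_max_left _ _)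
  refine ⟨fun uΔ huΔ μ hμ0 hμ =>
    nonlocal_sub_heat_eLpNorm_le hJ hN hu hu₀ hM hMu hα hαN hlim huΔ hμ0 hμ, fun hlt => ⟨?_, ?_⟩,
    fun heq => ?_⟩
  · exact nonlocal_le_rpow hJ hN hu hu₀.1 hM hMu hα hlt hlim
  · intro U hU K _
    exact nonlocal_tendsto_power_solution hJ hN hu hu₀.1 hM hMu hα hlt hlim hU K
  · subst heq
    refine ⟨nonlocal_le_rpow_mul_log hJ hN hu hu₀.1 hM hMu hlim, fun K _ => ?_⟩
    exact tendsto_parabolicSupNorm_zero fun ε hε =>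
      nonlocal_critical_asymptotics hJ hN hu hu₀.1 hM hMu hlim hε
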